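/- **Setting.** Let $G$ be a locally compact Hausdorff groupoid with (Hausdorff, locally compact) unit space $X$, source and range maps $s,r\colon G\to X$ and unit map $u\colon X\to G$. For $S\subseteq G$ and $Y\subseteq X$ put $S_Y=\{\gamma\in S: s(\gamma)\in Y\}$. Assume that $G$ has a Haar system $(\lambda^x)_{x\in X}$, and let $A$ be a $G$-algebra, that is, a $C_0(X)$-algebra with an action of $G$, given by isomorphisms $A_{s(\gamma)}\to A_{r(\gamma)}$, $a\mapsto\gamma(a)$, of its fibres. *$G$-orders.* A $G$-order is a subset $\mathfrak r\subseteq G$ with $u(s(\mathfrak r))\subseteq\mathfrak r$ and $\mathfrak r^{-1}=\mathfrak r$ such that $\mathfrak r_Y$ is compact for every compact $Y\subseteq X$. The set $\mathcal E_G$ of $G$-orders is a lattice for inclusion, with union and intersection; $\mathfrak r_1*\mathfrak r_2$ denotes the smallest $G$-order containing $(\mathfrak r_1\cdot\mathfrak r_2)\cup(\mathfrak r_2\cdot\mathfrak r_1)$, and $\mathfrak r^{*n}=\mathfrak r*\cdots*\mathfrak r$ ($n$ factors, which is the set of products of $n$ elements of $\mathfrak r$). *Decompositions.* An open subgroupoid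 $H$ with unit space $Y$ is relatively clopen if it is closed in $G_Y$. A coercive $\mathfrak r$-decomposition of $G$ is a quadruple $(V_1,V_2,H_1,H_2)$ where $V_1,V_2$ are open in $X$, $X=V_1\cup V_2$, there is a partition of unity subordinate to $(V_1,V_2)$, $H_1,H_2$ are relatively clopen open subgroupoids of $G$, and $\mathfrak r_{V_i}\subseteq H_i$ for $i=1,2$. *Crossed products.* Let $C_c(X;G,r^*A)$ and $C_c(X;G,s^*A)$ be the spaces of compactly supported elements of the pull-backs $r^*A$ and $s^*A$. The Hilbert module $L^2(G,A)$ is the completion of $C_c(X;G,s^*A)$ for $\langle\eta,\eta'\rangle(x)=\int\eta(\gamma^{-1})^*\eta'(\gamma^{-1})\,d\lambda^x(\gamma)$. Every $f\in C_c(X;G,r^*A)$ acts on it by $(f\cdot\xi)(\gamma)=\int\gamma^{-1}(f(\gamma'))\,\xi(\gamma'^{-1}\gamma)\,d\lambda^{r(\gamma)}(\gamma')$, and $A\rtimes_rG$ is the closure of these operators in the adjointable operators on $L^2(G,A)$. For a $G$-order $\mathfrak r$ and an open $V\subseteq X$, $A\rtimes_r\mathfrak r$ and $A\rtimes_r\mathfrak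 r_V$ are the closures in $A\rtimes_rG$ of the sets of $f\in C_c(X;G,r^*A)$ with support in $\mathfrak r$, respectively in $\mathfrak r_V$; for an open subgroupoid $H$, $A\rtimes_rH$ is the $C^*$-subalgebra of $A\rtimes_rG$ that is the closure of the set of $f\in C_c(X;G,r^*A)$ with support in $H$. *Filtrations.* A $C^*$-algebra $B$ is filtered by a family $(B_{\mathfrak s})_{\mathfrak s\in\mathcal E_G}$ of closed linear subspaces if $B_{\mathfrak s}\subseteq B_{\mathfrak s'}$ whenever $\mathfrak s\subseteq\mathfrak s'$, $B_{\mathfrak s}^*=B_{\mathfrak s}$, $B_{\mathfrak s}B_{\mathfrak s'}\subseteq B_{\mathfrak s*\mathfrak s'}$, and $\bigcup_{\mathfrak s}B_{\mathfrak s}$ is dense in $B$. **Theorem.** Let $\mathfrak r,\mathfrak r'$ be $G$-orders with $\mathfrak r^{*6}\subseteq\mathfrak r'$, let $(V_1,V_2,H_1,H_2)$ be a coercive $\mathfrak r'$-decomposition of $G$, and put $B=A\rtimes_rG$, $B_{\mathfrak s}=A\rtimes_r\mathfrak s$ for $\mathfrak s\in\mathcal E_G$, $\Delta_i=A\rtimes_r\mathfrak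 r_{V_i}$ and $D_i=A\rtimes_rH_i$. Then $B$ is filtered by $(B_{\mathfrak s})_{\mathfrak s\in\mathcal E_G}$, and $(\Delta_1,\Delta_2,D_1,D_2)$ is an $\mathfrak r$-controlled Mayer–Vietoris pair for $B$ with coercivity $2$, that is: 1. (complete coercive decomposition pair of order $\mathfrak r$ with coercivity $2$) $\Delta_1,\Delta_2$ are closed linear subspaces of $B_{\mathfrak r}$, and for every $G$-order $\mathfrak s\subseteq\mathfrak r$, every $n$ and every $x\in M_n(B_{\mathfrak s})$ there are $x_i\in M_n(\Delta_i\cap B_{\mathfrak s})$, $i=1,2$, with $x=x_1+x_2$ and $\|x_i\|\le2\|x\|$; 2. (neighbourhood $C^*$-algebras) for $i=1,2$, $D_i$ is a $C^*$-subalgebra of $B$, filtered by $(D_i\cap B_{\mathfrak s})_{\mathfrak s\in\mathcal E_G}$, and with $P=B_{\mathfrak r^{*5}}$, $\Delta_i+P\,\Delta_i+\Delta_i\,P+P\,\Delta_i\,P\subseteq D_i$; 3. (complete intersection approximation, CIA, with coercivity $2$) for every $G$-order $\mathfrak s$, every $\varepsilon>0$, every $n$, and all $x\in M_n(D_1\cap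 B_{\mathfrak s})$ and $y\in M_n(D_2\cap B_{\mathfrak s})$ with $\|x-y\|<\varepsilon$, there is $z\in M_n(D_1\cap D_2\cap B_{\mathfrak s})$ with $\|z-x\|<2\varepsilon$ and $\|z-y\|<2\varepsilon$. -/

import Mathlib

open Filter Topology MeasureTheory Set
open scoped ZeroAtInfty MultiplierAlgebra CStarAlgebra

set_option linter.unusedSectionVars false

noncomputable section

/-! Quotients of C⋆-algebras -/

/-- A closed two-sided ⋆-ideal of a C⋆-algebra. -/
structure ClosedStarIdeal (A : Type*) [NonUnitalCStarAlgebra A] extends Submodule ℂ A where ofSubmodule ::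
  isClosed : IsClosed (carrier : Set A)
  mul_left : ∀ (a : A) {b : A}, b ∈ carrier → a * b ∈ carrier
  mul_right : ∀ (a : A) {b : A}, b ∈ carrier → b * a ∈ carrier
  star_mem : ∀ {b : A}, b ∈ carrier → star b ∈ carrier

namespace ClosedStarIdeal

variable {A : Type*} [NonUnitalCStarAlgebra A] (J : ClosedStarIdeal A)

section Quotient

/-- The quotient C⋆-algebra, with the quotient norm. -/
def Quot : Type _ := A ⧸ J.toSubmodule

instance : IsClosed (J.toSubmodule : Set A) := J.isClosed

instance : NormedAddCommGroup J.Quot :=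
  inferInstanceAs (NormedAddCommGroup (A ⧸ J.toSubmodule))

instance : NormedSpace ℂ J.Quot := inferInstanceAs (NormedSpace ℂ (A ⧸ J.toSubmodule))

instance : CompleteSpace J.Quot := inferInstanceAs (CompleteSpace (A ⧸ J.toSubmodule))

/-- The quotient map. -/
def mk : A →ₗ[ℂ] J.Quot := J.toSubmodule.mkQ

theorem mk_surjective : Function.Surjective J.mk := J.toSubmodule.mkQ_surjective

theorem mk_eq_iff {a b : A} : J.mk a = J.mk b ↔ a - b ∈ J.toSubmodule :=
  Submodule.Quotient.eq J.toSubmodule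

theorem norm_mk_le (a : A) : ‖J.mk a‖ ≤ ‖a‖ := Submodule.Quotient.norm_mk_le J.toSubmodule a

theorem exists_norm_lt (q : J.Quot) {ε : ℝ} (hε : 0 < ε) : ∃ a, J.mk a = q ∧ ‖a‖ < ‖q‖ + ε :=
  Submodule.Quotient.norm_mk_lt (S := J.toSubmodule) q hε

instance : Mul J.Quot where
  mul := Quotient.map₂ (· * ·) (by
    intro a a' h b b' h'
    rw [← Quotient.eq_iff_equiv] at h h' ⊢
    replace h := (Submodule.Quotient.eq J.toSubmodule).1 h
    replace h' := (Submodule.Quotient.eq J.toSubmodule).1 h'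
    refine (Submodule.Quotient.eq J.toSubmodule).2 ?_
    have : a * b - a' * b' = (a - a') * b + a' * (b - b') := by noncomm_ring
    rw [this]
    exact J.toSubmodule.add_mem (J.mul_right _ h) (J.mul_left _ h'))

instance : Star J.Quot where
  star := Quotient.map star (by
    intro a a' h
    rw [← Quotient.eq_iff_equiv] at h ⊢
    replace h := (Submodule.Quotient.eq J.toSubmodule).1 h
    refine (Submodule.Quotient.eq J.toSubmodule).2 ?_
    rw [← star_sub]
    exact J.star_mem h)

theorem mk_mul (a b : A) : J.mk (a * b) = J.mk a * J.mk b := rfl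

theorem mk_star (a : A) : J.mk (star a) = star (J.mk a) := rfl

@[reducible] def ring : NonUnitalRing J.Quot where
  left_distrib a b c := by
    obtain ⟨a, rfl⟩ := J.mk_surjective a
    obtain ⟨b, rfl⟩ := J.mk_surjective b
    obtain ⟨c, rfl⟩ := J.mk_surjective c
    simp only [← map_add, ← mk_mul, mul_add]
  right_distrib a b c := by
    obtain ⟨a, rfl⟩ := J.mk_surjective a
    obtain ⟨b, rfl⟩ := J.mk_surjective b
    obtain ⟨c, rfl⟩ := J.mk_surjective c
    simp only [← map_add, ← mk_mul, add_mul]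
  zero_mul a := by
    obtain ⟨a, rfl⟩ := J.mk_surjective a
    rw [← map_zero J.mk, ← mk_mul, zero_mul]
  mul_zero a := by
    obtain ⟨a, rfl⟩ := J.mk_surjective a
    rw [← map_zero J.mk, ← mk_mul, mul_zero]
  mul_assoc a b c := by
    obtain ⟨a, rfl⟩ := J.mk_surjective a
    obtain ⟨b, rfl⟩ := J.mk_surjective b
    obtain ⟨c, rfl⟩ := J.mk_surjective c
    simp only [← mk_mul, mul_assoc]

attribute [local instance] ring

@[reducible] def starRing : StarRing J.Quot where
  star_involutive a := by
    obtain ⟨a, rfl⟩ := J.mk_surjective a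
    simp only [← mk_star, star_star]
  star_mul a b := by
    obtain ⟨a, rfl⟩ := J.mk_surjective a
    obtain ⟨b, rfl⟩ := J.mk_surjective b
    simp only [← mk_star, ← mk_mul, star_mul]
  star_add a b := by
    obtain ⟨a, rfl⟩ := J.mk_surjective a
    obtain ⟨b, rfl⟩ := J.mk_surjective b
    simp only [← mk_star, ← map_add, star_add]

attribute [local instance] starRing

/-- The ideal as a C⋆-algebra. -/
def toSub : NonUnitalStarSubalgebra ℂ A where
  toSubmodule := J.toSubmodule
  mul_mem' := fun {a _} _ hb => J.mul_left a hb
  star_mem' := J.star_mem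

instance : IsClosed (J.toSub : Set A) := J.isClosed

open CStarAlgebra in
theorem norm_sub_mul_le (a e : A) (c : A) (he : IsSelfAdjoint e) (he1 : ‖e‖ ≤ 1) (hpos : ∃ d, e = star d * d) : ‖a - a * e‖ ^ 2 ≤ ‖star a * a - star a * a * e‖ ∧ ‖c - c * e‖ ≤ ‖c‖ := by
  let _ := spectralOrder A
  have _ := spectralOrderedRing A
  let _ := spectralOrder A⁺¹
  have _ := spectralOrderedRing A⁺¹
  have h1 : ‖(1 - e : A⁺¹)‖ ≤ 1 := by
    obtain ⟨d, rfl⟩ := hpos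
    have h0 : (0 : A⁺¹) ≤ ((star d * d : A) : A⁺¹) := by
      rw [Unitization.inr_mul, Unitization.inr_star]
      exact star_mul_self_nonneg _
    have h1 : ((star d * d : A) : A⁺¹) ≤ 1 := by
      rw [← CStarAlgebra.norm_le_one_iff_of_nonneg _ h0]
      rw [Unitization.norm_inr]; exact he1
    rw [CStarAlgebra.norm_le_one_iff_of_nonneg _ (sub_nonneg.2 h1)]
    exact sub_le_self _ h0
  have key : ∀ b : A, ((b - b * e : A) : A⁺¹) = b * (1 - e : A⁺¹) := by
    intro b; simp [mul_sub]
  constructor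
  · have : ‖a - a * e‖ ^ 2 = ‖(1 - e : A⁺¹) * ((star a * a - star a * a * e : A) : A⁺¹)‖ := by
      rw [← Unitization.norm_inr (𝕜 := ℂ) (a - a * e), key, key, sq, ← CStarRing.norm_star_mul_self]
      congr 1
      have : star (1 - (e : A⁺¹)) = 1 - e := by
        rw [star_sub, star_one, ← Unitization.inr_star, he.star_eq]
      rw [star_mul, this]
      simp [mul_assoc]
    rw [this]
    refine (norm_mul_le _ _).trans ?_
    rw [Unitization.norm_inr]
    exact mul_le_of_le_one_left (norm_nonneg _) h1
  · rw [← Unitization.norm_inr (𝕜 := ℂ) (c - c * e), key]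
    refine (norm_mul_le _ _).trans ?_
    rw [Unitization.norm_inr]
    exact mul_le_of_le_one_right (norm_nonneg _) h1

theorem norm_mk_sq_le (a : A) : ‖J.mk a‖ * ‖J.mk a‖ ≤ ‖star (J.mk a) * J.mk a‖ := by
  let _ := CStarAlgebra.spectralOrder J.toSub
  have _ := CStarAlgebra.spectralOrderedRing J.toSub
  refine le_of_forall_pos_le_add fun ε hε => ?_
  obtain ⟨b, hb, hbn⟩ := J.exists_norm_lt (star (J.mk a) * J.mk a) (half_pos hε)
  rw [← mk_star, ← mk_mul, mk_eq_iff] at hb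
  set i : J.toSub := ⟨star a * a - b, by
    have := J.toSubmodule.neg_mem hb
    rwa [neg_sub] at this⟩ with hi
  have hl := CStarAlgebra.increasingApproximateUnit J.toSub
  have ht := hl.tendsto_mul_left i
  have hev : ∀ᶠ e in CStarAlgebra.approximateUnit J.toSub, ‖i * e - i‖ < ε / 2 := by
    have := (tendsto_iff_norm_sub_tendsto_zero.1 ht).eventually (gt_mem_nhds (half_pos hε))
    simpa using this
  obtain ⟨e, he, hpos, hn⟩ := (hev.and (hl.eventually_nonneg.and hl.eventually_norm)).exists
  obtain ⟨d, hd⟩ := CStarAlgebra.nonneg_iff_eq_star_mul_self.1 hpos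
  have hesa : IsSelfAdjoint (e : A) := congrArg Subtype.val (hpos.isSelfAdjoint : star e = e)
  obtain ⟨h1, h2⟩ := norm_sub_mul_le a (e : A) b hesa hn ⟨d, congrArg Subtype.val hd⟩
  have hmk : J.mk a = J.mk (a - a * e) := by
    rw [mk_eq_iff]
    have : a - (a - a * e) = a * (e : A) := by abel
    rw [this]
    exact J.mul_left _ e.2
  have h3 : ‖J.mk a‖ * ‖J.mk a‖ ≤ ‖star a * a - star a * a * e‖ := by
    rw [hmk, ← sq]
    exact (pow_le_pow_left₀ (norm_nonneg _) (J.norm_mk_le _) 2).trans h1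
  have h4 : star a * a - star a * a * (e : A) = (b - b * e) - ((i * e - i : J.toSub) : A) := by
    simp [hi]; noncomm_ring
  have h5 : ‖((i * e - i : J.toSub) : A)‖ < ε / 2 := he
  have := norm_sub_le (b - b * e) ((i * e - i : J.toSub) : A)
  rw [← h4] at this
  linarith

instance : NonUnitalCStarAlgebra J.Quot where
  __ := J.ring
  __ := J.starRing
  __ := (inferInstance : NormedAddCommGroup J.Quot)
  __ := (inferInstance : NormedSpace ℂ J.Quot)
  __ := (inferInstance : CompleteSpace J.Quot)
  norm_mul_le a b := by
    refine le_of_forall_pos_le_add fun ε hε => ?_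
    obtain ⟨δ, hδ, hδ'⟩ : ∃ δ : ℝ, 0 < δ ∧ (‖a‖ + δ) * (‖b‖ + δ) < ‖a‖ * ‖b‖ + ε := by
      have hc : Filter.Tendsto (fun δ : ℝ => (‖a‖ + δ) * (‖b‖ + δ)) (𝓝[>] 0) (𝓝 (‖a‖ * ‖b‖)) := by
        have : Continuous fun δ : ℝ => (‖a‖ + δ) * (‖b‖ + δ) := by fun_prop
        simpa using (this.tendsto 0).mono_left nhdsWithin_le_nhds
      have := (hc.eventually (gt_mem_nhds (lt_add_of_pos_right _ hε))).and self_mem_nhdsWithin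
      obtain ⟨δ, h1, h2⟩ := this.exists
      exact ⟨δ, h2, h1⟩
    obtain ⟨a', rfl, ha⟩ := J.exists_norm_lt a hδ
    obtain ⟨b', rfl, hb⟩ := J.exists_norm_lt b hδ
    rw [← mk_mul]
    refine (J.norm_mk_le _).trans ((norm_mul_le _ _).trans ?_)
    exact (mul_le_mul ha.le hb.le (norm_nonneg _) (by positivity)).trans hδ'.le
  norm_mul_self_le a := by
    obtain ⟨a, rfl⟩ := J.mk_surjective a
    exact J.norm_mk_sq_le a
  smul_assoc c a b := by
    obtain ⟨a, rfl⟩ := J.mk_surjective a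
    obtain ⟨b, rfl⟩ := J.mk_surjective b
    simp only [smul_eq_mul, ← map_smul, ← mk_mul, smul_mul_assoc]
  smul_comm c a b := by
    obtain ⟨a, rfl⟩ := J.mk_surjective a
    obtain ⟨b, rfl⟩ := J.mk_surjective b
    simp only [smul_eq_mul, ← map_smul, ← mk_mul, mul_smul_comm]
  star_smul c a := by
    obtain ⟨a, rfl⟩ := J.mk_surjective a
    simp only [← map_smul, ← mk_star, star_smul]

end Quotient

instance : PartialOrder J.Quot := CStarAlgebra.spectralOrder J.Quot

instance : StarOrderedRing J.Quot := CStarAlgebra.spectralOrderedRing J.Quot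

end ClosedStarIdeal

/-! Hilbert modules -/

theorem sesq_smul {R V : Type*} [NonUnitalCStarAlgebra R] [AddCommGroup V] [Module ℂ V]
    (B : V →ₗ⋆[ℂ] V →ₗ[ℂ] R) (c d : ℂ) (v w : V) :
    B (c • v) (d • w) = (starRingEnd ℂ) c • d • B v w := by
  rw [LinearMap.map_smulₛₗ B c v, LinearMap.smul_apply, LinearMap.map_smul]

section Forms

variable {R V : Type*} [NonUnitalCStarAlgebra R] [PartialOrder R] [StarOrderedRing R]
  [AddCommGroup V] [Module ℂ V]

/-- A positive sesquilinear form (conjugate-linear on the left) with values in a C⋆-algebra. -/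
structure IsPosForm (B : V →ₗ⋆[ℂ] V →ₗ[ℂ] R) : Prop where
  symm : ∀ v w, star (B v w) = B w v
  nonneg : ∀ v, 0 ≤ B v v

namespace IsPosForm

variable {B : V →ₗ⋆[ℂ] V →ₗ[ℂ] R}

theorem le_aux (hB : IsPosForm B) (v w : V) (t : ℝ) :
    t • (B v w + B w v) ≤ (t ^ 2) • B v v + B w w := by
  have h := hB.nonneg ((t : ℂ) • v - w)
  rw [← sub_nonneg]
  convert h using 1
  have e1 := sesq_smul B t t v v
  have e2 := sesq_smul B t 1 v w
  have e3 := sesq_smul B 1 t w v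
  simp only [one_smul, map_one, Complex.conj_ofReal, Complex.coe_smul] at e1 e2 e3
  simp only [map_sub, LinearMap.sub_apply, Complex.coe_smul]
  rw [e1, e2, e3, sq, mul_smul, smul_add]
  abel

theorem norm_le (hB : IsPosForm B) {v w : V} {a b : ℝ} (ha : 0 ≤ a) (hb : 0 ≤ b) (hv : ‖B v v‖ ≤ a ^ 2)
    (hw : ‖B w w‖ ≤ b ^ 2) (hvw : 0 ≤ B v w) : ‖B v w‖ ≤ a * b := by
  have hsym : B w v = B v w := by
    rw [← hB.symm v w]; exact hvw.isSelfAdjoint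
  have key : ∀ δ : ℝ, 0 < δ → ‖B v w‖ ≤ (a + δ) * (b + δ) := by
    intro δ hδ
    have ha' : 0 < a + δ := by positivity
    have hb' : 0 < b + δ := by positivity
    set t := (b + δ) / (a + δ) with ht
    have htp : 0 < t := by positivity
    have h := hB.le_aux v w t
    rw [hsym] at h
    have h0 : 0 ≤ t • (B v w + B v w) := smul_nonneg htp.le (add_nonneg hvw hvw)
    have h1 := CStarAlgebra.norm_le_norm_of_nonneg_of_le h0 h
    have h2 : ‖t • (B v w + B v w)‖ = t * (2 * ‖B v w‖) := by
      rw [← two_smul ℝ (B v w), norm_smul, norm_smul, Real.norm_of_nonneg htp.le]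
      norm_num
    have h3 : ‖t ^ 2 • B v v + B w w‖ ≤ t ^ 2 * a ^ 2 + b ^ 2 := by
      refine (norm_add_le _ _).trans ?_
      rw [norm_smul, Real.norm_of_nonneg (by positivity)]
      gcongr
    have h4 : t ^ 2 * a ^ 2 + b ^ 2 ≤ t * (2 * ((a + δ) * (b + δ))) := by
      have : t * (2 * ((a + δ) * (b + δ))) = t ^ 2 * (a + δ) ^ 2 + (b + δ) ^ 2 := by
        rw [ht]; field_simp; ring
      rw [this]
      gcongr <;> linarith
    have h5 : t * (2 * ‖B v w‖) ≤ t * (2 * ((a + δ) * (b + δ))) := by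
      rw [← h2]; exact h1.trans (h3.trans h4)
    have := le_of_mul_le_mul_left h5 htp
    linarith
  have hc : Tendsto (fun δ : ℝ => (a + δ) * (b + δ)) (𝓝[>] 0) (𝓝 (a * b)) := by
    have : Continuous fun δ : ℝ => (a + δ) * (b + δ) := by fun_prop
    simpa using (this.tendsto 0).mono_left nhdsWithin_le_nhds
  refine ge_of_tendsto hc ?_
  filter_upwards [self_mem_nhdsWithin] with δ hδ using key δ hδ

theorem norm_add_le (hB : IsPosForm B) {v w : V} {a b : ℝ} (ha : 0 ≤ a) (hb : 0 ≤ b) (hv : ‖B v v‖ ≤ a ^ 2)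
    (hw : ‖B w w‖ ≤ b ^ 2) : ‖B (v + w) (v + w)‖ ≤ (a + b) ^ 2 := by
  have key : ∀ δ : ℝ, 0 < δ → ‖B (v + w) (v + w)‖ ≤ ((a + δ) + (b + δ)) ^ 2 := by
    intro δ hδ
    have ha' : 0 < a + δ := by positivity
    have hb' : 0 < b + δ := by positivity
    set t := (b + δ) / (a + δ) with ht
    have htp : 0 < t := by positivity
    have h : B (v + w) (v + w) ≤ (1 + t) • B v v + (1 + t⁻¹) • B w w := by
      have h := smul_le_smul_of_nonneg_left (hB.le_aux v w t) (inv_pos.2 htp).le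
      rw [smul_smul, inv_mul_cancel₀ htp.ne', one_smul, smul_add, smul_smul] at h
      have e : t⁻¹ * t ^ 2 = t := by field_simp
      rw [e] at h
      have e2 : B (v + w) (v + w) = (B v v + B w w) + (B v w + B w v) := by
        simp only [map_add, LinearMap.add_apply]; abel
      rw [e2, add_smul, add_smul, one_smul, one_smul]
      calc _ ≤ (B v v + B w w) + (t • B v v + t⁻¹ • B w w) := by gcongr
        _ = _ := by abel
    have h1 := CStarAlgebra.norm_le_norm_of_nonneg_of_le (hB.nonneg _) h
    refine h1.trans ((_root_.norm_add_le _ _).trans ?_)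
    rw [norm_smul, norm_smul, Real.norm_of_nonneg (by positivity),
      Real.norm_of_nonneg (by positivity)]
    calc (1 + t) * ‖B v v‖ + (1 + t⁻¹) * ‖B w w‖
        ≤ (1 + t) * (a + δ) ^ 2 + (1 + t⁻¹) * (b + δ) ^ 2 := by
          gcongr
          · exact hv.trans (by gcongr; linarith)
          · exact hw.trans (by gcongr; linarith)
      _ = ((a + δ) + (b + δ)) ^ 2 := by rw [ht]; field_simp; ring
  have hc : Tendsto (fun δ : ℝ => ((a + δ) + (b + δ)) ^ 2) (𝓝[>] 0) (𝓝 ((a + b) ^ 2)) := by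
    have : Continuous fun δ : ℝ => ((a + δ) + (b + δ)) ^ 2 := by fun_prop
    simpa using (this.tendsto 0).mono_left nhdsWithin_le_nhds
  refine ge_of_tendsto hc ?_
  filter_upwards [self_mem_nhdsWithin] with δ hδ using key δ hδ

theorem norm_le_polar (hB : IsPosForm B) {v w : V} {a b : ℝ} (ha : 0 ≤ a) (hb : 0 ≤ b) (hv : ‖B v v‖ ≤ a ^ 2)
    (hw : ‖B w w‖ ≤ b ^ 2) : ‖B v w‖ ≤ 4 * a * b := by
  have main : ∀ (v w : V) (a b : ℝ), 0 ≤ a → 0 ≤ b → ‖B v v‖ ≤ a ^ 2 → ‖B w w‖ ≤ b ^ 2 →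
      ‖B v w‖ ≤ (a + b) ^ 2 := by
    intro v w a b ha hb hv hw
    have hsm : ∀ c : ℂ, ‖c‖ = 1 → ‖B (v + c • w) (v + c • w)‖ ≤ (a + b) ^ 2 := by
      intro c hc
      refine hB.norm_add_le ha hb hv ?_
      rw [sesq_smul, norm_smul, norm_smul]
      simpa [hc] using hw
    have e : (4 : ℂ) • B v w = B (v + (1 : ℂ) • w) (v + (1 : ℂ) • w)
        - B (v + (-1 : ℂ) • w) (v + (-1 : ℂ) • w)
        - Complex.I • B (v + Complex.I • w) (v + Complex.I • w)
        + Complex.I • B (v + (-Complex.I) • w) (v + (-Complex.I) • w) := by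
      simp only [map_add, LinearMap.add_apply, map_smulₛₗ, LinearMap.smul_apply, map_neg,
        Complex.conj_I, map_one, RingHom.id_apply]
      match_scalars <;> ring_nf <;> (simp [Complex.I_sq]; try norm_num)
    have h1 := hsm 1 (by simp)
    have h2 := hsm (-1) (by simp)
    have h3 := hsm Complex.I (by simp)
    have h4 := hsm (-Complex.I) (by simp)
    have : ‖(4 : ℂ) • B v w‖ ≤ 4 * (a + b) ^ 2 := by
      rw [e]
      refine (_root_.norm_add_le _ _).trans ?_
      refine (add_le_add_left ((norm_sub_le _ _).trans
        (add_le_add_left (norm_sub_le _ _) _)) _).trans ?_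
      rw [norm_smul, norm_smul, Complex.norm_I, one_mul, one_mul]
      linarith
    rw [norm_smul] at this
    norm_num at this
    linarith
  have key : ∀ δ : ℝ, 0 < δ → ‖B v w‖ ≤ 4 * (a + δ) * (b + δ) := by
    intro δ hδ
    have ha' : 0 < a + δ := by positivity
    have hb' : 0 < b + δ := by positivity
    set t := √((b + δ) / (a + δ)) with ht
    have htp : 0 < t := by positivity
    have ht2 : t ^ 2 = (b + δ) / (a + δ) := Real.sq_sqrt (by positivity)
    have h := main ((t : ℂ) • v) (((t⁻¹ : ℝ) : ℂ) • w) (t * (a + δ)) (t⁻¹ * (b + δ))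
      (by positivity) (by positivity) (by
        rw [sesq_smul, norm_smul, norm_smul]
        simp only [Complex.conj_ofReal, Complex.norm_real, Real.norm_of_nonneg htp.le]
        rw [mul_pow, ← mul_assoc, ← sq]
        have : ‖B v v‖ ≤ (a + δ) ^ 2 := hv.trans (by gcongr; linarith)
        gcongr) (by
        rw [sesq_smul, norm_smul, norm_smul]
        simp only [Complex.conj_ofReal, Complex.norm_real,
          Real.norm_of_nonneg (inv_pos.2 htp).le]
        rw [mul_pow, ← mul_assoc, ← sq]
        have : ‖B w w‖ ≤ (b + δ) ^ 2 := hw.trans (by gcongr; linarith)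
        gcongr)
    have e : B ((t : ℂ) • v) (((t⁻¹ : ℝ) : ℂ) • w) = B v w := by
      rw [sesq_smul, smul_smul, Complex.conj_ofReal,
        ← Complex.ofReal_mul, mul_inv_cancel₀ htp.ne', Complex.ofReal_one, one_smul]
    rw [e] at h
    refine h.trans (le_of_eq ?_)
    have e1 : t⁻¹ * (b + δ) = t * (a + δ) := by
      have : b + δ = t ^ 2 * (a + δ) := by rw [ht2]; field_simp
      rw [this]; field_simp
    have e3 : (t * (a + δ) + t⁻¹ * (b + δ)) ^ 2 = 4 * ((t ^ 2 * (a + δ)) * (a + δ)) := by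
      rw [e1]; ring
    rw [e3, ht2]; field_simp
  have hc : Tendsto (fun δ : ℝ => 4 * (a + δ) * (b + δ)) (𝓝[>] 0) (𝓝 (4 * a * b)) := by
    have : Continuous fun δ : ℝ => 4 * (a + δ) * (b + δ) := by fun_prop
    simpa using (this.tendsto 0).mono_left nhdsWithin_le_nhds
  refine ge_of_tendsto hc ?_
  filter_upwards [self_mem_nhdsWithin] with δ hδ using key δ hδ

end IsPosForm

end Forms

/-- A complex vector space with a bounded family, indexed by the points `x` of `X`, of positive
sesquilinear forms with values in C⋆-algebras `F x`: the fibrewise description of a pre-Hilbert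
module over a C⋆-algebra fibred over `X`. -/
structure PreHilbert (X : Type*) (F : X → Type*) (V : Type*)
    [∀ x, NonUnitalCStarAlgebra (F x)] [∀ x, PartialOrder (F x)] [∀ x, StarOrderedRing (F x)]
    [AddCommGroup V] [Module ℂ V] where
  form : ∀ x, V →ₗ⋆[ℂ] V →ₗ[ℂ] F x
  isPosForm : ∀ x, IsPosForm (form x)
  bdd : ∀ v, BddAbove (range fun x => ‖form x v v‖)

namespace PreHilbert

variable {X : Type*} {F : X → Type*} {V : Type*}
  [∀ x, NonUnitalCStarAlgebra (F x)] [∀ x, PartialOrder (F x)] [∀ x, StarOrderedRing (F x)]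
  [AddCommGroup V] [Module ℂ V] (H : PreHilbert X F V)

/-- The vector space with the seminorm `‖v‖ = sup_x ‖⟨v, v⟩(x)‖ ^ (1/2)`. -/
def Pre (_ : PreHilbert X F V) : Type _ := V

instance : AddCommGroup H.Pre := inferInstanceAs (AddCommGroup V)

instance : Module ℂ H.Pre := inferInstanceAs (Module ℂ V)

instance : Norm H.Pre where
  norm v := √(⨆ x, ‖H.form x v v‖)

theorem norm_def (v : H.Pre) : ‖v‖ = √(⨆ x, ‖H.form x v v‖) := rfl

theorem norm_form_le (x : X) (v : H.Pre) : ‖H.form x v v‖ ≤ ‖v‖ ^ 2 := by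
  rw [norm_def, Real.sq_sqrt (Real.iSup_nonneg fun _ => norm_nonneg _)]
  exact le_ciSup (H.bdd v) x

theorem norm_le_of_forall {v : H.Pre} {c : ℝ} (hc : 0 ≤ c) (h : ∀ x, ‖H.form x v v‖ ≤ c ^ 2) :
    ‖v‖ ≤ c := by
  rw [norm_def]
  exact Real.sqrt_le_iff.2 ⟨hc, Real.iSup_le h (by positivity)⟩

theorem core : SeminormedSpace.Core ℂ H.Pre where
  norm_nonneg v := Real.sqrt_nonneg _
  norm_smul c v := by
    have e : ∀ x, ‖H.form x (c • v) (c • v)‖ = ‖c‖ ^ 2 * ‖H.form x v v‖ := by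
      intro x
      have : H.form x (c • v) (c • v) = (starRingEnd ℂ) c • c • H.form x v v :=
        sesq_smul (H.form x) c c v v
      rw [this, norm_smul, norm_smul]; simp; ring
    rw [norm_def, norm_def]
    simp only [e]
    rw [← Real.mul_iSup_of_nonneg (by positivity), Real.sqrt_mul (by positivity),
      Real.sqrt_sq (norm_nonneg _)]
  norm_triangle v w :=
    H.norm_le_of_forall (add_nonneg (Real.sqrt_nonneg _) (Real.sqrt_nonneg _)) fun x =>
      (H.isPosForm x).norm_add_le (Real.sqrt_nonneg _) (Real.sqrt_nonneg _)
        (H.norm_form_le x v) (H.norm_form_le x w)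

instance : SeminormedAddCommGroup H.Pre := SeminormedAddCommGroup.ofCore H.core

instance : NormedSpace ℂ H.Pre where
  norm_smul_le c v := (H.core.norm_smul c v).le

/-- The Hausdorff completion of the seminormed space `H.Pre`. -/
def Space : Type _ := UniformSpace.Completion H.Pre

instance : NormedAddCommGroup H.Space :=
  inferInstanceAs (NormedAddCommGroup (UniformSpace.Completion H.Pre))

instance : NormedSpace ℂ H.Space :=
  inferInstanceAs (NormedSpace ℂ (UniformSpace.Completion H.Pre))

instance : CompleteSpace H.Space :=
  inferInstanceAs (CompleteSpace (UniformSpace.Completion H.Pre))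

def toPre (v : V) : H.Pre := v

/-- The canonical map to the completion. -/
def toSpace : V →ₗ[ℂ] H.Space :=
  (UniformSpace.Completion.toComplₗᵢ (𝕜 := ℂ) (E := H.Pre)).toLinearMap

theorem denseRange_toSpace : DenseRange H.toSpace :=
  UniformSpace.Completion.denseRange_coe (α := H.Pre)

theorem norm_toSpace (v : V) : ‖H.toSpace v‖ = ‖H.toPre v‖ :=
  UniformSpace.Completion.norm_coe (H.toPre v)

def innerFun (x : X) : H.Space × H.Space → F x :=
  ((UniformSpace.Completion.isDenseInducing_coe (α := H.Pre)).prodMap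
    (UniformSpace.Completion.isDenseInducing_coe (α := H.Pre))).extend
      fun p : H.Pre × H.Pre => H.form x p.1 p.2

theorem continuous_form (x : X) :
    Continuous fun p : H.Pre × H.Pre => H.form x p.1 p.2 := by
  let B : H.Pre →ₗ⋆[ℂ] H.Pre →ₗ[ℂ] F x := H.form x
  have hB : ∀ v w : H.Pre, ‖B v w‖ ≤ 4 * ‖v‖ * ‖w‖ := fun v w =>
    (H.isPosForm x).norm_le_polar (norm_nonneg v) (norm_nonneg w)
      (H.norm_form_le x v) (H.norm_form_le x w)
  exact ((B.mkContinuous₂ 4 hB).continuous.comp continuous_fst).clm_apply continuous_snd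

theorem continuous_innerFun (x : X) : Continuous (H.innerFun x) := by
  let φ : H.Pre →+ H.Pre →+ F x :=
    { toFun := fun v => (H.form x v).toAddMonoidHom
      map_zero' := by ext w; exact LinearMap.congr_fun (map_zero (H.form x)) w
      map_add' := fun v v' => by ext w; exact LinearMap.congr_fun (map_add (H.form x) v v') w }
  have : Continuous fun p : H.Pre × H.Pre => φ p.1 p.2 := H.continuous_form x
  exact (UniformSpace.Completion.isDenseInducing_toCompl H.Pre).extend_Z_bilin
    (UniformSpace.Completion.isDenseInducing_toCompl H.Pre) this

theorem innerFun_coe (x : X) (v w : V) :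
    H.innerFun x (H.toSpace v, H.toSpace w) = H.form x v w :=
  ((UniformSpace.Completion.isDenseInducing_coe (α := H.Pre)).prodMap
    (UniformSpace.Completion.isDenseInducing_coe (α := H.Pre))).extend_eq
      (H.continuous_form x) (v, w)

theorem eq_of_dense {Y : Type*} [TopologicalSpace Y] [T2Space Y] {f g : H.Space → Y}
    (hf : Continuous f) (hg : Continuous g) (h : ∀ v, f (H.toSpace v) = g (H.toSpace v))
    (ξ : H.Space) : f ξ = g ξ :=
  congrFun (H.denseRange_toSpace.equalizer hf hg (funext h)) ξ

theorem continuous_left (x : X) (η : H.Space) : Continuous fun ξ => H.innerFun x (ξ, η) :=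
  (H.continuous_innerFun x).comp (by fun_prop)

theorem continuous_right (x : X) (ξ : H.Space) : Continuous fun η => H.innerFun x (ξ, η) :=
  (H.continuous_innerFun x).comp (by fun_prop)

theorem innerFun_symm (x : X) (ξ η : H.Space) :
    star (H.innerFun x (ξ, η)) = H.innerFun x (η, ξ) := by
  refine H.eq_of_dense (f := fun ξ => star (H.innerFun x (ξ, η)))
    (continuous_star.comp (H.continuous_left x η)) (H.continuous_right x η) (fun v => ?_) ξ
  refine H.eq_of_dense (f := fun η => star (H.innerFun x (H.toSpace v, η)))
    (continuous_star.comp (H.continuous_right x _)) (H.continuous_left x _) (fun w => ?_) η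
  simp only [innerFun_coe]
  exact (H.isPosForm x).symm v w

theorem innerFun_add_right (x : X) (ξ η ζ : H.Space) :
    H.innerFun x (ξ, η + ζ) = H.innerFun x (ξ, η) + H.innerFun x (ξ, ζ) := by
  refine H.eq_of_dense (f := fun ξ => H.innerFun x (ξ, η + ζ)) (H.continuous_left x _)
    ((H.continuous_left x _).add (H.continuous_left x _)) (fun v => ?_) ξ
  refine H.eq_of_dense (f := fun η => H.innerFun x (_, η + ζ))
    ((H.continuous_right x _).comp (continuous_id.add continuous_const))
    ((H.continuous_right x _).add continuous_const) (fun w => ?_) η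
  refine H.eq_of_dense (f := fun ζ => H.innerFun x (_, H.toSpace w + ζ))
    ((H.continuous_right x _).comp (continuous_const.add continuous_id))
    (continuous_const.add (H.continuous_right x _)) (fun u => ?_) ζ
  simp only [← map_add, Pi.add_apply, innerFun_coe]

theorem innerFun_smul_right (x : X) (c : ℂ) (ξ η : H.Space) :
    H.innerFun x (ξ, c • η) = c • H.innerFun x (ξ, η) := by
  refine H.eq_of_dense (f := fun ξ => H.innerFun x (ξ, c • η)) (H.continuous_left x _)
    ((H.continuous_left x _).const_smul c) (fun v => ?_) ξ
  refine H.eq_of_dense (f := fun η => H.innerFun x (_, c • η))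
    ((H.continuous_right x _).comp (continuous_const_smul c))
    ((H.continuous_right x _).const_smul c) (fun w => ?_) η
  simp only [← map_smul, Pi.smul_apply, innerFun_coe]

/-- The extended inner product. -/
def inner (x : X) : H.Space →ₗ⋆[ℂ] H.Space →ₗ[ℂ] F x :=
  LinearMap.mk₂'ₛₗ (starRingEnd ℂ) (RingHom.id ℂ) (fun ξ η => H.innerFun x (ξ, η))
    (fun ξ ξ' η => by
      rw [← H.innerFun_symm x η, H.innerFun_add_right, star_add, H.innerFun_symm,
        H.innerFun_symm])
    (fun c ξ η => by
      rw [← H.innerFun_symm x η, H.innerFun_smul_right, star_smul, H.innerFun_symm]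
      rfl)
    (fun ξ η η' => H.innerFun_add_right x ξ η η')
    (fun c ξ η => H.innerFun_smul_right x c ξ η)

theorem inner_apply (x : X) (ξ η : H.Space) : H.inner x ξ η = H.innerFun x (ξ, η) := rfl

theorem inner_toSpace (x : X) (v w : V) :
    H.inner x (H.toSpace v) (H.toSpace w) = H.form x v w := H.innerFun_coe x v w

theorem continuous_inner_self (x : X) : Continuous fun ξ => H.inner x ξ ξ :=
  (H.continuous_innerFun x).comp (continuous_id.prodMk continuous_id)

theorem isPosForm_inner (x : X) : IsPosForm (H.inner x) where
  symm := H.innerFun_symm x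
  nonneg ξ := by
    refine H.denseRange_toSpace.induction_on (p := fun ξ => 0 ≤ H.inner x ξ ξ) ξ ?_ fun v => ?_
    · exact isClosed_le continuous_const (H.continuous_inner_self x)
    · rw [inner_toSpace]; exact (H.isPosForm x).nonneg v

theorem norm_inner_self_le (x : X) (ξ : H.Space) : ‖H.inner x ξ ξ‖ ≤ ‖ξ‖ ^ 2 := by
  refine H.denseRange_toSpace.induction_on (p := fun ξ => ‖H.inner x ξ ξ‖ ≤ ‖ξ‖ ^ 2) ξ ?_
    fun v => ?_
  · exact isClosed_le (H.continuous_inner_self x).norm (by fun_prop)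
  · rw [inner_toSpace, norm_toSpace]; exact H.norm_form_le x v

theorem norm_space_le {ξ : H.Space} {c : ℝ} (hc : 0 ≤ c) (h : ∀ x, ‖H.inner x ξ ξ‖ ≤ c ^ 2) :
    ‖ξ‖ ≤ c := by
  refine le_of_forall_pos_le_add fun ε hε => ?_
  obtain ⟨v, hv⟩ := Metric.denseRange_iff.1 H.denseRange_toSpace ξ (ε / 2) (half_pos hε)
  rw [dist_eq_norm] at hv
  have h1 : ‖H.toSpace v‖ ≤ c + ‖H.toSpace v - ξ‖ := by
    rw [norm_toSpace]
    refine H.norm_le_of_forall (by positivity) fun x => ?_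
    have := (H.isPosForm_inner x).norm_add_le hc (norm_nonneg (H.toSpace v - ξ)) (h x)
      (H.norm_inner_self_le x _)
    rw [add_sub_cancel, inner_toSpace] at this
    exact this
  have h2 : ‖ξ‖ ≤ ‖H.toSpace v‖ + ‖ξ - H.toSpace v‖ := by
    have := _root_.norm_add_le (H.toSpace v) (ξ - H.toSpace v)
    rwa [add_sub_cancel] at this
  rw [norm_sub_rev] at h1
  linarith

theorem ext_inner {ξ η : H.Space} (h : ∀ x ζ, H.inner x ζ ξ = H.inner x ζ η) : ξ = η := by
  rw [← sub_eq_zero, ← norm_eq_zero]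
  refine le_antisymm (H.norm_space_le le_rfl fun x => ?_) (norm_nonneg _)
  rw [map_sub, h x, sub_self]; simp

theorem inner_smul_left (x : X) (c : ℂ) (ξ η : H.Space) :
    H.inner x (c • ξ) η = (starRingEnd ℂ) c • H.inner x ξ η := by
  simp

/-- The ring of pairs `(T, S)` of bounded operators that are adjoint to each other:
`⟨T ξ, η⟩(x) = ⟨ξ, S η⟩(x)` for all `x`, `ξ`, `η`. Here `S` is determined by `T`; it is stored
in the opposite ring because `(T, S) (T', S') = (T T', S' S)`. -/
def adjointable : Subring ((H.Space →L[ℂ] H.Space) × (H.Space →L[ℂ] H.Space)ᵐᵒᵖ) where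
  carrier := {p | ∀ x ξ η, H.inner x (p.1 ξ) η = H.inner x ξ (p.2.unop η)}
  mul_mem' {p q} hp hq x ξ η := (hp x (q.1 ξ) η).trans (hq x ξ (p.2.unop η))
  one_mem' _ _ _ := rfl
  add_mem' {p q} hp hq x ξ η := by
    change H.inner x (p.1 ξ + q.1 ξ) η = H.inner x ξ (p.2.unop η + q.2.unop η)
    rw [map_add, map_add, LinearMap.add_apply, hp x, hq x]
  zero_mem' x ξ η := by
    change H.inner x 0 η = H.inner x ξ 0
    simp
  neg_mem' {p} hp x ξ η := by
    change H.inner x (-(p.1 ξ)) η = H.inner x ξ (-(p.2.unop η))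
    rw [map_neg, map_neg, LinearMap.neg_apply, hp x]

/-- The C⋆-algebra of adjointable operators on the completion, with the operator norm;
the involution exchanges an operator and its adjoint. -/
def Adjointable : Type _ := H.adjointable

namespace Adjointable

variable {H}

instance : NormedRing H.Adjointable := inferInstanceAs (NormedRing H.adjointable)

/-- The operator. -/
def op (T : H.Adjointable) : H.Space →L[ℂ] H.Space := T.1.1

/-- The adjoint operator. -/
def adj (T : H.Adjointable) : H.Space →L[ℂ] H.Space := T.1.2.unop

theorem inner_op (T : H.Adjointable) (x : X) (ξ η : H.Space) :
    H.inner x (T.op ξ) η = H.inner x ξ (T.adj η) := T.2 x ξ η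

theorem inner_adj (T : H.Adjointable) (x : X) (ξ η : H.Space) :
    H.inner x (T.adj ξ) η = H.inner x ξ (T.op η) := by
  rw [← (H.isPosForm_inner x).symm, ← T.inner_op, (H.isPosForm_inner x).symm]

/-- An adjoint pair as an adjointable operator. -/
def mkPair (T S : H.Space →L[ℂ] H.Space)
    (h : ∀ x ξ η, H.inner x (T ξ) η = H.inner x ξ (S η)) : H.Adjointable :=
  ⟨(T, MulOpposite.op S), h⟩

@[ext]
theorem ext {T S : H.Adjointable} (h : T.op = S.op) (h' : T.adj = S.adj) : T = S :=
  Subtype.ext (Prod.ext h (MulOpposite.unop_injective h'))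

theorem op_mul (T S : H.Adjointable) : (T * S).op = T.op * S.op := rfl
theorem adj_mul (T S : H.Adjointable) : (T * S).adj = S.adj * T.adj := rfl
theorem op_add (T S : H.Adjointable) : (T + S).op = T.op + S.op := rfl
theorem adj_add (T S : H.Adjointable) : (T + S).adj = T.adj + S.adj := rfl
theorem op_zero : (0 : H.Adjointable).op = 0 := rfl
theorem adj_zero : (0 : H.Adjointable).adj = 0 := rfl
theorem op_one : (1 : H.Adjointable).op = 1 := rfl
theorem adj_one : (1 : H.Adjointable).adj = 1 := rfl

theorem norm_eq_max (T : H.Adjointable) : ‖T‖ = max ‖T.op‖ ‖T.adj‖ := rfl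

instance : Star H.Adjointable where
  star T := mkPair T.adj T.op T.inner_adj

theorem op_star (T : H.Adjointable) : (star T).op = T.adj := rfl
theorem adj_star (T : H.Adjointable) : (star T).adj = T.op := rfl

instance : StarRing H.Adjointable where
  star_involutive _ := rfl
  star_mul _ _ := rfl
  star_add _ _ := rfl

instance : SMul ℂ H.Adjointable where
  smul c T := mkPair (c • T.op) ((starRingEnd ℂ) c • T.adj) fun x ξ η => by
    change H.inner x (c • T.op ξ) η = H.inner x ξ ((starRingEnd ℂ) c • T.adj η)
    rw [H.inner_smul_left, T.inner_op, map_smul]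

theorem op_smul (c : ℂ) (T : H.Adjointable) : (c • T).op = c • T.op := rfl
theorem adj_smul (c : ℂ) (T : H.Adjointable) : (c • T).adj = (starRingEnd ℂ) c • T.adj := rfl

instance : Module ℂ H.Adjointable where
  one_smul T := by ext1 <;> simp [op_smul, adj_smul]
  mul_smul c d T := by ext1 <;> simp [op_smul, adj_smul, mul_smul]
  smul_zero c := by ext1 <;> simp [op_smul, adj_smul, op_zero, adj_zero]
  smul_add c T S := by ext1 <;> simp [op_smul, adj_smul, op_add, adj_add]
  add_smul c d T := by ext1 <;> simp [op_smul, adj_smul, op_add, adj_add, add_smul]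
  zero_smul T := by ext1 <;> simp [op_smul, adj_smul, op_zero, adj_zero]

instance : Algebra ℂ H.Adjointable := Algebra.ofModule
  (fun c T S => by ext1 <;> simp [op_smul, adj_smul, op_mul, adj_mul])
  (fun c T S => by ext1 <;> simp [op_smul, adj_smul, op_mul, adj_mul])

instance : NormedAlgebra ℂ H.Adjointable where
  norm_smul_le c T := by
    rw [norm_eq_max, norm_eq_max, op_smul, adj_smul, norm_smul, norm_smul, RCLike.norm_conj,
      ← mul_max_of_nonneg _ _ (norm_nonneg c)]

instance : StarModule ℂ H.Adjointable where
  star_smul c T := by ext1 <;> simp [op_smul, adj_smul, op_star, adj_star]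

instance : CompleteSpace H.Adjointable := by
  have : IsClosed (H.adjointable :
      Set ((H.Space →L[ℂ] H.Space) × (H.Space →L[ℂ] H.Space)ᵐᵒᵖ)) := by
    have : (H.adjointable : Set ((H.Space →L[ℂ] H.Space) × (H.Space →L[ℂ] H.Space)ᵐᵒᵖ)) = ⋂ x, ⋂ ξ, ⋂ η, {p :
        (H.Space →L[ℂ] H.Space) × (H.Space →L[ℂ] H.Space)ᵐᵒᵖ |
          H.innerFun x (p.1 ξ, η) = H.innerFun x (ξ, p.2.unop η)} := by
      ext p; simp only [Set.mem_iInter]; rfl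
    rw [this]
    refine isClosed_iInter fun x => isClosed_iInter fun ξ => isClosed_iInter fun η => ?_
    refine isClosed_eq ((H.continuous_left x η).comp ?_) ((H.continuous_right x ξ).comp ?_)
    · fun_prop
    · have : Continuous fun p : (H.Space →L[ℂ] H.Space) × (H.Space →L[ℂ] H.Space)ᵐᵒᵖ =>
          p.2.unop := MulOpposite.continuous_unop.comp continuous_snd
      fun_prop
  exact this.completeSpace_coe

theorem norm_op_le (T : H.Adjointable) : ‖T.op‖ * ‖T.op‖ ≤ ‖T.adj * T.op‖ := by
  have h : ‖T.op‖ ≤ √‖T.adj * T.op‖ := by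
    refine T.op.opNorm_le_bound (Real.sqrt_nonneg _) fun ξ => ?_
    refine H.norm_space_le (by positivity) fun x => ?_
    have e : H.inner x (T.op ξ) (T.op ξ) = H.inner x ξ ((T.adj * T.op) ξ) := T.inner_op x _ _
    have h := (H.isPosForm_inner x).norm_le (norm_nonneg ξ) (norm_nonneg ((T.adj * T.op) ξ))
      (H.norm_inner_self_le x _) (H.norm_inner_self_le x _)
      (e ▸ (H.isPosForm_inner x).nonneg _)
    rw [e, mul_pow, Real.sq_sqrt (norm_nonneg _)]
    refine h.trans ?_
    have := mul_le_mul_of_nonneg_left ((T.adj * T.op).le_opNorm ξ) (norm_nonneg ξ)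
    linarith
  have := mul_self_le_mul_self (norm_nonneg _) h
  rwa [Real.mul_self_sqrt (norm_nonneg _)] at this

theorem norm_op_eq (T : H.Adjointable) : ‖T.adj‖ = ‖T.op‖ := by
  have key : ∀ T : H.Adjointable, ‖T.op‖ ≤ ‖T.adj‖ := by
    intro T
    by_cases h : ‖T.op‖ = 0
    · rw [h]; exact norm_nonneg _
    · have := T.norm_op_le.trans (norm_mul_le _ _)
      exact le_of_mul_le_mul_right this (lt_of_le_of_ne (norm_nonneg _) (Ne.symm h))
  exact le_antisymm (key (star T)) (key T)

instance : CStarAlgebra H.Adjointable where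
  norm_mul_self_le T := by
    have h : ‖T‖ = ‖T.op‖ := by rw [norm_eq_max, norm_op_eq, max_self]
    have h' : ‖star T * T‖ = ‖T.adj * T.op‖ := by
      rw [norm_eq_max, norm_op_eq, max_self]; rfl
    rw [h, h']
    exact T.norm_op_le

end Adjointable

end PreHilbert

/-! Groupoids -/

/-- A topological groupoid with space of arrows `G` and space of units `X`. The product
`mul a b` is only meaningful when `src a = rng b`; its other values play no role. -/
structure TopGroupoid (G X : Type*) [TopologicalSpace G] [TopologicalSpace X] where
  src : G → X
  rng : G → X
  unit : X → G
  mul : G → G → G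
  inv : G → G
  src_unit : ∀ x, src (unit x) = x
  rng_unit : ∀ x, rng (unit x) = x
  src_mul : ∀ {a b}, src a = rng b → src (mul a b) = src b
  rng_mul : ∀ {a b}, src a = rng b → rng (mul a b) = rng a
  mul_assoc : ∀ {a b c}, src a = rng b → src b = rng c → mul (mul a b) c = mul a (mul b c)
  mul_unit : ∀ a, mul a (unit (src a)) = a
  unit_mul : ∀ a, mul (unit (rng a)) a = a
  src_inv : ∀ a, src (inv a) = rng a
  rng_inv : ∀ a, rng (inv a) = src a
  mul_inv : ∀ a, mul a (inv a) = unit (rng a)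
  inv_mul : ∀ a, mul (inv a) a = unit (src a)
  continuous_src : Continuous src
  continuous_rng : Continuous rng
  continuous_unit : Continuous unit
  continuousOn_mul : ContinuousOn (fun p : G × G => mul p.1 p.2) {p | src p.1 = rng p.2}
  continuous_inv : Continuous inv

namespace TopGroupoid

variable {G X : Type*} [TopologicalSpace G] [TopologicalSpace X] (𝓖 : TopGroupoid G X)

theorem eq_inv {a b : G} (h : 𝓖.src a = 𝓖.rng b) (hab : 𝓖.mul a b = 𝓖.unit (𝓖.rng a)) :
    𝓖.inv a = b := by
  have h1 := 𝓖.mul_assoc (𝓖.src_inv a) h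
  rw [𝓖.inv_mul, hab, h, 𝓖.unit_mul, ← 𝓖.src_inv, 𝓖.mul_unit] at h1
  exact h1.symm

theorem inv_unit (x : X) : 𝓖.inv (𝓖.unit x) = 𝓖.unit x := by
  refine 𝓖.eq_inv (by rw [𝓖.src_unit, 𝓖.rng_unit]) ?_
  have := 𝓖.mul_unit (𝓖.unit x)
  rw [𝓖.src_unit] at this
  rw [this, 𝓖.rng_unit]

theorem inv_mul_rev {a b : G} (h : 𝓖.src a = 𝓖.rng b) :
    𝓖.inv (𝓖.mul a b) = 𝓖.mul (𝓖.inv b) (𝓖.inv a) := by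
  have h' : 𝓖.src (𝓖.inv b) = 𝓖.rng (𝓖.inv a) := by rw [𝓖.src_inv, 𝓖.rng_inv, h]
  refine 𝓖.eq_inv (by rw [𝓖.src_mul h, 𝓖.rng_mul h', 𝓖.rng_inv]) ?_
  rw [𝓖.mul_assoc h (by rw [𝓖.rng_mul h', 𝓖.rng_inv]),
    ← 𝓖.mul_assoc (𝓖.rng_inv b).symm h', 𝓖.mul_inv, ← h, ← 𝓖.rng_inv a, 𝓖.unit_mul, 𝓖.mul_inv,
    𝓖.rng_mul h]

theorem inv_inv (a : G) : 𝓖.inv (𝓖.inv a) = a :=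
  𝓖.eq_inv (𝓖.src_inv a) (by rw [𝓖.inv_mul, 𝓖.rng_inv])

/-- The product `S · T` of two sets of arrows. -/
def setMul (S T : Set G) : Set G :=
  {γ | ∃ a ∈ S, ∃ b ∈ T, 𝓖.src a = 𝓖.rng b ∧ γ = 𝓖.mul a b}

/-- The set `S_Y` of the elements of `S` with source in `Y`. -/
def restrictSrc (S : Set G) (Y : Set X) : Set G := S ∩ 𝓖.src ⁻¹' Y

end TopGroupoid

/-- A `G`-order: a symmetric set `r` of arrows that contains the units at the sources of its elements
and is such that `r_Y` is compact for every compact set `Y` of units. -/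
structure GOrder {G X : Type*} [TopologicalSpace G] [TopologicalSpace X]
    (𝓖 : TopGroupoid G X) where
  carrier : Set G
  unit_mem : ∀ γ ∈ carrier, 𝓖.unit (𝓖.src γ) ∈ carrier
  inv_mem : ∀ γ ∈ carrier, 𝓖.inv γ ∈ carrier
  isCompact : ∀ Y : Set X, IsCompact Y → IsCompact (𝓖.restrictSrc carrier Y)

/-- A coarse structure: a lattice with a commutative addition that is monotone in both variables. -/
class CoarseStructure (𝓔 : Type*) extends Lattice 𝓔, AddCommMagma 𝓔 where
  add_le_add' : ∀ a b c d : 𝓔, a ≤ b → c ≤ d → a + c ≤ b + d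

namespace GOrder

variable {G X : Type*} [TopologicalSpace G] [TopologicalSpace X] {𝓖 : TopGroupoid G X}

@[ext]
theorem ext {r₁ r₂ : GOrder 𝓖} (h : r₁.carrier = r₂.carrier) : r₁ = r₂ := by
  cases r₁; cases r₂; congr

/-- `G`-orders are ordered by inclusion; infimum and supremum are intersection and union. -/
instance [T2Space G] : Lattice (GOrder 𝓖) where
  le r₁ r₂ := r₁.carrier ⊆ r₂.carrier
  le_refl _ := Subset.rfl
  le_trans _ _ _ := Subset.trans
  le_antisymm _ _ h h' := ext (Subset.antisymm h h')
  sup r₁ r₂ :=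
    { carrier := r₁.carrier ∪ r₂.carrier
      unit_mem := fun γ h => h.imp (r₁.unit_mem γ) (r₂.unit_mem γ)
      inv_mem := fun γ h => h.imp (r₁.inv_mem γ) (r₂.inv_mem γ)
      isCompact := fun Y hY => by
        rw [TopGroupoid.restrictSrc, Set.union_inter_distrib_right]
        exact (r₁.isCompact Y hY).union (r₂.isCompact Y hY) }
  le_sup_left _ _ := subset_union_left
  le_sup_right _ _ := subset_union_right
  sup_le _ _ _ := union_subset
  inf r₁ r₂ :=
    { carrier := r₁.carrier ∩ r₂.carrier
      unit_mem := fun γ h => ⟨r₁.unit_mem γ h.1, r₂.unit_mem γ h.2⟩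
      inv_mem := fun γ h => ⟨r₁.inv_mem γ h.1, r₂.inv_mem γ h.2⟩
      isCompact := fun Y hY => by
        rw [TopGroupoid.restrictSrc, Set.inter_inter_distrib_right]
        exact (r₁.isCompact Y hY).inter (r₂.isCompact Y hY) }
  inf_le_left _ _ := inter_subset_left
  inf_le_right _ _ := inter_subset_right
  le_inf _ _ _ := subset_inter

theorem isCompact_setMul [T2Space X] (r₁ r₂ : GOrder 𝓖) {Y : Set X} (hY : IsCompact Y) :
    IsCompact (𝓖.restrictSrc (𝓖.setMul r₁.carrier r₂.carrier) Y) := by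
  have h2 := r₂.isCompact Y hY
  have h1 := r₁.isCompact _ (h2.image 𝓖.continuous_rng)
  have hc : IsClosed {p : G × G | 𝓖.src p.1 = 𝓖.rng p.2} :=
    isClosed_eq (𝓖.continuous_src.comp continuous_fst) (𝓖.continuous_rng.comp continuous_snd)
  have := ((h1.prod h2).inter_right hc).image_of_continuousOn
    (𝓖.continuousOn_mul.mono inter_subset_right)
  convert this using 1
  ext γ
  constructor
  · rintro ⟨⟨a, ha, b, hb, hab, rfl⟩, hγ⟩
    have hb' : 𝓖.src b ∈ Y := by rw [← 𝓖.src_mul hab]; exact hγ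
    exact ⟨(a, b), ⟨⟨⟨ha, ⟨b, ⟨hb, hb'⟩, hab.symm⟩⟩, ⟨hb, hb'⟩⟩, hab⟩, rfl⟩
  · rintro ⟨⟨a, b⟩, ⟨⟨⟨ha, -⟩, ⟨hb, hb'⟩⟩, hab⟩, rfl⟩
    exact ⟨⟨a, ha, b, hb, hab, rfl⟩, by rw [Set.mem_preimage, 𝓖.src_mul hab]; exact hb'⟩

/-- The set `(r₁ · r₂) ∪ (r₂ · r₁)`. -/
def starSet (r₁ r₂ : GOrder 𝓖) : Set G :=
  𝓖.setMul r₁.carrier r₂.carrier ∪ 𝓖.setMul r₂.carrier r₁.carrier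

theorem inv_mem_setMul {r₁ r₂ : GOrder 𝓖} {γ : G} (h : γ ∈ 𝓖.setMul r₁.carrier r₂.carrier) :
    𝓖.inv γ ∈ 𝓖.setMul r₂.carrier r₁.carrier := by
  obtain ⟨a, ha, b, hb, hab, rfl⟩ := h
  exact ⟨𝓖.inv b, r₂.inv_mem b hb, 𝓖.inv a, r₁.inv_mem a ha, by
    rw [𝓖.src_inv, 𝓖.rng_inv, hab], 𝓖.inv_mul_rev hab⟩

/-- The sum `r₁ + r₂` is the smallest `G`-order that contains `(r₁ · r₂) ∪ (r₂ · r₁)`: the units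
at the sources of this set are added to it. They already belong to it when `r₁ ⊆ r₂` or
`r₂ ⊆ r₁`, as for the powers of a single `G`-order. -/
instance [T2Space X] : Add (GOrder 𝓖) where
  add r₁ r₂ :=
    { carrier := starSet r₁ r₂ ∪ (fun γ => 𝓖.unit (𝓖.src γ)) '' starSet r₁ r₂
      unit_mem := by
        rintro γ (h | ⟨γ, h, rfl⟩)
        · exact Or.inr ⟨γ, h, rfl⟩
        · exact Or.inr ⟨γ, h, by simp only [𝓖.src_unit]⟩
      inv_mem := by
        rintro γ ((h | h) | ⟨γ, h, rfl⟩)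
        · exact Or.inl (Or.inr (inv_mem_setMul h))
        · exact Or.inl (Or.inl (inv_mem_setMul h))
        · exact Or.inr ⟨γ, h, (𝓖.inv_unit _).symm⟩
      isCompact := fun Y hY => by
        have h1 : IsCompact (𝓖.restrictSrc (starSet r₁ r₂) Y) := by
          rw [TopGroupoid.restrictSrc, starSet, Set.union_inter_distrib_right]
          exact (isCompact_setMul r₁ r₂ hY).union (isCompact_setMul r₂ r₁ hY)
        rw [TopGroupoid.restrictSrc, Set.union_inter_distrib_right]
        refine h1.union ?_
        convert h1.image (𝓖.continuous_unit.comp 𝓖.continuous_src) using 1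
        ext γ
        constructor
        · rintro ⟨⟨γ, h, rfl⟩, h'⟩
          exact ⟨γ, ⟨h, by simpa [𝓖.src_unit] using h'⟩, rfl⟩
        · rintro ⟨γ, ⟨h, h'⟩, rfl⟩
          exact ⟨⟨γ, h, rfl⟩, by simpa [𝓖.src_unit] using h'⟩ }

theorem add_carrier [T2Space X] (r₁ r₂ : GOrder 𝓖) : (r₁ + r₂).carrier =
    starSet r₁ r₂ ∪ (fun γ => 𝓖.unit (𝓖.src γ)) '' starSet r₁ r₂ := rfl

instance [T2Space G] [T2Space X] : CoarseStructure (GOrder 𝓖) where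
  add_comm r₁ r₂ := by
    ext1
    rw [add_carrier, add_carrier, starSet, starSet, Set.union_comm (𝓖.setMul r₁.carrier _)]
  add_le_add' a b c d hab hcd := by
    have h : starSet a c ⊆ starSet b d := by
      rintro γ (⟨x, hx, y, hy, h⟩ | ⟨x, hx, y, hy, h⟩)
      · exact Or.inl ⟨x, hab hx, y, hcd hy, h⟩
      · exact Or.inr ⟨x, hcd hx, y, hab hy, h⟩
    exact Set.union_subset_union h (Set.image_mono h)

end GOrder

/-- A subgroupoid: a set of arrows stable under products and inverses. -/
structure Subgroupoid {G X : Type*} [TopologicalSpace G] [TopologicalSpace X]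
    (𝓖 : TopGroupoid G X) where
  carrier : Set G
  mul_mem : ∀ a ∈ carrier, ∀ b ∈ carrier, 𝓖.src a = 𝓖.rng b → 𝓖.mul a b ∈ carrier
  inv_mem : ∀ a ∈ carrier, 𝓖.inv a ∈ carrier

namespace Subgroupoid

variable {G X : Type*} [TopologicalSpace G] [TopologicalSpace X] {𝓖 : TopGroupoid G X}

/-- The units of `G` that belong to `H`. -/
def unitSpace (H : Subgroupoid 𝓖) : Set X := {x | 𝓖.unit x ∈ H.carrier}

/-- An open subgroupoid. -/
def IsOpenSubgroupoid (H : Subgroupoid 𝓖) : Prop := IsOpen H.carrier ∧ IsOpen H.unitSpace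

/-- An open subgroupoid `H`, with space of units `Y`, that is closed in `G_Y`. -/
def IsRelativelyClopen (H : Subgroupoid 𝓖) : Prop :=
  H.IsOpenSubgroupoid ∧
    ∃ C : Set G, IsClosed C ∧ H.carrier = 𝓖.restrictSrc C H.unitSpace

end Subgroupoid

/-- An `r`-decomposition of the groupoid. -/
structure IsDecomposition {G X : Type*} [TopologicalSpace G] [TopologicalSpace X]
    {𝓖 : TopGroupoid G X} (r : GOrder 𝓖) (V₁ V₂ : Set X) (H₁ H₂ : Subgroupoid 𝓖) : Prop where
  isOpen₁ : IsOpen V₁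
  isOpen₂ : IsOpen V₂
  union_eq : V₁ ∪ V₂ = Set.univ
  partition : ∃ φ : PartitionOfUnity (Fin 2) X Set.univ, φ.IsSubordinate ![V₁, V₂]
  isOpenSubgroupoid₁ : H₁.IsOpenSubgroupoid
  isOpenSubgroupoid₂ : H₂.IsOpenSubgroupoid
  subset₁ : 𝓖.restrictSrc r.carrier V₁ ⊆ H₁.carrier
  subset₂ : 𝓖.restrictSrc r.carrier V₂ ⊆ H₂.carrier

/-- A coercive `r`-decomposition of the groupoid. -/
structure IsCoerciveDecomposition {G X : Type*} [TopologicalSpace G] [TopologicalSpace X]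
    {𝓖 : TopGroupoid G X} (r : GOrder 𝓖) (V₁ V₂ : Set X) (H₁ H₂ : Subgroupoid 𝓖) : Prop
    extends IsDecomposition r V₁ V₂ H₁ H₂ where
  isRelativelyClopen₁ : H₁.IsRelativelyClopen
  isRelativelyClopen₂ : H₂.IsRelativelyClopen

/-- A (left) Haar system: Radon measures `λ^x` with support the set of arrows of range `x`, such that
integrals of functions in `C_c(G)` are continuous in `x`, and which are invariant under left
translations. -/
structure HaarSystem {G X : Type*} [TopologicalSpace G] [TopologicalSpace X]
    [MeasurableSpace G] [BorelSpace G] (𝓖 : TopGroupoid G X) where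
  meas : X → Measure G
  regular : ∀ x, (meas x).Regular
  null_compl : ∀ x, meas x {γ | 𝓖.rng γ ≠ x} = 0
  pos : ∀ x, ∀ U : Set G, IsOpen U → (∃ γ ∈ U, 𝓖.rng γ = x) → 0 < meas x U
  continuous_integral : ∀ f : G → ℂ, Continuous f → HasCompactSupport f →
    Continuous fun x => ∫ γ, f γ ∂(meas x)
  integral_mul_left : ∀ f : G → ℂ, Continuous f → HasCompactSupport f → ∀ γ,
    ∫ γ', f (𝓖.mul γ γ') ∂(meas (𝓖.src γ)) = ∫ γ', f γ' ∂(meas (𝓖.rng γ))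

/-! C(X)-algebras -/

/-- A `C₀(X)`-algebra: a ⋆-homomorphism from `C₀(X)` to the centre of the multiplier algebra of `A`
such that `C₀(X) · A` is dense in `A`. -/
structure CXAlgebra (X A : Type*) [TopologicalSpace X] [NonUnitalCStarAlgebra A] where
  toMultiplier : C₀(X, ℂ) →⋆ₙₐ[ℂ] 𝓜(ℂ, A)
  central : ∀ f, toMultiplier f ∈ Set.center 𝓜(ℂ, A)
  dense : Dense {b : A | ∃ f a, b = (toMultiplier f).fst a}

namespace CXAlgebra

variable {X A : Type*} [TopologicalSpace X] [NonUnitalCStarAlgebra A] (C : CXAlgebra X A)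

/-- The product of `f ∈ C₀(X)` and `a ∈ A`. -/
def smul (f : C₀(X, ℂ)) (a : A) : A := (C.toMultiplier f).fst a

theorem smul_mul (f : C₀(X, ℂ)) (a b : A) : C.smul f (a * b) = a * C.smul f b := by
  have h := ((Set.mem_center_iff.1 (C.central f)).comm (a : 𝓜(ℂ, A))).eq
  have := congrArg (fun m : 𝓜(ℂ, A) => m.fst b) h
  simpa [smul] using this

theorem eq_of_mul_left {a b : A} (h : ∀ z : A, z * a = z * b) : a = b := by
  rw [← sub_eq_zero, ← CStarRing.star_mul_self_eq_zero_iff, mul_sub, h, sub_self]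

theorem smul_mul' (f : C₀(X, ℂ)) (a b : A) : C.smul f (a * b) = C.smul f a * b := by
  refine eq_of_mul_left fun z => ?_
  have h1 := (C.toMultiplier f).central z (a * b)
  have h2 := (C.toMultiplier f).central z a
  rw [smul, smul, ← mul_assoc z, ← h1, ← h2, mul_assoc]

theorem snd_eq (f : C₀(X, ℂ)) (a : A) : (C.toMultiplier f).snd a = C.smul f a := by
  have h : ∀ z, (C.toMultiplier f).snd a * z = C.smul f a * z := fun z => by
    rw [(C.toMultiplier f).central, ← smul_mul', smul_mul, smul]
  have := eq_of_mul_left (a := star ((C.toMultiplier f).snd a)) (b := star (C.smul f a))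
    fun z => by
      have := congrArg star (h (star z))
      simpa using this
  exact star_injective this

theorem star_smul (f : C₀(X, ℂ)) (a : A) : star (C.smul f a) = C.smul (star f) (star a) := by
  have h : C.toMultiplier (star f) = star (C.toMultiplier f) := map_star C.toMultiplier f
  rw [show C.smul (star f) (star a) = (C.toMultiplier (star f)).fst (star a) from rfl, h,
    DoubleCentralizer.star_fst, star_star, snd_eq]

/-- The ideal of `A` generated by the products `f · a` with `f x = 0`. -/
def ideal (x : X) : ClosedStarIdeal A where
  toSubmodule := (Submodule.span ℂ
    {b | ∃ f : C₀(X, ℂ), ∃ a : A, f x = 0 ∧ b = C.smul f a}).topologicalClosure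
  isClosed := Submodule.isClosed_topologicalClosure _
  mul_left a b hb := by
    refine map_mem_closure (f := fun b => a * b) (by fun_prop) hb fun c hc => ?_
    induction hc using Submodule.span_induction with
    | mem c hc =>
      obtain ⟨f, d, hf, rfl⟩ := hc
      exact Submodule.subset_span ⟨f, a * d, hf, (C.smul_mul f a d).symm⟩
    | zero => simp
    | add c d _ _ hc hd => simpa [mul_add] using Submodule.add_mem _ hc hd
    | smul t c _ hc => simpa [mul_smul_comm] using Submodule.smul_mem _ t hc
  mul_right a b hb := by
    refine map_mem_closure (f := fun b => b * a) (by fun_prop) hb fun c hc => ?_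
    induction hc using Submodule.span_induction with
    | mem c hc =>
      obtain ⟨f, d, hf, rfl⟩ := hc
      exact Submodule.subset_span ⟨f, d * a, hf, (C.smul_mul' f d a).symm⟩
    | zero => simp
    | add c d _ _ hc hd => simpa [add_mul] using Submodule.add_mem _ hc hd
    | smul t c _ hc => simpa [smul_mul_assoc] using Submodule.smul_mem _ t hc
  star_mem {b} hb := by
    refine map_mem_closure (f := fun b : A => star b) (by fun_prop) hb fun c hc => ?_
    induction hc using Submodule.span_induction with
    | mem c hc =>
      obtain ⟨f, d, hf, rfl⟩ := hc
      exact Submodule.subset_span ⟨star f, star d, by simp [hf], C.star_smul f d⟩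
    | zero => simp
    | add c d _ _ hc hd => simpa [star_add] using Submodule.add_mem _ hc hd
    | smul t c _ hc => simpa using Submodule.smul_mem _ (star t) hc

/-- The fibre `A_x`. -/
abbrev Fiber (x : X) : Type _ := (C.ideal x).Quot

/-- The evaluation `A → A_x`. -/
def eval (x : X) : A →ₗ[ℂ] C.Fiber x := (C.ideal x).mk

theorem norm_eval_le (x : X) (a : A) : ‖C.eval x a‖ ≤ ‖a‖ := (C.ideal x).norm_mk_le a

theorem continuous_eval (x : X) : Continuous (C.eval x) :=
  (LinearMap.mkContinuous (C.eval x) 1 fun a => by simpa using C.norm_eval_le x a).continuous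

section Sections

variable {G : Type*} [TopologicalSpace G] (q : G → X)

/-- The family `f` is an element of the pull-back `q^* A = C₀(G) ⊗_q A`, seen as a section of
its fibres `(q^* A)_γ = A_{q γ}`. As `q^* A` is the restriction of `C₀(G) ⊗ A = C₀(G, A)` to the graph
of `q`, these are the sections `γ ↦ ξ(γ)_{q γ}` with `ξ` in `C₀(G, A)`. -/
def IsSection (f : ∀ γ, C.Fiber (q γ)) : Prop :=
  ∃ ξ : C₀(G, A), ∀ γ, f γ = C.eval (q γ) (ξ γ)

/-- The support of a section: the complement of the largest open set on which it vanishes. -/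
def supp {q : G → X} (f : ∀ γ, C.Fiber (q γ)) : Set G := closure {γ | f γ ≠ 0}

/-- The elements of `q^* A` with compact support. -/
def Cc : Submodule ℂ (∀ γ, C.Fiber (q γ)) where
  carrier := {f | C.IsSection q f ∧ IsCompact (C.supp f)}
  add_mem' := by
    rintro f g ⟨⟨ξ, hξ⟩, hf⟩ ⟨⟨ζ, hζ⟩, hg⟩
    refine ⟨⟨ξ + ζ, fun γ => by simp [hξ, hζ]⟩, (hf.union hg).of_isClosed_subset isClosed_closure ?_⟩
    rw [supp, supp, supp, ← closure_union]
    refine closure_mono fun γ h => ?_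
    by_contra hn
    simp only [Set.mem_union, Set.mem_ofPred_eq, not_or, not_not] at hn
    exact h (by simp [hn.1, hn.2])
  zero_mem' := ⟨⟨0, fun γ => by simp⟩, by simp [supp]⟩
  smul_mem' := by
    rintro c f ⟨⟨ξ, hξ⟩, hf⟩
    refine ⟨⟨c • ξ, fun γ => by simp [hξ]⟩, hf.of_isClosed_subset isClosed_closure ?_⟩
    refine closure_mono fun γ h h' => h (by simp [h'])

/-- The value at `γ` of the restriction of a section to `q ⁻¹ {x}`, extended by `0`. -/
def onFiber {q : G → X} (f : ∀ γ, C.Fiber (q γ)) (x : X) (γ : G) : C.Fiber x :=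
  open Classical in if h : q γ = x then h ▸ f γ else 0

theorem onFiber_of_ne {q : G → X} (f : ∀ γ, C.Fiber (q γ)) {x : X} {γ : G} (h : q γ ≠ x) :
    C.onFiber f x γ = 0 := by simp [onFiber, h]

theorem onFiber_eval {q : G → X} {f : ∀ γ, C.Fiber (q γ)} {ξ : G → A}
    (hξ : ∀ γ, f γ = C.eval (q γ) (ξ γ)) {x : X} {γ : G} (h : q γ = x) :
    C.onFiber f x γ = C.eval x (ξ γ) := by
  subst h; simp [onFiber, hξ]

theorem onFiber_add {q : G → X} (f g : ∀ γ, C.Fiber (q γ)) (x : X) (γ : G) :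
    C.onFiber (f + g) x γ = C.onFiber f x γ + C.onFiber g x γ := by
  by_cases h : q γ = x
  · subst h; simp [onFiber]
  · simp [onFiber, h]

theorem onFiber_smul {q : G → X} (c : ℂ) (f : ∀ γ, C.Fiber (q γ)) (x : X) (γ : G) :
    C.onFiber (c • f) x γ = c • C.onFiber f x γ := by
  by_cases h : q γ = x
  · subst h; simp [onFiber]
  · simp [onFiber, h]

theorem onFiber_eq_zero {q : G → X} {f : ∀ γ, C.Fiber (q γ)} {γ : G} (h : γ ∉ C.supp f) (x : X) :
    C.onFiber f x γ = 0 := by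
  have h' : f γ = 0 := by
    by_contra hn
    exact h (subset_closure hn)
  by_cases hx : q γ = x
  · subst hx; simp [onFiber, h']
  · simp [onFiber, hx]

theorem norm_onFiber_le {q : G → X} {f : ∀ γ, C.Fiber (q γ)} {ξ : C₀(G, A)}
    (hξ : ∀ γ, f γ = C.eval (q γ) (ξ γ)) (x : X) (γ : G) :
    ‖C.onFiber f x γ‖ ≤ ‖ξ‖ := by
  by_cases h : q γ = x
  · rw [C.onFiber_eval hξ h]
    exact (C.norm_eval_le _ _).trans (ξ.toBCF.norm_coe_le_norm γ)
  · rw [C.onFiber_of_ne _ h]; simp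

end Sections

end CXAlgebra


/-! Groupoid actions and the reduced crossed product -/

/-- A `G`-algebra: a `C₀(X)`-algebra with an isomorphism `s^* A ≅ r^* A` of `C₀(G)`-algebras, given
by its fibres `α_γ : A_{s γ} ≃ A_{r γ}`, such that `α_{γ γ'} = α_γ ∘ α_{γ'}` when `γ` and `γ'` are composable.
The last identity is written on representatives in `A` of elements of the fibres, since the equality of
units `s γ = r γ'` is not definitional. -/
structure GAlgebra {G X : Type*} [TopologicalSpace G] [TopologicalSpace X]
    (𝓖 : TopGroupoid G X) (A : Type*) [NonUnitalCStarAlgebra A] extends CXAlgebra X A where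
  act : ∀ γ, toCXAlgebra.Fiber (𝓖.src γ) ≃⋆ₐ[ℂ] toCXAlgebra.Fiber (𝓖.rng γ)
  isSection_iff : ∀ f : ∀ γ, toCXAlgebra.Fiber (𝓖.src γ),
    toCXAlgebra.IsSection 𝓖.src f ↔ toCXAlgebra.IsSection 𝓖.rng fun γ => act γ (f γ)
  act_mul : ∀ γ γ', 𝓖.src γ = 𝓖.rng γ' → ∀ a b c : A,
    act γ' (toCXAlgebra.eval _ a) = toCXAlgebra.eval _ b →
    act γ (toCXAlgebra.eval _ b) = toCXAlgebra.eval _ c →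
    act (𝓖.mul γ γ') (toCXAlgebra.eval _ a) = toCXAlgebra.eval _ c

section L2

variable {G X A : Type*} [TopologicalSpace G] [TopologicalSpace X] [T2Space G]
  [LocallyCompactSpace G] [T2Space X] [MeasurableSpace G] [BorelSpace G] [NonUnitalCStarAlgebra A]
  {𝓖 : TopGroupoid G X} (lam : HaarSystem 𝓖) (C : CXAlgebra X A)

namespace HaarSystem

theorem exists_bound (K : Set G) (hK : IsCompact K) :
    ∃ M : ℝ, ∀ x, lam.meas x K ≤ ENNReal.ofReal M := by
  obtain ⟨χ, h1, -, hχc, hχ⟩ := exists_continuous_one_zero_of_isCompact hK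
    (isClosed_empty : IsClosed (∅ : Set G)) (Set.disjoint_empty K)
  have hcont : Continuous fun x => ∫ γ, ((χ γ : ℝ) : ℂ) ∂(lam.meas x) :=
    lam.continuous_integral (fun γ => ((χ γ : ℝ) : ℂ)) (by fun_prop)
      (hχc.comp_left (g := fun t : ℝ => (t : ℂ)) (by simp))
  have hc : IsCompact (𝓖.rng '' tsupport χ) := hχc.isCompact.image 𝓖.continuous_rng
  obtain ⟨M, hM⟩ := (hc.image hcont.norm).bddAbove
  refine ⟨max M 0, fun x => ?_⟩
  have := lam.regular x
  have hint : Integrable (fun γ => χ γ) (lam.meas x) :=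
    χ.continuous.integrable_of_hasCompactSupport hχc
  have hle : ∫ γ, χ γ ∂(lam.meas x) ≤ max M 0 := by
    by_cases hx : x ∈ 𝓖.rng '' tsupport χ
    · have h2 : ‖∫ γ, ((χ γ : ℝ) : ℂ) ∂(lam.meas x)‖ ≤ M := hM (Set.mem_image_of_mem _ hx)
      rw [integral_complex_ofReal, Complex.norm_real] at h2
      exact (le_abs_self _).trans (h2.trans (le_max_left _ _))
    · have : ∫ γ, χ γ ∂(lam.meas x) = 0 := by
        refine integral_eq_zero_of_ae ?_
        have h0 : ∀ᵐ γ ∂(lam.meas x), ¬ 𝓖.rng γ ≠ x := by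
          rw [ae_iff]; simpa using lam.null_compl x
        filter_upwards [h0] with γ hγ
        by_contra hne
        exact hx ⟨γ, subset_tsupport _ hne, not_not.1 hγ⟩
      rw [this]; exact le_max_right _ _
  calc lam.meas x K ≤ ENNReal.ofReal (∫ γ, χ γ ∂(lam.meas x)) := by
        refine hint.measure_le_integral (ae_of_all _ fun γ => (hχ γ).1) fun γ hγ => ?_
        exact le_of_eq (h1 hγ).symm
    _ ≤ _ := ENNReal.ofReal_le_ofReal hle

end HaarSystem

namespace L2

/-- The function `γ ↦ η(γ⁻¹)^* η'(γ⁻¹)` on the arrows of range `x`, with values in `A_x`. -/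
def integrand (η η' : ∀ γ, C.Fiber (𝓖.src γ)) (x : X) (γ : G) : C.Fiber x :=
  star (C.onFiber η x (𝓖.inv γ)) * C.onFiber η' x (𝓖.inv γ)

variable {C}

theorem integrand_eq_indicator {η η' : ∀ γ, C.Fiber (𝓖.src γ)} {ξ ξ' : G → A}
    (hξ : ∀ γ, η γ = C.eval (𝓖.src γ) (ξ γ)) (hξ' : ∀ γ, η' γ = C.eval (𝓖.src γ) (ξ' γ)) (x : X) :
    integrand C η η' x = ({γ | 𝓖.rng γ = x} ∩ 𝓖.inv ⁻¹' C.supp η).indicator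
      fun γ => star (C.eval x (ξ (𝓖.inv γ))) * C.eval x (ξ' (𝓖.inv γ)) := by
  ext γ
  by_cases h : 𝓖.rng γ = x
  · by_cases h' : 𝓖.inv γ ∈ C.supp η
    · have hm : γ ∈ {γ | 𝓖.rng γ = x} ∩ 𝓖.inv ⁻¹' C.supp η := ⟨h, h'⟩
      rw [Set.indicator_of_mem hm, integrand,
        C.onFiber_eval hξ (by rw [𝓖.src_inv, h]), C.onFiber_eval hξ' (by rw [𝓖.src_inv, h])]
    · rw [Set.indicator_of_notMem fun hh => h' hh.2, integrand, C.onFiber_eq_zero h']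
      simp
  · rw [Set.indicator_of_notMem fun hh => h hh.1, integrand,
      C.onFiber_of_ne η (by rw [𝓖.src_inv]; exact h)]
    simp

theorem isCompact_inv {η : ∀ γ, C.Fiber (𝓖.src γ)} (hη : IsCompact (C.supp η)) :
    IsCompact (𝓖.inv ⁻¹' C.supp η) := by
  convert hη.image 𝓖.continuous_inv using 1
  ext γ
  constructor
  · intro h; exact ⟨𝓖.inv γ, h, 𝓖.inv_inv γ⟩
  · rintro ⟨γ, h, rfl⟩
    rw [Set.mem_preimage, 𝓖.inv_inv]; exact h

theorem integrable {η η' : ∀ γ, C.Fiber (𝓖.src γ)} (hη : η ∈ C.Cc 𝓖.src)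
    (hη' : η' ∈ C.Cc 𝓖.src) (x : X) : Integrable (integrand C η η' x) (lam.meas x) := by
  obtain ⟨⟨ξ, hξ⟩, hc⟩ := hη
  obtain ⟨⟨ξ', hξ'⟩, -⟩ := hη'
  have := lam.regular x
  have hF : IsClosed {γ | 𝓖.rng γ = x} := isClosed_eq 𝓖.continuous_rng continuous_const
  have hK : IsCompact ({γ | 𝓖.rng γ = x} ∩ 𝓖.inv ⁻¹' C.supp η) := (isCompact_inv hc).inter_left hF
  rw [integrand_eq_indicator hξ hξ', integrable_indicator_iff hK.measurableSet]
  refine ContinuousOn.integrableOn_compact hK (Continuous.continuousOn ?_)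
  have h1 := (C.continuous_eval x).comp (ξ.continuous.comp 𝓖.continuous_inv)
  have h2 := (C.continuous_eval x).comp (ξ'.continuous.comp 𝓖.continuous_inv)
  exact h1.star.mul h2

variable (C)

/-- The space `C_c(X; G, s^* A)` with the inner products
`⟨η, η'⟩(x) = ∫ η(γ⁻¹)^* η'(γ⁻¹) dλ^x(γ)` in `A_x`. Its completion is `L²(G, A)`. -/
def preHilbert : PreHilbert X C.Fiber (C.Cc 𝓖.src) where
  form x := LinearMap.mk₂'ₛₗ (starRingEnd ℂ) (RingHom.id ℂ)
    (fun η η' => ∫ γ, integrand C η.1 η'.1 x γ ∂(lam.meas x))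
    (fun η₁ η₂ η' => by
      rw [← integral_add (integrable lam η₁.2 η'.2 x) (integrable lam η₂.2 η'.2 x)]
      congr 1; ext γ
      simp only [integrand, Submodule.coe_add, C.onFiber_add, star_add, add_mul])
    (fun c η η' => by
      rw [← integral_smul]
      congr 1; ext γ
      simp only [integrand, Submodule.coe_smul, C.onFiber_smul, star_smul, smul_mul_assoc]
      rfl)
    (fun η η₁ η₂ => by
      rw [← integral_add (integrable lam η.2 η₁.2 x) (integrable lam η.2 η₂.2 x)]
      congr 1; ext γ
      simp only [integrand, Submodule.coe_add, C.onFiber_add, mul_add])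
    (fun c η η' => by
      rw [← integral_smul]
      congr 1; ext γ
      simp only [integrand, Submodule.coe_smul, C.onFiber_smul, mul_smul_comm, RingHom.id_apply])
  isPosForm x :=
    { symm := fun η η' => by
        have := (starL' ℝ (A := C.Fiber x)).toContinuousLinearMap.integral_comp_comm
          (integrable lam η.2 η'.2 x)
        refine Eq.trans this.symm ?_
        refine integral_congr_ae (ae_of_all _ fun γ => ?_)
        simp [integrand]
      nonneg := fun η => integral_nonneg fun γ => star_mul_self_nonneg _ }
  bdd η := by
    obtain ⟨⟨ξ, hξ⟩, hc⟩ := η.2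
    obtain ⟨M, hM⟩ := lam.exists_bound _ (isCompact_inv hc)
    refine ⟨‖ξ‖ * ‖ξ‖ * max M 0, ?_⟩
    rintro _ ⟨x, rfl⟩
    have := lam.regular x
    have hK := isCompact_inv hc
    have hb : ∀ γ, ‖integrand C η.1 η.1 x γ‖ ≤
        (𝓖.inv ⁻¹' C.supp η.1).indicator (fun _ => ‖ξ‖ * ‖ξ‖) γ := by
      intro γ
      by_cases h' : 𝓖.inv γ ∈ C.supp η.1
      · rw [Set.indicator_of_mem (show γ ∈ 𝓖.inv ⁻¹' C.supp η.1 from h')]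
        refine (norm_mul_le _ _).trans ?_
        rw [norm_star]
        have := C.norm_onFiber_le hξ x (𝓖.inv γ)
        gcongr
      · rw [integrand, C.onFiber_eq_zero h']
        simp [Set.indicator_nonneg, mul_self_nonneg]
    have hfin : lam.meas x (𝓖.inv ⁻¹' C.supp η.1) < ⊤ := hK.measure_lt_top
    calc ‖∫ γ, integrand C η.1 η.1 x γ ∂(lam.meas x)‖
        ≤ ∫ γ, (𝓖.inv ⁻¹' C.supp η.1).indicator (fun _ => ‖ξ‖ * ‖ξ‖) γ ∂(lam.meas x) := by
          refine norm_integral_le_of_norm_le ?_ (ae_of_all _ hb)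
          rw [integrable_indicator_iff hK.measurableSet]
          exact integrableOn_const hfin.ne
      _ = (lam.meas x).real (𝓖.inv ⁻¹' C.supp η.1) * (‖ξ‖ * ‖ξ‖) := by
          rw [integral_indicator hK.measurableSet]; simp
      _ ≤ ‖ξ‖ * ‖ξ‖ * max M 0 := by
          rw [mul_comm]
          gcongr
          refine ENNReal.toReal_le_of_le_ofReal (le_max_right _ _) ((hM x).trans ?_)
          exact ENNReal.ofReal_le_ofReal (le_max_left _ _)

end L2

end L2

namespace GAlgebra

variable {G X A : Type*} [TopologicalSpace G] [TopologicalSpace X] [T2Space G]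
  [LocallyCompactSpace G] [T2Space X] [MeasurableSpace G] [BorelSpace G] [NonUnitalCStarAlgebra A]
  {𝓖 : TopGroupoid G X} (𝓐 : GAlgebra 𝓖 A) (lam : HaarSystem 𝓖)

/-- The section `γ ↦ ∫ γ⁻¹(f(γ')) ξ(γ'⁻¹ γ) dλ^{r γ}(γ')` of `s^* A`. -/
def conv (f : ∀ γ, 𝓐.Fiber (𝓖.rng γ)) (ξ : ∀ γ, 𝓐.Fiber (𝓖.src γ)) (γ : G) :
    𝓐.Fiber (𝓖.src γ) :=
  ∫ γ', (𝓐.act γ).symm (𝓐.onFiber f (𝓖.rng γ) γ') *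
    𝓐.onFiber ξ (𝓖.src γ) (𝓖.mul (𝓖.inv γ') γ) ∂(lam.meas (𝓖.rng γ))

/-- The C⋆-algebra of adjointable operators on `L²(G, A)`. -/
def AdjOps : Type _ := (L2.preHilbert lam 𝓐.toCXAlgebra).Adjointable

instance : CStarAlgebra (𝓐.AdjOps lam) :=
  inferInstanceAs (CStarAlgebra (L2.preHilbert lam 𝓐.toCXAlgebra).Adjointable)

/-- `T` is the operator of convolution by `f` on `L²(G, A)`. -/
def IsConvolution (f : ∀ γ, 𝓐.Fiber (𝓖.rng γ)) (T : 𝓐.AdjOps lam) : Prop :=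
  ∀ ξ : 𝓐.Cc 𝓖.src, ∃ ζ : 𝓐.Cc 𝓖.src, (∀ γ, ζ.1 γ = 𝓐.conv lam f ξ.1 γ) ∧
    PreHilbert.Adjointable.op T ((L2.preHilbert lam 𝓐.toCXAlgebra).toSpace ξ) =
      (L2.preHilbert lam 𝓐.toCXAlgebra).toSpace ζ

/-- The operators of convolution by the elements of `C_c(X; G, r^* A)` with support in `S`. -/
def convOps (S : Set G) : Set (𝓐.AdjOps lam) :=
  {T | ∃ f ∈ 𝓐.Cc 𝓖.rng, 𝓐.supp f ⊆ S ∧ 𝓐.IsConvolution lam f T}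

/-- The closed ⋆-subalgebra generated by the operators of convolution by elements of
`C_c(X; G, r^* A)` (these operators form a ⋆-algebra, so it is their closure). -/
def crossedSub : NonUnitalStarSubalgebra ℂ (𝓐.AdjOps lam) :=
  (NonUnitalStarAlgebra.adjoin ℂ (𝓐.convOps lam Set.univ)).topologicalClosure

instance : IsClosed (𝓐.crossedSub lam : Set (𝓐.AdjOps lam)) :=
  NonUnitalStarSubalgebra.isClosed_topologicalClosure _

/-- The reduced crossed product of `A` and `G`. -/
def ReducedCrossedProduct : Type _ := 𝓐.crossedSub lam

instance : NonUnitalCStarAlgebra (𝓐.ReducedCrossedProduct lam) :=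
  inferInstanceAs (NonUnitalCStarAlgebra (𝓐.crossedSub lam))

instance : PartialOrder (𝓐.ReducedCrossedProduct lam) := CStarAlgebra.spectralOrder _

instance : StarOrderedRing (𝓐.ReducedCrossedProduct lam) := CStarAlgebra.spectralOrderedRing _

/-- The inclusion in the adjointable operators. -/
def incl (T : 𝓐.ReducedCrossedProduct lam) : 𝓐.AdjOps lam := T.1

/-- The closed linear subspace generated by the elements of `C_c(X; G, r^* A)` with support
in `S`. -/
def supported (S : Set G) : Submodule ℂ (𝓐.ReducedCrossedProduct lam) :=
  (Submodule.span ℂ {T | 𝓐.incl lam T ∈ 𝓐.convOps lam S}).topologicalClosure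

/-- The reduced crossed product by an open subgroupoid `H`, as a C⋆-subalgebra of the reduced crossed
product by `G`: the closed ⋆-subalgebra generated by the elements of `C_c(X; G, r^* A)` with support
in `H`. -/
def subgroupoidAlgebra (H : Subgroupoid 𝓖) :
    NonUnitalStarSubalgebra ℂ (𝓐.ReducedCrossedProduct lam) :=
  (NonUnitalStarAlgebra.adjoin ℂ {T | 𝓐.incl lam T ∈ 𝓐.convOps lam H.carrier}).topologicalClosure

end GAlgebra

/-! Filtered C⋆-algebras and controlled Mayer–Vietoris pairs -/

/-- The closed subspaces `F E` form a filtration of the C⋆-algebra `B` by the coarse structure `𝓔`. -/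
structure IsFiltered {𝓔 B : Type*} [CoarseStructure 𝓔] [NonUnitalRing B] [StarRing B]
    [Module ℂ B] [TopologicalSpace B] (F : 𝓔 → Submodule ℂ B) : Prop where
  isClosed : ∀ E, IsClosed (F E : Set B)
  mono : ∀ E E', E ≤ E' → F E ≤ F E'
  star_mem : ∀ E, ∀ a ∈ F E, star a ∈ F E
  mul_mem : ∀ E E', ∀ a ∈ F E, ∀ b ∈ F E', a * b ∈ F (E + E')
  dense : Dense (⋃ E, (F E : Set B))

section MV

variable {𝓔 B : Type*} [CoarseStructure 𝓔] [NonUnitalCStarAlgebra B]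

/-- The subspace `D ∩ S` of `D`. -/
def traceOn (D : NonUnitalStarSubalgebra ℂ B) (S : Submodule ℂ B) : Submodule ℂ D where
  carrier := {d | (d : B) ∈ S}
  add_mem' := S.add_mem
  zero_mem' := S.zero_mem
  smul_mem' := fun c _ h => S.smul_mem c h

/-- `D` is an `E`-controlled `Δ`-neighbourhood C⋆-algebra. As `D` is a linear subspace, it contains
`Δ + B_{5E} Δ + Δ B_{5E} + B_{5E} Δ B_{5E}` as soon as it contains each of the four terms. -/
structure IsNeighborhoodAlgebra (F : 𝓔 → Submodule ℂ B) (E : 𝓔) (Δ : Submodule ℂ B)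
    (D : NonUnitalStarSubalgebra ℂ B) : Prop where
  isClosed : IsClosed (D : Set B)
  isFiltered : IsFiltered fun E' => traceOn D (F E')
  mem : ∀ d ∈ Δ, d ∈ D
  mul_mem_left : ∀ d ∈ Δ, ∀ a ∈ F (E + E + E + E + E), a * d ∈ D
  mul_mem_right : ∀ d ∈ Δ, ∀ a ∈ F (E + E + E + E + E), d * a ∈ D
  mul_mem_both : ∀ d ∈ Δ, ∀ a ∈ F (E + E + E + E + E), ∀ b ∈ F (E + E + E + E + E), a * d * b ∈ D

variable [PartialOrder B] [StarOrderedRing B]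

/-- The matrix `x` has its entries in `S`. -/
def MatrixIn {n : ℕ} (S : Set B) (x : CStarMatrix (Fin n) (Fin n) B) : Prop := ∀ i j, x i j ∈ S

/-- `(Δ₁, Δ₂)` is a complete coercive decomposition pair of order `E` with coercivity `c`.
The norm of `CStarMatrix` is the C⋆-norm of the matrix algebra. -/
structure IsCompleteCoerciveDecompositionPair (F : 𝓔 → Submodule ℂ B) (E : 𝓔)
    (Δ₁ Δ₂ : Submodule ℂ B) (c : ℝ) : Prop where
  isClosed₁ : IsClosed (Δ₁ : Set B)
  isClosed₂ : IsClosed (Δ₂ : Set B)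
  le₁ : Δ₁ ≤ F E
  le₂ : Δ₂ ≤ F E
  exists_decomp : ∀ E' ≤ E, ∀ (n : ℕ) (x : CStarMatrix (Fin n) (Fin n) B), MatrixIn (F E') x →
    ∃ x₁ x₂ : CStarMatrix (Fin n) (Fin n) B,
      MatrixIn (Δ₁ ⊓ F E' : Submodule ℂ B) x₁ ∧ MatrixIn (Δ₂ ⊓ F E' : Submodule ℂ B) x₂ ∧
      ‖x₁‖ ≤ c * ‖x‖ ∧ ‖x₂‖ ≤ c * ‖x‖ ∧ x = x₁ + x₂

/-- The complete intersection approximation property with coercivity `c`. -/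
def HasCIA (S₁ S₂ : Set B) (c : ℝ) : Prop :=
  ∀ ε : ℝ, 0 < ε → ∀ (n : ℕ) (x y : CStarMatrix (Fin n) (Fin n) B),
    MatrixIn S₁ x → MatrixIn S₂ y → ‖x - y‖ < ε →
    ∃ z : CStarMatrix (Fin n) (Fin n) B, MatrixIn (S₁ ∩ S₂) z ∧ ‖z - x‖ < c * ε ∧ ‖z - y‖ < c * ε

/-- `(Δ₁, Δ₂, D₁, D₂)` is an `E`-controlled Mayer–Vietoris pair, with coercivity `c`, for the
C⋆-algebra `B` filtered by `F`. -/
structure IsControlledMayerVietorisPair (F : 𝓔 → Submodule ℂ B) (E : 𝓔)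
    (Δ₁ Δ₂ : Submodule ℂ B) (D₁ D₂ : NonUnitalStarSubalgebra ℂ B) (c : ℝ) : Prop where
  isFiltered : IsFiltered F
  pos : 0 < c
  decomposition : IsCompleteCoerciveDecompositionPair F E Δ₁ Δ₂ c
  neighborhood₁ : IsNeighborhoodAlgebra F E Δ₁ D₁
  neighborhood₂ : IsNeighborhoodAlgebra F E Δ₂ D₂
  cia : ∀ E', HasCIA ((D₁ : Set B) ∩ F E') ((D₂ : Set B) ∩ F E') c

end MV

end

/-!
The elements of `A ⋊_r G` are limits of convolution operators, and everything rests on cutting down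
the supports of convolutions without increasing norms. Pointwise multiplication `f ↦ k f` by a
function `k` on `G` is a *contractive multiplier* (`GAlgebra.IsContractiveMultiplier`) if it decreases
the norms of the matrices of convolutions. In that case it extends to a completely contractive map
`Φ` of `A ⋊_r G` (`GAlgebra.exists_multiplier`), which maps `A ⋊_r 𝔰` to the part of it supported in
the support of `k` (`GAlgebra.map_mem_supported`). Two kinds of multipliers are used.

* `k = φ ∘ s`, for a function `φ` on `X` with `|φ| ≤ 1`: multiplication by `k` is the composition with
  a contraction of `L²(G, A)`. A partition of unity subordinate to `(V₁, V₂)` gives two such maps of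
  sum `1`, hence the decomposition `x = Φ₁ x + Φ₂ x` of
  `GAlgebra.isCompleteCoerciveDecompositionPair`, where even `‖Φᵢ x‖ ≤ ‖x‖`.
* `k γ = φ (r γ) φ (s γ)` on a relatively clopen subgroupoid `H`, and `k = 0` elsewhere, where the support
  of `φ` is contained in the unit space of `H`; relative clopenness makes `k` continuous. The arrows of
  range `x` and of source in the unit space of `H` are partitioned by the relation `a⁻¹ b ∈ H`, which
  is locally constant, so that a compact set meets finitely many classes
  (`IsCompact.exists_finset_separating`). In the fibre over `x`, the product by `k` is the compression of
  the convolution operator to the diagonal blocks of this partition, multiplied by `φ` on both sides,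
  and such a compression is contractive (`GAlgebra.isContractiveMultiplier_cutoff`).

The intersection approximation (`GAlgebra.hasCIA`) follows from the second kind with `H = H₁`: `x` is
close to a matrix `x'` of convolutions with compact supports in `H₁`, and for `φ` equal to `1` on the
sources and ranges of these supports, `Φ x' = x'`. Then `z = Φ y` is close to `Φ x' = x'`, hence to
`x` and `y`; it is supported in `H₁`, and as `Φ` does not increase supports, it stays in
`A ⋊_r H₂` and in `A ⋊_r 𝔰`. The condition on neighbourhoods (`GAlgebra.isNeighborhoodAlgebra`) is a
computation of supports of products.

Norms of matrices of operators are computed by their action on columns, in each fibre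
(`GAlgebra.norm_le_iff_convBound`), which reduces the estimates to inequalities between integrals over
the arrows of range `x`. There, convolution by `f` is an integral operator
(`GAlgebra.kernel`, `GAlgebra.onFiber_conv`), and left invariance and Fubini's theorem show that the
convolution operators form a ⋆-algebra (`GAlgebra.conv_mulSec`, `GAlgebra.form_conv`). That products
are again continuous sections is checked with the local notion of a continuous family of elements of
the fibres, `CXAlgebra.Approx`.
-/

noncomputable section

/-! ### Partitions of unity on compact sets -/

/-- A finite partition of unity on a compact set, subordinate to an open cover. -/
theorem IsCompact.exists_partition {G : Type*} [TopologicalSpace G] [T2Space G]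
    [LocallyCompactSpace G] {K : Set G} (hK : IsCompact K) {ι : Type*} {U : ι → Set G}
    (hU : ∀ i, IsOpen (U i)) (hKU : K ⊆ ⋃ i, U i) :
    ∃ (t : Finset ι) (h : t → C(G, ℝ)), (∀ i, HasCompactSupport (h i)) ∧
      (∀ i γ, h i γ ≠ 0 → γ ∈ U i) ∧ (∀ i γ, 0 ≤ h i γ) ∧ (∀ γ, ∑ i, h i γ ≤ 1) ∧
      ∀ γ ∈ K, ∑ i, h i γ = 1 := by
  obtain ⟨t, ht⟩ := hK.elim_finite_subcover U hU hKU
  obtain ⟨f, hf, hc⟩ := PartitionOfUnity.exists_isSubordinate_of_locallyFinite_t2space hK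
    (fun i : t => U i) (fun i => hU i) (locallyFinite_of_finite _) (by simpa [iUnion_subtype] using ht)
  refine ⟨t, f, hc, fun i γ h => hf i (subset_tsupport _ h), f.nonneg, fun γ => ?_, fun γ hγ => ?_⟩
  · rw [← finsum_eq_sum_of_fintype]; exact f.sum_le_one γ
  · rw [← finsum_eq_sum_of_fintype]; exact f.sum_eq_one hγ

/-- A convex combination of vectors at distance at most `ε` from `v` is at distance at most `ε`. -/
theorem norm_sub_convex_le {E ι : Type*} [NormedAddCommGroup E] [NormedSpace ℂ E] [Fintype ι]
    {h : ι → ℝ} (h0 : ∀ i, 0 ≤ h i) (h1 : ∑ i, h i = 1) {v : E} {w : ι → E} {ε : ℝ}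
    (hw : ∀ i, h i ≠ 0 → ‖v - w i‖ ≤ ε) : ‖v - ∑ i, (h i : ℂ) • w i‖ ≤ ε := by
  have e : v - ∑ i, (h i : ℂ) • w i = ∑ i, (h i : ℂ) • (v - w i) := by
    simp only [smul_sub, Finset.sum_sub_distrib, ← Finset.sum_smul, ← Complex.ofReal_sum, h1]
    simp
  rw [e]
  calc _ ≤ ∑ i, h i * ε := by
        refine norm_sum_le_of_le _ fun i _ => ?_
        rw [norm_smul, Complex.norm_real, Real.norm_of_nonneg (h0 i)]
        by_cases hi : h i = 0
        · simp [hi]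
        · exact mul_le_mul_of_nonneg_left (hw i hi) (h0 i)
    _ = ε := by rw [← Finset.sum_mul, h1, one_mul]

/-- A compactly supported continuous function as an element of `C₀`. -/
def zeroAtInftyOfCompact {G A : Type*} [TopologicalSpace G] [TopologicalSpace A] [Zero A]
    (f : G → A) (hf : Continuous f) (hc : HasCompactSupport f) : C₀(G, A) :=
  ⟨⟨f, hf⟩, hc.is_zero_at_infty⟩

theorem ZeroAtInftyContinuousMap.norm_le_of_forall {G A : Type*} [TopologicalSpace G]
    [NormedAddCommGroup A] {f : C₀(G, A)} {c : ℝ} (hc : 0 ≤ c) (h : ∀ γ, ‖f γ‖ ≤ c) : ‖f‖ ≤ c := by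
  rw [← ZeroAtInftyContinuousMap.norm_toBCF_eq_norm]
  exact (BoundedContinuousFunction.norm_le hc).2 h

theorem ZeroAtInftyContinuousMap.norm_apply_le' {G A : Type*} [TopologicalSpace G]
    [NormedAddCommGroup A] (f : C₀(G, A)) (γ : G) : ‖f γ‖ ≤ ‖f‖ := by
  rw [← ZeroAtInftyContinuousMap.norm_toBCF_eq_norm]
  exact f.toBCF.norm_coe_le_norm γ

/-! ### Continuous families of elements of the fibres -/

namespace CXAlgebra

variable {X A : Type*} [TopologicalSpace X] [NonUnitalCStarAlgebra A] (C : CXAlgebra X A)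

theorem eval_mul (x : X) (a b : A) : C.eval x (a * b) = C.eval x a * C.eval x b := rfl

theorem eval_star (x : X) (a : A) : C.eval x (star a) = star (C.eval x a) := rfl

theorem eval_surjective (x : X) : Function.Surjective (C.eval x) := (C.ideal x).mk_surjective

theorem exists_eval_eq_norm_lt (x : X) (v : C.Fiber x) {M : ℝ} (h : ‖v‖ < M) :
    ∃ a, C.eval x a = v ∧ ‖a‖ < M := by
  obtain ⟨a, ha, hn⟩ := (C.ideal x).exists_norm_lt v (sub_pos.2 h)
  exact ⟨a, ha, by linarith⟩

theorem smul_smul (f g : C₀(X, ℂ)) (a : A) : C.smul f (C.smul g a) = C.smul (f * g) a := by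
  simp [smul, map_mul]

/-- `C₀(X)` acts on the fibre at `y` through the evaluation at `y`. -/
theorem eval_smul (f : C₀(X, ℂ)) (b : A) (y : X) :
    C.eval y (C.smul f b) = f y • C.eval y b := by
  have hc : Continuous fun b => C.eval y (C.smul f b) :=
    (C.continuous_eval y).comp (C.toMultiplier f).fst.continuous
  have hc' : Continuous fun b => f y • C.eval y b := by
    exact (continuous_const_smul (f y)).comp (C.continuous_eval y)
  refine congrFun (hc.ext_on C.dense hc' ?_) b
  rintro _ ⟨g, a, rfl⟩
  change C.eval y (C.smul f (C.smul g a)) = f y • C.eval y (C.smul g a)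
  rw [C.smul_smul, ← map_smul, ← sub_eq_zero, ← map_sub]
  have h : C.smul (f * g) a - f y • C.smul g a = C.smul (f * g - f y • g) a := by
    simp [smul, map_sub]
  rw [h, ← map_zero (C.eval y), eval, ClosedStarIdeal.mk_eq_iff, sub_zero]
  exact Submodule.le_topologicalClosure _ (Submodule.subset_span ⟨_, a, by simp, rfl⟩)

/-- The norm of `a` in the fibres is upper semicontinuous. -/
theorem eventually_norm_eval_lt {a : A} {x : X} {ε : ℝ} (h : ‖C.eval x a‖ < ε) :
    ∀ᶠ y in 𝓝 x, ‖C.eval y a‖ < ε := by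
  obtain ⟨a', ha', hn⟩ := C.exists_eval_eq_norm_lt x (C.eval x a) h
  have hδ : 0 < (ε - ‖a'‖) / 2 := by linarith
  have hmem : a - a' ∈ (C.ideal x).toSubmodule := (C.ideal x).mk_eq_iff.1 ha'.symm
  obtain ⟨b, hb, hab⟩ := Metric.mem_closure_iff.1 hmem _ hδ
  rw [dist_eq_norm] at hab
  have hlim : Tendsto (fun y => ‖C.eval y b‖) (𝓝 x) (𝓝 0) := by
    clear hab
    induction hb using Submodule.span_induction with
    | mem c hc =>
      obtain ⟨f, d, hf, rfl⟩ := hc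
      have h1 : Tendsto (fun y => ‖f y‖ * ‖d‖) (𝓝 x) (𝓝 0) := by
        have : Tendsto (fun y => ‖f y‖ * ‖d‖) (𝓝 x) (𝓝 (‖f x‖ * ‖d‖)) :=
          ((map_continuous f).norm.mul continuous_const).tendsto x
        simpa [hf] using this
      refine squeeze_zero (fun _ => norm_nonneg _) (fun y => ?_) h1
      rw [eval_smul, norm_smul]
      gcongr
      exact C.norm_eval_le y d
    | zero => simp
    | add c d _ _ hc hd =>
      refine squeeze_zero (fun _ => norm_nonneg _) (fun y => ?_) (by simpa using hc.add hd)
      rw [map_add]; exact norm_add_le _ _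
    | smul t c _ hc =>
      refine squeeze_zero (fun _ => norm_nonneg _) (fun y => ?_)
        (by simpa using hc.const_mul ‖t‖)
      rw [map_smul, norm_smul]
  filter_upwards [hlim.eventually (gt_mem_nhds hδ)] with y hy
  have e : a = a' + (a - a' - b) + b := by abel
  calc ‖C.eval y a‖ = ‖C.eval y a' + C.eval y (a - a' - b) + C.eval y b‖ := by
        rw [← map_add, ← map_add, ← e]
    _ ≤ ‖a'‖ + ‖a - a' - b‖ + ‖C.eval y b‖ :=
        (norm_add₃_le).trans (by gcongr <;> exact C.norm_eval_le y _)
    _ < ε := by linarith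

/-- The family `z ↦ F z` of elements of the fibres over `q z` is continuous along the filter `l`:
it is approximated by the images of a single element of `A`. -/
def Approx {Z : Type*} (l : Filter Z) (q : Z → X) (F : ∀ z, C.Fiber (q z)) : Prop :=
  ∀ ε : ℝ, 0 < ε → ∃ a : A, ∀ᶠ z in l, ‖F z - C.eval (q z) a‖ < ε

namespace Approx

variable {C} {Z : Type*} {l : Filter Z} {q : Z → X} {F F' : ∀ z, C.Fiber (q z)}

theorem congr' (h : C.Approx l q F) (hF : ∀ᶠ z in l, F z = F' z) : C.Approx l q F' :=
  fun ε hε => (h ε hε).imp fun a ha => by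
    filter_upwards [ha, hF] with z hz hz'
    rwa [← hz']

theorem comp {W : Type*} {m : Filter W} (h : C.Approx l q F) {p : W → Z} (hp : Tendsto p m l) :
    C.Approx m (fun w => q (p w)) fun w => F (p w) :=
  fun ε hε => (h ε hε).imp fun _ ha => hp.eventually ha

/-- A uniform limit of continuous families is continuous. -/
theorem of_forall_exists (h : ∀ ε : ℝ, 0 < ε → ∃ F' : ∀ z, C.Fiber (q z), C.Approx l q F' ∧
    ∀ᶠ z in l, ‖F z - F' z‖ < ε) : C.Approx l q F := fun ε hε => by
  obtain ⟨F', hF', h1⟩ := h (ε / 2) (half_pos hε)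
  obtain ⟨a, h2⟩ := hF' (ε / 2) (half_pos hε)
  refine ⟨a, ?_⟩
  filter_upwards [h1, h2] with z h1 h2
  have := norm_add_le (F z - F' z) (F' z - C.eval (q z) a)
  rw [sub_add_sub_cancel] at this
  linarith

theorem eventually_bounded (h : C.Approx l q F) : ∃ M : ℝ, 0 < M ∧ ∀ᶠ z in l, ‖F z‖ ≤ M := by
  obtain ⟨a, ha⟩ := h 1 one_pos
  refine ⟨‖a‖ + 1, by positivity, ?_⟩
  filter_upwards [ha] with z hz
  have := norm_add_le (F z - C.eval (q z) a) (C.eval (q z) a)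
  rw [sub_add_cancel] at this
  have := C.norm_eval_le (q z) a
  linarith

theorem add (h : C.Approx l q F) (h' : C.Approx l q F') :
    C.Approx l q fun z => F z + F' z := fun ε hε => by
  obtain ⟨a, ha⟩ := h (ε / 2) (half_pos hε)
  obtain ⟨b, hb⟩ := h' (ε / 2) (half_pos hε)
  refine ⟨a + b, ?_⟩
  filter_upwards [ha, hb] with z ha hb
  rw [map_add, add_sub_add_comm]
  have := norm_add_le (F z - C.eval (q z) a) (F' z - C.eval (q z) b)
  linarith

theorem star (h : C.Approx l q F) : C.Approx l q fun z => star (F z) := fun ε hε => by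
  obtain ⟨a, ha⟩ := h ε hε
  refine ⟨Star.star a, ?_⟩
  filter_upwards [ha] with z ha
  rwa [eval_star, ← star_sub, norm_star]

theorem smul {h : Z → ℂ} {c : ℂ} (hh : Tendsto h l (𝓝 c)) (hF : C.Approx l q F) :
    C.Approx l q fun z => h z • F z := by
  obtain ⟨M, hM, hb⟩ := hF.eventually_bounded
  refine of_forall_exists fun ε hε => ⟨fun z => c • F z, fun δ hδ => ?_, ?_⟩
  · obtain ⟨a, ha⟩ := hF (δ / (‖c‖ + 1)) (by positivity)
    refine ⟨c • a, ?_⟩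
    filter_upwards [ha] with z ha
    rw [map_smul, ← smul_sub, norm_smul]
    calc ‖c‖ * _ ≤ (‖c‖ + 1) * ‖F z - C.eval (q z) a‖ := by gcongr; linarith
      _ < (‖c‖ + 1) * (δ / (‖c‖ + 1)) := by gcongr
      _ = δ := by field_simp
  · have h1 := (tendsto_iff_norm_sub_tendsto_zero.1 hh).eventually (gt_mem_nhds (div_pos hε hM))
    filter_upwards [h1, hb] with z h1 h2
    rw [← sub_smul, norm_smul]
    calc ‖h z - c‖ * ‖F z‖ ≤ ‖h z - c‖ * M := by gcongr
      _ < ε / M * M := by gcongr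
      _ = ε := by field_simp

theorem mul (h : C.Approx l q F) (h' : C.Approx l q F') :
    C.Approx l q fun z => F z * F' z := by
  obtain ⟨M, hM, hb⟩ := h'.eventually_bounded
  intro ε hε
  obtain ⟨a, ha⟩ := h (ε / (2 * M)) (by positivity)
  obtain ⟨b, hb'⟩ := h' (ε / (2 * (‖a‖ + 1))) (by positivity)
  refine ⟨a * b, ?_⟩
  filter_upwards [ha, hb, hb'] with z h1 h2 h3
  have e : F z * F' z - C.eval (q z) (a * b) = (F z - C.eval (q z) a) * F' z +
      C.eval (q z) a * (F' z - C.eval (q z) b) := by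
    rw [eval_mul, sub_mul, mul_sub]; abel
  rw [e]
  have h4 := C.norm_eval_le (q z) a
  calc _ ≤ ‖F z - C.eval (q z) a‖ * ‖F' z‖ + ‖C.eval (q z) a‖ * ‖F' z - C.eval (q z) b‖ :=
        (norm_add_le _ _).trans (add_le_add (norm_mul_le _ _) (norm_mul_le _ _))
    _ ≤ ‖F z - C.eval (q z) a‖ * M + (‖a‖ + 1) * ‖F' z - C.eval (q z) b‖ := by
        gcongr; linarith
    _ < ε / (2 * M) * M + (‖a‖ + 1) * (ε / (2 * (‖a‖ + 1))) := by gcongr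
    _ = ε := by field_simp; norm_num

/-- A family given by a convergent family of elements of `A` is continuous. -/
theorem eval_of_tendsto {ξ : Z → A} {a : A} (h : Tendsto ξ l (𝓝 a)) :
    C.Approx l q fun z => C.eval (q z) (ξ z) := fun ε hε => by
  refine ⟨a, ?_⟩
  filter_upwards [(tendsto_iff_norm_sub_tendsto_zero.1 h).eventually (gt_mem_nhds hε)] with z hz
  rw [← map_sub]
  exact (C.norm_eval_le _ _).trans_lt hz

theorem of_bot : C.Approx ⊥ q F := fun _ _ => ⟨0, trivial⟩

/-- In a fixed fibre, continuity of families is continuity. -/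
theorem continuousOn [TopologicalSpace Z] {x : X} {F : Z → C.Fiber x} {s : Set Z}
    (h : ∀ z ∈ s, C.Approx (𝓝[s] z) (fun _ => x) F) : ContinuousOn F s := by
  refine fun z hz => Metric.tendsto_nhds.2 fun ε hε => ?_
  obtain ⟨a, ha⟩ := h z hz (ε / 2) (half_pos hε)
  filter_upwards [ha] with w hw
  have h2 := ha.self_of_nhdsWithin hz
  rw [dist_eq_norm]
  have := norm_sub_le (F w - C.eval x a) (F z - C.eval x a)
  rw [sub_sub_sub_cancel_right] at this
  linarith

end Approx

section Sections

variable {G : Type*} [TopologicalSpace G] {q : G → X}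

variable {C} in
theorem IsSection.approx {f : ∀ γ, C.Fiber (q γ)} (hf : C.IsSection q f) (γ : G) :
    C.Approx (𝓝 γ) q f := by
  obtain ⟨ξ, hξ⟩ := hf
  refine (Approx.eval_of_tendsto (C := C) (q := q) (ξ.continuous.tendsto γ)).congr' ?_
  exact Eventually.of_forall fun γ => (hξ γ).symm

theorem approx_onFiber {f : ∀ γ, C.Fiber (q γ)} (hf : C.IsSection q f) {Z : Type*}
    {l : Filter Z} {p : Z → G} {q' : Z → X} {γ : G} (hp : Tendsto p l (𝓝 γ))
    (hq : ∀ᶠ z in l, q (p z) = q' z) :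
    C.Approx l q' fun z => C.onFiber f (q' z) (p z) := by
  obtain ⟨ξ, hξ⟩ := hf
  refine (Approx.eval_of_tendsto (C := C) (q := q') ((ξ.continuous.tendsto γ).comp hp)).congr' ?_
  filter_upwards [hq] with z hz
  exact (C.onFiber_eval hξ hz).symm

theorem onFiber_self (f : ∀ γ, C.Fiber (q γ)) (γ : G) : C.onFiber f (q γ) γ = f γ := by
  simp [onFiber]

theorem eq_zero_of_notMem_supp {f : ∀ γ, C.Fiber (q γ)} {γ : G} (h : γ ∉ C.supp f) : f γ = 0 := by
  by_contra hn
  exact h (subset_closure hn)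

variable [T2Space G] [LocallyCompactSpace G]

/-- On a compact set, a continuous bounded family is approximated, up to half of the bound, by an
element of `C₀(G, A)` whose norm is controlled by the bound. -/
theorem exists_half_approx (hq : Continuous q) {K : Set G} (hK : IsCompact K)
    {F : ∀ γ, C.Fiber (q γ)} (hF : ∀ γ ∈ K, C.Approx (𝓝 γ) q F) {M : ℝ} (hM : 0 < M)
    (hb : ∀ γ ∈ K, ‖F γ‖ ≤ M) :
    ∃ ξ : C₀(G, A), ‖ξ‖ ≤ 2 * M ∧ ∀ γ ∈ K, ‖F γ - C.eval (q γ) (ξ γ)‖ ≤ M / 2 := by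
  have hloc : ∀ γ ∈ K, ∃ a : A, ‖a‖ ≤ 2 * M ∧ ∀ᶠ γ' in 𝓝 γ, ‖F γ' - C.eval (q γ') a‖ < M / 2 := by
    intro γ hγ
    obtain ⟨a, ha, hn⟩ := C.exists_eval_eq_norm_lt (q γ) (F γ)
      (show ‖F γ‖ < 2 * M by linarith [hb γ hγ])
    obtain ⟨a', ha'⟩ := hF γ hγ (M / 4) (by positivity)
    have h1 : ‖C.eval (q γ) (a' - a)‖ < M / 4 := by
      rw [map_sub, ha, norm_sub_rev]; exact ha'.self_of_nhds
    refine ⟨a, hn.le, ?_⟩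
    filter_upwards [ha', (hq.tendsto γ).eventually (C.eventually_norm_eval_lt h1)] with γ' h2 h3
    rw [map_sub] at h3
    have := norm_add_le (F γ' - C.eval (q γ') a') (C.eval (q γ') a' - C.eval (q γ') a)
    rw [sub_add_sub_cancel] at this
    linarith
  choose! a han ha using hloc
  choose! U hU hUo hUm using fun γ (hγ : γ ∈ K) => eventually_nhds_iff.1 (ha γ hγ)
  obtain ⟨t, h, hc, hs, h0, h1, hK1⟩ := hK.exists_partition (U := fun γ : K => U γ)
    (fun γ => hUo γ γ.2) fun γ hγ => mem_iUnion.2 ⟨⟨γ, hγ⟩, hUm γ hγ⟩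
  refine ⟨zeroAtInftyOfCompact (fun γ => ∑ i, (h i γ : ℂ) • a i) (by fun_prop) ?_,
    ZeroAtInftyContinuousMap.norm_le_of_forall (by positivity) fun γ => ?_, fun γ hγ => ?_⟩
  · refine HasCompactSupport.intro (isCompact_iUnion fun i => hc i) fun γ hγ => ?_
    simp only [mem_iUnion, not_exists] at hγ
    exact Finset.sum_eq_zero fun i _ => by simp [image_eq_zero_of_notMem_tsupport (hγ i)]
  · calc ‖∑ i, (h i γ : ℂ) • a i‖ ≤ ∑ i, h i γ * (2 * M) := by
          refine norm_sum_le_of_le _ fun i _ => ?_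
          rw [norm_smul, Complex.norm_real, Real.norm_of_nonneg (h0 i γ)]
          exact mul_le_mul_of_nonneg_left (han _ i.1.2) (h0 i γ)
      _ = (∑ i, h i γ) * (2 * M) := by rw [Finset.sum_mul]
      _ ≤ 2 * M := mul_le_of_le_one_left (by positivity) (h1 γ)
  · change ‖F γ - C.eval (q γ) (∑ i, (h i γ : ℂ) • a i)‖ ≤ _
    simp only [map_sum, map_smul]
    exact norm_sub_convex_le (fun i => h0 i γ) (hK1 γ hγ) fun i hi =>
      (hU _ i.1.2 γ (hs i γ hi)).le

/-- On a compact set, a continuous family is the restriction of an element of `q^* A`. -/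
theorem exists_eq_on_compact (hq : Continuous q) {K : Set G} (hK : IsCompact K)
    {F : ∀ γ, C.Fiber (q γ)} (hF : ∀ γ ∈ K, C.Approx (𝓝 γ) q F) :
    ∃ ξ : C₀(G, A), ∀ γ ∈ K, F γ = C.eval (q γ) (ξ γ) := by
  obtain ⟨M, hM, hb⟩ : ∃ M : ℝ, 0 < M ∧ ∀ γ ∈ K, ‖F γ‖ ≤ M := by
    choose! m hm hmb using fun γ (hγ : γ ∈ K) => (hF γ hγ).eventually_bounded
    obtain ⟨t, ht, hKt⟩ := hK.elim_nhds_subcover _ hmb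
    refine ⟨1 + ∑ i ∈ t, m i,
      add_pos_of_pos_of_nonneg one_pos (Finset.sum_nonneg fun i hi => (hm i (ht i hi)).le),
      fun γ hγ => ?_⟩
    obtain ⟨i, hi, h⟩ := mem_iUnion₂.1 (hKt hγ)
    have := Finset.single_le_sum (f := m) (fun j hj => (hm j (ht j hj)).le) hi
    exact (show ‖F γ‖ ≤ m i from h).trans (by linarith)
  -- the successive errors are halved, and the corrections form a convergent series
  have step : ∀ (n : ℕ) (S : {S : C₀(G, A) // ∀ γ ∈ K, ‖F γ - C.eval (q γ) (S γ)‖ ≤ M / 2 ^ n}),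
      ∃ S' : {S : C₀(G, A) // ∀ γ ∈ K, ‖F γ - C.eval (q γ) (S γ)‖ ≤ M / 2 ^ (n + 1)},
        ‖S'.1 - S.1‖ ≤ 2 * (M / 2 ^ n) := by
    rintro n ⟨S, hS⟩
    obtain ⟨ξ, h1, h2⟩ := C.exists_half_approx hq hK
      (F := fun γ => F γ + (-1 : ℂ) • C.eval (q γ) (S γ))
      (fun γ hγ => (hF γ hγ).add (Approx.smul tendsto_const_nhds
        (Approx.eval_of_tendsto (S.continuous.tendsto γ))))
      (M := M / 2 ^ n) (by positivity) (by simpa [sub_eq_add_neg] using hS)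
    refine ⟨⟨S + ξ, fun γ hγ => ?_⟩, by simpa using h1⟩
    have := h2 γ hγ
    rw [pow_succ, ← div_div]
    convert this using 2
    simp only [ZeroAtInftyContinuousMap.add_apply, map_add, neg_smul, one_smul]
    abel
  choose next hnext using step
  let S : ∀ n, {S : C₀(G, A) // ∀ γ ∈ K, ‖F γ - C.eval (q γ) (S γ)‖ ≤ M / 2 ^ n} := fun n =>
    Nat.rec ⟨0, by simpa using hb⟩ (fun n S => next n S) n
  have hcau : CauchySeq fun n => (S n).1 := by
    refine cauchySeq_of_le_geometric (1 / 2) (2 * M) (by norm_num) fun n => ?_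
    rw [dist_comm, dist_eq_norm]
    refine (hnext n (S n)).trans (le_of_eq ?_)
    rw [one_div, inv_pow]; ring
  obtain ⟨ξ, hξ⟩ := cauchySeq_tendsto_of_complete hcau
  refine ⟨ξ, fun γ hγ => ?_⟩
  have h1 : Tendsto (fun n => C.eval (q γ) ((S n).1 γ)) atTop (𝓝 (C.eval (q γ) (ξ γ))) := by
    refine ((C.continuous_eval (q γ)).tendsto _).comp ?_
    refine tendsto_iff_norm_sub_tendsto_zero.2 (squeeze_zero (fun _ => norm_nonneg _)
      (fun n => ?_) (tendsto_iff_norm_sub_tendsto_zero.1 hξ))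
    exact ((S n).1 - ξ).norm_apply_le' γ
  have h2 : Tendsto (fun n => C.eval (q γ) ((S n).1 γ)) atTop (𝓝 (F γ)) := by
    refine tendsto_iff_norm_sub_tendsto_zero.2 (squeeze_zero (fun _ => norm_nonneg _)
      (fun n => ?_) (?_ : Tendsto (fun n : ℕ => M * (1 / 2) ^ n) atTop (𝓝 0)))
    · rw [norm_sub_rev]
      refine ((S n).2 γ hγ).trans (le_of_eq ?_)
      rw [one_div, inv_pow]; ring
    · simpa using (tendsto_pow_atTop_nhds_zero_of_lt_one (r := (1 / 2 : ℝ)) (by norm_num)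
        (by norm_num)).const_mul M
  exact tendsto_nhds_unique h2 h1

/-- A continuous family with compact support is a section. -/
theorem isSection_of_approx (hq : Continuous q) {F : ∀ γ, C.Fiber (q γ)}
    (hF : ∀ γ, C.Approx (𝓝 γ) q F) {K : Set G} (hK : IsCompact K) (hFK : ∀ γ, F γ ≠ 0 → γ ∈ K) :
    C.IsSection q F := by
  obtain ⟨χ, h1, -, hχc, hχ⟩ := exists_continuous_one_zero_of_isCompact hK
    (isClosed_empty : IsClosed (∅ : Set G)) (Set.disjoint_empty K)
  obtain ⟨ξ, hξ⟩ := C.exists_eq_on_compact hq hχc.isCompact fun γ _ => hF γ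
  refine ⟨zeroAtInftyOfCompact (fun γ => (χ γ : ℂ) • ξ γ) (by fun_prop) ?_, fun γ => ?_⟩
  · exact HasCompactSupport.intro hχc fun γ hγ => by
      simp [image_eq_zero_of_notMem_tsupport hγ]
  · change F γ = C.eval (q γ) ((χ γ : ℂ) • ξ γ)
    rw [map_smul]
    by_cases h : γ ∈ tsupport χ
    · rw [← hξ γ h]
      by_cases hγ : γ ∈ K
      · rw [h1 hγ]; simp
      · rw [show F γ = 0 from not_not.1 fun hn => hγ (hFK γ hn)]; simp
    · rw [image_eq_zero_of_notMem_tsupport h,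
        show F γ = 0 from not_not.1 fun hn => h (subset_tsupport _ (by
          rw [Function.mem_support, h1 (hFK γ hn)]; simp))]
      simp

theorem supp_subset {F : ∀ γ, C.Fiber (q γ)} {K : Set G} (hK : IsClosed K)
    (hFK : ∀ γ, F γ ≠ 0 → γ ∈ K) : C.supp F ⊆ K :=
  closure_minimal hFK hK

theorem mem_Cc_of_approx (hq : Continuous q) {F : ∀ γ, C.Fiber (q γ)}
    (hF : ∀ γ, C.Approx (𝓝 γ) q F) {K : Set G} (hK : IsCompact K) (hFK : ∀ γ, F γ ≠ 0 → γ ∈ K) :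
    F ∈ C.Cc q :=
  ⟨C.isSection_of_approx hq hF hK hFK,
    hK.of_isClosed_subset isClosed_closure (C.supp_subset hK.isClosed hFK)⟩

/-- The product of an element of `C_c` and a continuous function. -/
theorem smul_mem_Cc (hq : Continuous q) {F : ∀ γ, C.Fiber (q γ)} (hF : F ∈ C.Cc q) {h : G → ℂ}
    (hh : Continuous h) : (fun γ => h γ • F γ) ∈ C.Cc q := by
  have hF' : C.IsSection q F ∧ IsCompact (C.supp F) := hF
  refine C.mem_Cc_of_approx hq (fun γ => Approx.smul (hh.tendsto γ) (hF'.1.approx γ)) hF'.2 ?_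
  intro γ h'
  exact subset_closure fun h0 => h' (by rw [h0, smul_zero])

end Sections

end CXAlgebra

/-! ### Integration against a Haar system -/

/-- A finite partition of unity on `K` adapted to a property `good a γ z` that can be achieved
locally in `γ`, uniformly for `z` close to the limit of the filter `l`. -/
theorem IsCompact.exists_partition_eventually {G A Z : Type*} [TopologicalSpace G] [T2Space G]
    [LocallyCompactSpace G] {K : Set G} (hK : IsCompact K) {l : Filter Z}
    {good : A → G → Z → Prop}
    (hg : ∀ γ ∈ K, ∃ a, ∀ᶠ p in 𝓝 γ ×ˢ l, good a p.1 p.2) :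
    ∃ (t : Finset K) (h : t → C(G, ℝ)) (a : t → A), (∀ i, HasCompactSupport (h i)) ∧
      (∀ i γ, 0 ≤ h i γ) ∧ (∀ γ ∈ K, ∑ i, h i γ = 1) ∧
      ∀ᶠ z in l, ∀ i γ, h i γ ≠ 0 → good (a i) γ z := by
  have hg' : ∀ γ : K, ∃ a, ∃ U : Set G, IsOpen U ∧ γ.1 ∈ U ∧ ∀ᶠ z in l, ∀ γ' ∈ U, good a γ' z := by
    intro γ
    obtain ⟨a, ha⟩ := hg γ γ.2
    obtain ⟨P, hP, Q, hQ, h⟩ := eventually_prod_iff.1 ha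
    obtain ⟨U, hU, hUo, hUm⟩ := eventually_nhds_iff.1 hP
    exact ⟨a, U, hUo, hUm, hQ.mono fun z hz γ' hγ' => h (hU γ' hγ') hz⟩
  choose a U hUo hUm hU using hg'
  obtain ⟨t, h, hc, hs, h0, -, h1⟩ := hK.exists_partition (U := U) hUo fun γ hγ =>
    mem_iUnion.2 ⟨⟨γ, hγ⟩, hUm ⟨γ, hγ⟩⟩
  refine ⟨t, h, fun i => a i, hc, h0, h1, ?_⟩
  filter_upwards [eventually_all.2 fun i : t => hU i] with z hz i γ hi
  exact hz i γ (hs i γ hi)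

/-- If `F` is within `δ χ` of `∑ i, c i • v i`, then the integrals are within `δ ∫ χ`. -/
theorem norm_integral_sub_sum_le {G E ι : Type*} [MeasurableSpace G] [NormedAddCommGroup E]
    [NormedSpace ℂ E] [CompleteSpace E] [Fintype ι] {μ : Measure G} {F : G → E}
    (hF : Integrable F μ) {χ : G → ℝ} (hχ : Integrable χ μ) {c : ι → G → ℂ}
    (hc : ∀ i, Integrable (c i) μ) {v : ι → E} {δ : ℝ}
    (h : ∀ᵐ γ ∂μ, ‖F γ - ∑ i, c i γ • v i‖ ≤ δ * χ γ) :
    ‖∫ γ, F γ ∂μ - ∑ i, (∫ γ, c i γ ∂μ) • v i‖ ≤ δ * ∫ γ, χ γ ∂μ := by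
  have e : ∫ γ, F γ ∂μ - ∑ i, (∫ γ, c i γ ∂μ) • v i = ∫ γ, (F γ - ∑ i, c i γ • v i) ∂μ := by
    rw [integral_sub hF (integrable_finsetSum _ fun i _ => (hc i).smul_const _),
      integral_finsetSum _ fun i _ => (hc i).smul_const _]
    simp only [integral_smul_const]
  rw [e, ← integral_const_mul]
  exact norm_integral_le_of_norm_le (hχ.const_mul δ) h

namespace HaarSystem

variable {G X : Type*} [TopologicalSpace G] [TopologicalSpace X] [T2Space G]
  [LocallyCompactSpace G] [T2Space X] [MeasurableSpace G] [BorelSpace G]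
  {𝓖 : TopGroupoid G X} (lam : HaarSystem 𝓖)

theorem ae_rng (x : X) : ∀ᵐ γ ∂(lam.meas x), 𝓖.rng γ = x := by
  rw [ae_iff]; exact lam.null_compl x

theorem isClosed_rng (𝓖 : TopGroupoid G X) (x : X) : IsClosed {γ | 𝓖.rng γ = x} :=
  isClosed_eq 𝓖.continuous_rng continuous_const

theorem integrable_of_hasCompactSupport {E : Type*} [NormedAddCommGroup E] (x : X) {F : G → E}
    (hF : Continuous F) (hc : HasCompactSupport F) : Integrable F (lam.meas x) := by
  have := lam.regular x
  exact hF.integrable_of_hasCompactSupport hc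

/-- A function that is continuous on the closed set of the arrows of range `x`, which carries `λ^x`, and
vanishes there outside a compact set is integrable. -/
theorem integrable_of_continuousOn {E : Type*} [NormedAddCommGroup E] {x : X} {F : G → E}
    (hF : ContinuousOn F {γ | 𝓖.rng γ = x}) {K : Set G} (hK : IsCompact K)
    (hFK : ∀ γ, 𝓖.rng γ = x → F γ ≠ 0 → γ ∈ K) : Integrable F (lam.meas x) := by
  have := lam.regular x
  have hK' : IsCompact ({γ | 𝓖.rng γ = x} ∩ K) := hK.inter_left (isClosed_rng 𝓖 x)
  have h : Integrable (({γ | 𝓖.rng γ = x} ∩ K).indicator F) (lam.meas x) := by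
    rw [integrable_indicator_iff hK'.measurableSet]
    exact (hF.mono inter_subset_left).integrableOn_compact hK'
  refine h.congr ?_
  filter_upwards [lam.ae_rng x] with γ hγ
  by_cases h0 : F γ = 0
  · rw [h0, indicator_apply_eq_zero]; exact fun _ => h0
  · exact indicator_of_mem (show γ ∈ {γ | 𝓖.rng γ = x} ∩ K from ⟨hγ, hFK γ hγ h0⟩) F

section Approx

variable {A : Type*} [NonUnitalCStarAlgebra A] {C : CXAlgebra X A}

/-- Continuity of parametric integrals against a Haar system, for families of elements of the
fibres. -/
theorem approx_integral {Z : Type*} {l : Filter Z} {q x : Z → X} {x₀ : X}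
    (hx : Tendsto x l (𝓝 x₀)) {Θ : G → ∀ z, C.Fiber (q z)} {K : Set G} (hK : IsCompact K)
    (hΘK : ∀ γ z, 𝓖.rng γ = x z → Θ γ z ≠ 0 → γ ∈ K)
    (hint : ∀ᶠ z in l, Integrable (fun γ => Θ γ z) (lam.meas (x z)))
    (hΘ : ∀ γ, C.Approx ((𝓝 γ ×ˢ l) ⊓ 𝓟 {p | 𝓖.rng p.1 = x p.2}) (fun p : G × Z => q p.2)
      fun p => Θ p.1 p.2) :
    C.Approx l q fun z => ∫ γ, Θ γ z ∂(lam.meas (x z)) := by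
  obtain ⟨χ, hχ1, -, hχc, hχ⟩ := exists_continuous_one_zero_of_isCompact hK
    (isClosed_empty : IsClosed (∅ : Set G)) (Set.disjoint_empty K)
  have hcont : ∀ (f : C(G, ℝ)), HasCompactSupport f →
      Continuous fun x => ∫ γ, ((f γ : ℝ) : ℂ) ∂(lam.meas x) := fun f hf =>
    lam.continuous_integral (fun γ => ((f γ : ℝ) : ℂ)) (by fun_prop)
      (hf.comp_left (g := fun t : ℝ => (t : ℂ)) (by simp))
  have hχint : Tendsto (fun z => ∫ γ, χ γ ∂(lam.meas (x z))) l (𝓝 (∫ γ, χ γ ∂(lam.meas x₀))) := by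
    have := (Complex.continuous_re.comp (hcont χ hχc)).continuousAt.tendsto.comp hx
    simpa only [Function.comp_def, integral_complex_ofReal, Complex.ofReal_re] using this
  set M := ∫ γ, χ γ ∂(lam.meas x₀) + 1 with hM
  have hM0 : 0 < M := add_pos_of_nonneg_of_pos (integral_nonneg fun γ => (hχ γ).1) one_pos
  -- near the limit, `Θ` is uniformly close on `K` to a combination of elements of `A` with coefficients
  -- in `C_c(G)`, whose integral depends continuously on the base point
  refine CXAlgebra.Approx.of_forall_exists fun ε hε => ?_
  have hδ : 0 < ε / (2 * M) := by positivity
  obtain ⟨t, h, a, hc, h0, h1, hev⟩ := hχc.isCompact.exists_partition_eventually (l := l)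
    (good := fun a γ z => 𝓖.rng γ = x z → ‖Θ γ z - C.eval (q z) a‖ < ε / (2 * M)) (fun γ _ => by
      obtain ⟨a, ha⟩ := hΘ γ _ hδ
      refine ⟨a, ?_⟩
      rw [eventually_inf_principal] at ha
      exact ha)
  have hcs : ∀ i, HasCompactSupport fun γ => χ γ * h i γ := fun i => (hc i).mul_left
  have hci : ∀ (i : t) (y : X), Integrable (fun γ => ((χ γ * h i γ : ℝ) : ℂ)) (lam.meas y) :=
    fun i y => (lam.integrable_of_hasCompactSupport y (by fun_prop) (hcs i)).ofReal
  refine ⟨fun z => C.eval (q z) (∑ i, (∫ γ, ((χ γ * h i γ : ℝ) : ℂ) ∂(lam.meas (x z))) • a i),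
    CXAlgebra.Approx.eval_of_tendsto (a := ∑ i, (∫ γ, ((χ γ * h i γ : ℝ) : ℂ) ∂(lam.meas x₀)) • a i)
      (tendsto_finsetSum _ fun i _ => Tendsto.smul_const
        (((hcont ⟨fun γ => χ γ * h i γ, by fun_prop⟩ (hcs i)).tendsto x₀).comp hx) (a i)), ?_⟩
  filter_upwards [hint, hev, hχint.eventually (gt_mem_nhds (lt_add_one _))] with z hz1 hz2 hz3
  rw [map_sum]
  simp only [map_smul]
  refine (norm_integral_sub_sum_le hz1 (lam.integrable_of_hasCompactSupport _ χ.continuous hχc)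
    (fun i => hci i (x z)) (δ := ε / (2 * M)) ?_).trans_lt ?_
  · filter_upwards [lam.ae_rng (x z)] with γ hγ
    by_cases hγχ : γ ∈ tsupport χ
    · have e : Θ γ z = (χ γ : ℂ) • Θ γ z := by
        by_cases h' : Θ γ z = 0
        · rw [h', smul_zero]
        · rw [hχ1 (hΘK γ z hγ h')]; simp
      have e2 : ∑ i, ((χ γ * h i γ : ℝ) : ℂ) • C.eval (q z) (a i) =
          (χ γ : ℂ) • ∑ i, (h i γ : ℂ) • C.eval (q z) (a i) := by
        simp only [Finset.smul_sum, smul_smul, Complex.ofReal_mul]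
      rw [e, e2, ← smul_sub, norm_smul, Complex.norm_real, Real.norm_of_nonneg (hχ γ).1, mul_comm]
      refine mul_le_mul_of_nonneg_right ?_ (hχ γ).1
      exact norm_sub_convex_le (fun i => h0 i γ) (h1 γ hγχ) fun i hi => (hz2 i γ hi hγ).le
    · have h2 := image_eq_zero_of_notMem_tsupport hγχ
      have h3 : Θ γ z = 0 := by
        by_contra hn
        have := hχ1 (hΘK γ z hγ hn)
        rw [h2] at this; simp at this
      simp [h2, h3]
  · calc ε / (2 * M) * ∫ γ, χ γ ∂(lam.meas (x z)) ≤ ε / (2 * M) * M := by gcongr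
      _ = ε / 2 := by field_simp
      _ < ε := half_lt_self hε

end Approx

theorem continuousOn_mul_left (𝓖 : TopGroupoid G X) (γ : G) :
    ContinuousOn (fun γ' => 𝓖.mul γ γ') {γ' | 𝓖.rng γ' = 𝓖.src γ} :=
  𝓖.continuousOn_mul.comp (f := fun γ' => (γ, γ')) (by fun_prop) fun _ h => Eq.symm h

theorem isCompact_setMul (𝓖 : TopGroupoid G X) {K L : Set G} (hK : IsCompact K)
    (hL : IsCompact L) : IsCompact (𝓖.setMul K L) := by
  have hc : IsClosed {p : G × G | 𝓖.src p.1 = 𝓖.rng p.2} :=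
    isClosed_eq (𝓖.continuous_src.comp continuous_fst) (𝓖.continuous_rng.comp continuous_snd)
  convert ((hK.prod hL).inter_right hc).image_of_continuousOn
    (𝓖.continuousOn_mul.mono inter_subset_right) using 1
  ext γ
  constructor
  · rintro ⟨a, ha, b, hb, hab, rfl⟩
    exact ⟨(a, b), ⟨⟨ha, hb⟩, hab⟩, rfl⟩
  · rintro ⟨⟨a, b⟩, ⟨⟨ha, hb⟩, hab⟩, rfl⟩
    exact ⟨a, ha, b, hb, hab, rfl⟩

theorem inv_mul_cancel_left (𝓖 : TopGroupoid G X) {a b : G} (h : 𝓖.src a = 𝓖.rng b) :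
    𝓖.mul (𝓖.inv a) (𝓖.mul a b) = b := by
  rw [← 𝓖.mul_assoc (𝓖.src_inv a) h, 𝓖.inv_mul, h, 𝓖.unit_mul]

theorem mul_inv_cancel_left (𝓖 : TopGroupoid G X) {a b : G} (h : 𝓖.rng a = 𝓖.rng b) :
    𝓖.mul a (𝓖.mul (𝓖.inv a) b) = b := by
  rw [← 𝓖.mul_assoc (𝓖.rng_inv a).symm (by rw [𝓖.src_inv, h]), 𝓖.mul_inv, h, 𝓖.unit_mul]

theorem integrable_mul_left {E : Type*} [NormedAddCommGroup E] (γ : G) {f : G → E} {L : Set G}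
    (hL : IsCompact L) (hf : ContinuousOn f {γ' | 𝓖.rng γ' = 𝓖.rng γ})
    (hfL : ∀ γ', 𝓖.rng γ' = 𝓖.rng γ → f γ' ≠ 0 → γ' ∈ L) :
    Integrable (fun γ' => f (𝓖.mul γ γ')) (lam.meas (𝓖.src γ)) := by
  refine lam.integrable_of_continuousOn (hf.comp (continuousOn_mul_left 𝓖 γ) fun γ' h => ?_)
    (isCompact_setMul 𝓖 (isCompact_singleton (x := 𝓖.inv γ)) hL) fun γ' h h' => ?_
  · exact 𝓖.rng_mul (Eq.symm h)
  · exact ⟨_, rfl, _, hfL _ (𝓖.rng_mul h.symm) h',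
      by rw [𝓖.src_inv, 𝓖.rng_mul h.symm], (inv_mul_cancel_left 𝓖 h.symm).symm⟩

/-- Left invariance of the Haar system, for vector-valued functions. -/
theorem integral_mul_left' {E : Type*} [NormedAddCommGroup E] [NormedSpace ℂ E] [CompleteSpace E]
    (γ : G) {F : G → E} (hF : ContinuousOn F {γ' | 𝓖.rng γ' = 𝓖.rng γ}) {K : Set G}
    (hK : IsCompact K) (hFK : ∀ γ', 𝓖.rng γ' = 𝓖.rng γ → F γ' ≠ 0 → γ' ∈ K) :
    ∫ γ', F (𝓖.mul γ γ') ∂(lam.meas (𝓖.src γ)) = ∫ γ', F γ' ∂(lam.meas (𝓖.rng γ)) := by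
  obtain ⟨χ, hχ1, -, hχc, hχ⟩ := exists_continuous_one_zero_of_isCompact hK
    (isClosed_empty : IsClosed (∅ : Set G)) (Set.disjoint_empty K)
  have hinv : ∀ f : C(G, ℝ), HasCompactSupport f →
      ∫ γ', ((f (𝓖.mul γ γ') : ℝ) : ℂ) ∂(lam.meas (𝓖.src γ)) =
        ∫ γ', ((f γ' : ℝ) : ℂ) ∂(lam.meas (𝓖.rng γ)) := fun f hf =>
    lam.integral_mul_left (fun γ => ((f γ : ℝ) : ℂ)) (by fun_prop)
      (hf.comp_left (g := fun t : ℝ => (t : ℂ)) (by simp)) γ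
  have hinv' : ∀ f : C(G, ℝ), HasCompactSupport f →
      ∫ γ', f (𝓖.mul γ γ') ∂(lam.meas (𝓖.src γ)) = ∫ γ', f γ' ∂(lam.meas (𝓖.rng γ)) :=
    fun f hf => by
      have := hinv f hf
      rwa [integral_complex_ofReal, integral_complex_ofReal, Complex.ofReal_inj] at this
  set M := ∫ γ', χ γ' ∂(lam.meas (𝓖.rng γ)) with hM
  have hM0 : 0 ≤ M := integral_nonneg fun γ => (hχ γ).1
  have key : ∀ δ : ℝ, 0 < δ → ‖∫ γ', F (𝓖.mul γ γ') ∂(lam.meas (𝓖.src γ)) -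
      ∫ γ', F γ' ∂(lam.meas (𝓖.rng γ))‖ ≤ 2 * M * δ := by
    intro δ hδ
    obtain ⟨t, h, a, hc, h0, h1, hev⟩ := hχc.isCompact.exists_partition_eventually
      (l := pure ()) (good := fun (a : E) γ' _ => 𝓖.rng γ' = 𝓖.rng γ → ‖F γ' - a‖ < δ)
      (fun γ' _ => by
        refine ⟨F γ', ?_⟩
        rw [prod_pure, eventually_map]
        by_cases h : 𝓖.rng γ' = 𝓖.rng γ
        · have := Metric.tendsto_nhds.1 (hF γ' h) δ hδ
          rw [eventually_nhdsWithin_iff] at this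
          simpa only [dist_eq_norm, Set.mem_ofPred_eq] using this
        · filter_upwards [(isClosed_rng 𝓖 (𝓖.rng γ)).isOpen_compl.mem_nhds h] with γ'' h1 h2
          exact absurd h2 h1)
    rw [eventually_pure] at hev
    have hcs : ∀ i, HasCompactSupport fun γ => χ γ * h i γ := fun i => (hc i).mul_left
    have hpt : ∀ γ', 𝓖.rng γ' = 𝓖.rng γ →
        ‖F γ' - ∑ i, ((χ γ' * h i γ' : ℝ) : ℂ) • a i‖ ≤ δ * χ γ' := by
      intro γ' hγ
      by_cases hγχ : γ' ∈ tsupport χ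
      · have e : F γ' = (χ γ' : ℂ) • F γ' := by
          by_cases h' : F γ' = 0
          · rw [h', smul_zero]
          · rw [hχ1 (hFK γ' hγ h')]; simp
        have e2 : ∑ i, ((χ γ' * h i γ' : ℝ) : ℂ) • a i =
            (χ γ' : ℂ) • ∑ i, (h i γ' : ℂ) • a i := by
          simp only [Finset.smul_sum, smul_smul, Complex.ofReal_mul]
        rw [e, e2, ← smul_sub, norm_smul, Complex.norm_real, Real.norm_of_nonneg (hχ γ').1,
          mul_comm]
        refine mul_le_mul_of_nonneg_right ?_ (hχ γ').1
        exact norm_sub_convex_le (fun i => h0 i γ') (h1 γ' hγχ) fun i hi => (hev i γ' hi hγ).le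
      · have h2 := image_eq_zero_of_notMem_tsupport hγχ
        have h3 : F γ' = 0 := by
          by_contra hn
          have := hχ1 (hFK γ' hγ hn)
          rw [h2] at this; simp at this
        simp [h2, h3]
    have hfi : ∀ i, Continuous fun γ => ((χ γ * h i γ : ℝ) : ℂ) := fun i => by fun_prop
    have hfc : ∀ i, HasCompactSupport fun γ => ((χ γ * h i γ : ℝ) : ℂ) := fun i =>
      (hcs i).comp_left (g := fun t : ℝ => (t : ℂ)) (by simp)
    have b1 := norm_integral_sub_sum_le (v := a) (δ := δ)
      (lam.integrable_of_continuousOn hF hK hFK)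
      (lam.integrable_of_hasCompactSupport (𝓖.rng γ) χ.continuous hχc)
      (fun i => lam.integrable_of_hasCompactSupport (𝓖.rng γ) (hfi i) (hfc i))
      (by filter_upwards [lam.ae_rng (𝓖.rng γ)] with γ' h using hpt γ' h)
    have b2 := norm_integral_sub_sum_le (v := a) (δ := δ) (lam.integrable_mul_left γ hK hF hFK)
      (lam.integrable_mul_left γ hχc.isCompact χ.continuous.continuousOn
        fun _ _ h => subset_tsupport _ h)
      (fun i => lam.integrable_mul_left γ (hfc i).isCompact (hfi i).continuousOn
        fun _ _ h => subset_tsupport _ h)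
      (by filter_upwards [lam.ae_rng (𝓖.src γ)] with γ' h using hpt _ (𝓖.rng_mul h.symm))
    rw [hinv' χ hχc] at b2
    have e : ∀ i, ∫ γ', ((χ (𝓖.mul γ γ') * h i (𝓖.mul γ γ') : ℝ) : ℂ) ∂(lam.meas (𝓖.src γ)) =
        ∫ γ', ((χ γ' * h i γ' : ℝ) : ℂ) ∂(lam.meas (𝓖.rng γ)) := fun i =>
      hinv ⟨fun γ => χ γ * h i γ, by fun_prop⟩ (hcs i)
    simp only [e] at b2
    have := norm_sub_le_norm_sub_add_norm_sub (∫ γ', F (𝓖.mul γ γ') ∂(lam.meas (𝓖.src γ)))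
      (∑ i, (∫ γ', ((χ γ' * h i γ' : ℝ) : ℂ) ∂(lam.meas (𝓖.rng γ))) • a i)
      (∫ γ', F γ' ∂(lam.meas (𝓖.rng γ)))
    rw [norm_sub_rev (∑ i, _)] at this
    linarith
  rw [← sub_eq_zero, ← norm_le_zero_iff]
  have hlim : Tendsto (fun δ : ℝ => 2 * M * δ) (𝓝[>] 0) (𝓝 0) := by
    have : Continuous fun δ : ℝ => 2 * M * δ := by fun_prop
    simpa using (this.tendsto 0).mono_left nhdsWithin_le_nhds
  exact ge_of_tendsto hlim (by filter_upwards [self_mem_nhdsWithin] with δ hδ using key δ hδ)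

/-- Fubini's theorem on the arrows of range `x`. The function need only be continuous on the
closed set of pairs of such arrows. -/
theorem integral_swap {E : Type*} [NormedAddCommGroup E] [NormedSpace ℂ E] [CompleteSpace E]
    {x : X} {Φ : G → G → E}
    (hΦ : ContinuousOn (fun p : G × G => Φ p.1 p.2) {p | 𝓖.rng p.1 = x ∧ 𝓖.rng p.2 = x})
    {K L : Set G} (hK : IsCompact K) (hL : IsCompact L)
    (hKL : ∀ a b, 𝓖.rng a = x → 𝓖.rng b = x → Φ a b ≠ 0 → a ∈ K ∧ b ∈ L) :
    ∫ a, ∫ b, Φ a b ∂(lam.meas x) ∂(lam.meas x) = ∫ b, ∫ a, Φ a b ∂(lam.meas x) ∂(lam.meas x) := by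
  have := lam.regular x
  let S : Set G := {γ | 𝓖.rng γ = x}
  have hS : IsClosed S := isClosed_rng 𝓖 x
  let μ : Measure S := (lam.meas x).comap Subtype.val
  have hμ : ∀ f : G → E, ∫ a : S, f a ∂μ = ∫ a, f a ∂(lam.meas x) := fun f => by
    rw [integral_subtype_comap hS.measurableSet f,
      Measure.restrict_eq_self_of_ae_mem (s := S) (lam.ae_rng x)]
  have hfin : IsFiniteMeasureOnCompacts μ := ⟨fun Q hQ => by
    rw [(MeasurableEmbedding.subtype_coe hS.measurableSet).comap_apply]
    exact (hQ.image continuous_subtype_val).measure_lt_top⟩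
  have hcont : Continuous (Function.uncurry fun a b : S => Φ a b) := by
    refine hΦ.comp_continuous (f := fun p : S × S => ((p.1 : G), (p.2 : G))) (by fun_prop) ?_
    exact fun p => ⟨p.1.2, p.2.2⟩
  have hsupp : HasCompactSupport (Function.uncurry fun a b : S => Φ a b) := by
    have hcl := hS.isClosedEmbedding_subtypeVal
    refine HasCompactSupport.intro ((hcl.isCompact_preimage hK).prod (hcl.isCompact_preimage hL)) ?_
    rintro ⟨a, b⟩ hab
    by_contra hn
    exact hab (hKL a b a.2 b.2 hn)
  have key := integral_integral_swap_of_hasCompactSupport hcont hsupp (μ := μ) (ν := μ)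
  have e1 : ∀ a, ∫ b : S, Φ a b ∂μ = ∫ b, Φ a b ∂(lam.meas x) := fun a => hμ _
  have e2 : ∀ b, ∫ a : S, Φ a b ∂μ = ∫ a, Φ a b ∂(lam.meas x) := fun b => hμ fun a => Φ a b
  simp only [e1, e2] at key
  rwa [hμ fun a => ∫ b, Φ a b ∂(lam.meas x), hμ fun b => ∫ a, Φ a b ∂(lam.meas x)] at key

end HaarSystem

/-! ### Transport along arrows -/

namespace TopGroupoid

variable {G X : Type*} [TopologicalSpace G] [TopologicalSpace X] (𝓖 : TopGroupoid G X)

theorem tendsto_mul [T2Space X] {Z : Type*} {l : Filter Z} [l.NeBot] {a b : Z → G} {a₀ b₀ : G}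
    (ha : Tendsto a l (𝓝 a₀)) (hb : Tendsto b l (𝓝 b₀)) (h : ∀ᶠ z in l, 𝓖.src (a z) = 𝓖.rng (b z)) :
    Tendsto (fun z => 𝓖.mul (a z) (b z)) l (𝓝 (𝓖.mul a₀ b₀)) := by
  have h0 : 𝓖.src a₀ = 𝓖.rng b₀ := tendsto_nhds_unique_of_eventuallyEq
    ((𝓖.continuous_src.tendsto _).comp ha) ((𝓖.continuous_rng.tendsto _).comp hb) h
  exact (𝓖.continuousOn_mul (a₀, b₀) h0).tendsto.comp
    (tendsto_nhdsWithin_iff.2 ⟨ha.prodMk_nhds hb, h⟩)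

theorem mul_inv_cancel_right {a b : G} (h : 𝓖.src a = 𝓖.rng b) :
    𝓖.mul (𝓖.mul a b) (𝓖.inv b) = a := by
  rw [𝓖.mul_assoc h (𝓖.rng_inv b).symm, 𝓖.mul_inv, ← h, 𝓖.mul_unit]

end TopGroupoid

namespace GAlgebra

variable {G X A : Type*} [TopologicalSpace G] [TopologicalSpace X] [NonUnitalCStarAlgebra A]
  {𝓖 : TopGroupoid G X} (𝓐 : GAlgebra 𝓖 A)

/-- The action of an arrow `γ`, as a map from `A_x` to `A_y`; it is set to `0` unless `x` is the source
and `y` the range of `γ`. -/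
def tr (γ : G) (x y : X) (v : 𝓐.Fiber x) : 𝓐.Fiber y :=
  open Classical in if h : 𝓖.src γ = x ∧ 𝓖.rng γ = y then h.2 ▸ 𝓐.act γ (h.1.symm ▸ v) else 0

theorem tr_self (γ : G) (v : 𝓐.Fiber (𝓖.src γ)) :
    𝓐.tr γ (𝓖.src γ) (𝓖.rng γ) v = 𝓐.act γ v := by simp [tr]

theorem tr_add (γ : G) (x y : X) (v w : 𝓐.Fiber x) :
    𝓐.tr γ x y (v + w) = 𝓐.tr γ x y v + 𝓐.tr γ x y w := by
  by_cases h : 𝓖.src γ = x ∧ 𝓖.rng γ = y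
  · obtain ⟨rfl, rfl⟩ := h; simp [tr_self]
  · simp [tr, h]

theorem tr_smul (γ : G) (x y : X) (c : ℂ) (v : 𝓐.Fiber x) :
    𝓐.tr γ x y (c • v) = c • 𝓐.tr γ x y v := by
  by_cases h : 𝓖.src γ = x ∧ 𝓖.rng γ = y
  · obtain ⟨rfl, rfl⟩ := h; simp [tr_self]
  · simp [tr, h]

theorem tr_mul (γ : G) (x y : X) (v w : 𝓐.Fiber x) :
    𝓐.tr γ x y (v * w) = 𝓐.tr γ x y v * 𝓐.tr γ x y w := by
  by_cases h : 𝓖.src γ = x ∧ 𝓖.rng γ = y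
  · obtain ⟨rfl, rfl⟩ := h; simp [tr_self]
  · simp [tr, h]

theorem tr_star (γ : G) (x y : X) (v : 𝓐.Fiber x) :
    𝓐.tr γ x y (star v) = star (𝓐.tr γ x y v) := by
  by_cases h : 𝓖.src γ = x ∧ 𝓖.rng γ = y
  · obtain ⟨rfl, rfl⟩ := h; simp [tr_self, map_star]
  · simp [tr, h]

theorem norm_tr_le (γ : G) (x y : X) (v : 𝓐.Fiber x) : ‖𝓐.tr γ x y v‖ ≤ ‖v‖ := by
  by_cases h : 𝓖.src γ = x ∧ 𝓖.rng γ = y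
  · obtain ⟨rfl, rfl⟩ := h
    rw [tr_self]
    exact NonUnitalStarAlgHom.norm_apply_le (𝓐.act γ) v
  · simp [tr, h]

/-- Transport as a continuous linear map. -/
def trL (γ : G) (x y : X) : 𝓐.Fiber x →L[ℂ] 𝓐.Fiber y :=
  LinearMap.mkContinuous
    { toFun := 𝓐.tr γ x y, map_add' := 𝓐.tr_add γ x y, map_smul' := 𝓐.tr_smul γ x y } 1
    fun v => by rw [one_mul]; exact 𝓐.norm_tr_le γ x y v

theorem trL_apply (γ : G) (x y : X) (v : 𝓐.Fiber x) : 𝓐.trL γ x y v = 𝓐.tr γ x y v := rfl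

theorem tr_zero (γ : G) (x y : X) : 𝓐.tr γ x y 0 = 0 := (𝓐.trL γ x y).map_zero

theorem tr_sub (γ : G) (x y : X) (v w : 𝓐.Fiber x) :
    𝓐.tr γ x y (v - w) = 𝓐.tr γ x y v - 𝓐.tr γ x y w := (𝓐.trL γ x y).map_sub v w

theorem tr_eval_iff {γ : G} {x y : X} (hs : 𝓖.src γ = x) (hr : 𝓖.rng γ = y) {a b : A} :
    𝓐.tr γ x y (𝓐.eval x a) = 𝓐.eval y b ↔ 𝓐.act γ (𝓐.eval _ a) = 𝓐.eval _ b := by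
  subst hs hr
  rw [tr_self]

/-- Transport is functorial. The action is given on representatives in `A` of elements of the fibres,
whence the passage through `eval`. -/
theorem tr_tr {γ γ' γ'' : G} {x y z : X} (h : 𝓖.src γ = y) (h' : 𝓖.rng γ' = y)
    (hs : 𝓖.src γ' = x) (hr : 𝓖.rng γ = z) (hγ : 𝓖.mul γ γ' = γ'') (v : 𝓐.Fiber x) :
    𝓐.tr γ y z (𝓐.tr γ' x y v) = 𝓐.tr γ'' x z v := by
  obtain ⟨a, rfl⟩ := 𝓐.eval_surjective x v
  obtain ⟨b, hb⟩ := 𝓐.eval_surjective y (𝓐.tr γ' x y (𝓐.eval x a))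
  obtain ⟨c, hc⟩ := 𝓐.eval_surjective z (𝓐.tr γ y z (𝓐.eval y b))
  rw [← hb, ← hc]
  refine Eq.symm ?_
  subst hγ
  have h0 : 𝓖.src γ = 𝓖.rng γ' := h.trans h'.symm
  rw [𝓐.tr_eval_iff ((𝓖.src_mul h0).trans hs) ((𝓖.rng_mul h0).trans hr)]
  have e1 := (𝓐.tr_eval_iff hs h').1 hb.symm
  have e2 := (𝓐.tr_eval_iff h hr).1 hc.symm
  exact 𝓐.act_mul γ γ' h0 a b c e1 e2

theorem tr_unit {γ : G} {x : X} (h : γ = 𝓖.unit x) (v : 𝓐.Fiber x) : 𝓐.tr γ x x v = v := by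
  subst h
  have hs := 𝓖.src_unit x
  have hr := 𝓖.rng_unit x
  have hm : 𝓖.mul (𝓖.unit x) (𝓖.unit x) = 𝓖.unit x := by
    have := 𝓖.mul_unit (𝓖.unit x)
    rwa [hs] at this
  -- the transport is idempotent and injective
  have h1 := 𝓐.tr_tr hs hr hs hr hm v
  have hinj : ∀ {γ : G} {x y : X}, 𝓖.src γ = x → 𝓖.rng γ = y → ∀ v w : 𝓐.Fiber x,
      𝓐.tr γ x y v = 𝓐.tr γ x y w → v = w := by
    rintro γ _ _ rfl rfl v w h
    rw [tr_self, tr_self] at h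
    exact (𝓐.act γ).injective h
  exact hinj hs hr _ _ h1

theorem act_symm_eq (γ : G) (v : 𝓐.Fiber (𝓖.rng γ)) :
    (𝓐.act γ).symm v = 𝓐.tr (𝓖.inv γ) (𝓖.rng γ) (𝓖.src γ) v := by
  obtain ⟨w, rfl⟩ := EquivLike.surjective (𝓐.act γ) v
  rw [StarAlgEquiv.symm_apply_apply, ← tr_self,
    𝓐.tr_tr (𝓖.src_inv γ) rfl rfl (𝓖.rng_inv γ) (𝓖.inv_mul γ), 𝓐.tr_unit rfl]

theorem onFiber_act (h : ∀ γ, 𝓐.Fiber (𝓖.src γ)) {γ : G} {y : X} (hy : 𝓖.rng γ = y) :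
    𝓐.onFiber (fun γ => 𝓐.act γ (h γ)) y γ = 𝓐.tr γ (𝓖.src γ) y (h γ) := by
  subst hy
  rw [CXAlgebra.onFiber_self, tr_self]

theorem onFiber_act_symm (g : ∀ γ, 𝓐.Fiber (𝓖.rng γ)) {γ : G} {y : X} (hy : 𝓖.src γ = y) :
    𝓐.onFiber (fun γ => (𝓐.act γ).symm (g γ)) y γ = 𝓐.tr (𝓖.inv γ) (𝓖.rng γ) y (g γ) := by
  subst hy
  rw [CXAlgebra.onFiber_self, act_symm_eq]

variable [T2Space G] [LocallyCompactSpace G] [T2Space X]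

/-- Transport preserves the continuity of families. -/
theorem approx_tr {Z : Type*} {l : Filter Z} {q q' : Z → X} {p : Z → G} {γ : G}
    (hp : Tendsto p l (𝓝 γ)) (hs : ∀ᶠ z in l, 𝓖.src (p z) = q z)
    (hr : ∀ᶠ z in l, 𝓖.rng (p z) = q' z) {F : ∀ z, 𝓐.Fiber (q z)} (hF : 𝓐.Approx l q F) :
    𝓐.Approx l q' fun z => 𝓐.tr (p z) (q z) (q' z) (F z) := by
  obtain ⟨K, hK, hKγ⟩ := exists_compact_mem_nhds γ
  obtain ⟨χ, h1, -, hχc, hχ⟩ := exists_continuous_one_zero_of_isCompact hK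
    (isClosed_empty : IsClosed (∅ : Set G)) (Set.disjoint_empty K)
  refine CXAlgebra.Approx.of_forall_exists fun ε hε => ?_
  obtain ⟨a, ha⟩ := hF ε hε
  have hsec : 𝓐.IsSection 𝓖.src fun γ => 𝓐.eval (𝓖.src γ) ((χ γ : ℂ) • a) :=
    ⟨zeroAtInftyOfCompact (fun γ => (χ γ : ℂ) • a) (by fun_prop)
      (HasCompactSupport.intro hχc fun γ hγ => by simp [image_eq_zero_of_notMem_tsupport hγ]),
      fun _ => rfl⟩
  obtain ⟨ξ, hξ⟩ := (𝓐.isSection_iff _).1 hsec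
  refine ⟨fun z => 𝓐.eval (q' z) (ξ (p z)),
    CXAlgebra.Approx.eval_of_tendsto ((ξ.continuous.tendsto γ).comp hp), ?_⟩
  filter_upwards [ha, hs, hr, hp.eventually hKγ] with z hz hsz hrz hzK
  have e : 𝓐.tr (p z) (q z) (q' z) (𝓐.eval (q z) a) = 𝓐.eval (q' z) (ξ (p z)) := by
    rw [𝓐.tr_eval_iff hsz hrz, ← hξ]
    simp [h1 hzK]
  rw [← e, ← tr_sub]
  exact (𝓐.norm_tr_le _ _ _ _).trans_lt hz

theorem isSection_act_symm {g : ∀ γ, 𝓐.Fiber (𝓖.rng γ)} (hg : g ∈ 𝓐.Cc 𝓖.rng) :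
    (fun γ => (𝓐.act γ).symm (g γ)) ∈ 𝓐.Cc 𝓖.src := by
  have hg' : 𝓐.IsSection 𝓖.rng g ∧ IsCompact (𝓐.supp g) := hg
  have e : 𝓐.supp (fun γ => (𝓐.act γ).symm (g γ)) = 𝓐.supp g := by simp [CXAlgebra.supp]
  refine ⟨(𝓐.isSection_iff _).2 (by simpa using hg'.1), by rw [e]; exact hg'.2⟩

theorem supp_act (h : ∀ γ, 𝓐.Fiber (𝓖.src γ)) :
    𝓐.supp (fun γ => 𝓐.act γ (h γ)) = 𝓐.supp h := by simp [CXAlgebra.supp]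

theorem act_mem_Cc {h : ∀ γ, 𝓐.Fiber (𝓖.src γ)} (hh : h ∈ 𝓐.Cc 𝓖.src) :
    (fun γ => 𝓐.act γ (h γ)) ∈ 𝓐.Cc 𝓖.rng := by
  have hh' : 𝓐.IsSection 𝓖.src h ∧ IsCompact (𝓐.supp h) := hh
  exact ⟨(𝓐.isSection_iff _).1 hh'.1, by rw [supp_act]; exact hh'.2⟩

/-! ### Convolution -/

/-- The kernel of the operator of convolution by `f` on the arrows of range `x`. -/
def kernel (f : ∀ γ, 𝓐.Fiber (𝓖.rng γ)) (x : X) (a b : G) : 𝓐.Fiber x :=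
  𝓐.tr a (𝓖.src a) x (𝓐.onFiber f (𝓖.src a) (𝓖.mul (𝓖.inv a) b))

theorem kernel_ne_zero {f : ∀ γ, 𝓐.Fiber (𝓖.rng γ)} {x : X} {a b : G}
    (h : 𝓐.kernel f x a b ≠ 0) : 𝓖.mul (𝓖.inv a) b ∈ 𝓐.supp f := by
  by_contra hn
  exact h (by rw [kernel, 𝓐.onFiber_eq_zero hn, tr_zero])

/-- The kernel is continuous only on pairs of arrows of range `x`: elsewhere the products and the
transports take junk values. -/
theorem continuousOn_kernel {f : ∀ γ, 𝓐.Fiber (𝓖.rng γ)} (hf : 𝓐.IsSection 𝓖.rng f) (x : X) :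
    ContinuousOn (fun p : G × G => 𝓐.kernel f x p.1 p.2)
      {p | 𝓖.rng p.1 = x ∧ 𝓖.rng p.2 = x} := by
  refine CXAlgebra.Approx.continuousOn (C := 𝓐.toCXAlgebra) fun p hp => ?_
  have : (𝓝[{p : G × G | 𝓖.rng p.1 = x ∧ 𝓖.rng p.2 = x}] p).NeBot := mem_closure_iff_nhdsWithin_neBot.1 (subset_closure hp)
  have h1 : Tendsto (fun p : G × G => p.1)
      (𝓝[{p : G × G | 𝓖.rng p.1 = x ∧ 𝓖.rng p.2 = x}] p) (𝓝 p.1) :=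
    continuous_fst.continuousWithinAt
  have h2 : Tendsto (fun p : G × G => p.2)
      (𝓝[{p : G × G | 𝓖.rng p.1 = x ∧ 𝓖.rng p.2 = x}] p) (𝓝 p.2) :=
    continuous_snd.continuousWithinAt
  refine 𝓐.approx_tr h1 (Eventually.of_forall fun _ => rfl)
    (eventually_mem_nhdsWithin.mono fun p hp => hp.1) ?_
  refine 𝓐.approx_onFiber hf (𝓖.tendsto_mul ((𝓖.continuous_inv.tendsto _).comp h1) h2
    (eventually_mem_nhdsWithin.mono fun p hp => ?_)) (eventually_mem_nhdsWithin.mono fun p hp => ?_)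
  · rw [𝓖.src_inv, hp.1, hp.2]
  · rw [𝓖.rng_mul (by rw [𝓖.src_inv, hp.1, hp.2]), 𝓖.rng_inv]

theorem continuousOn_onFiber_inv {ξ : ∀ γ, 𝓐.Fiber (𝓖.src γ)} (hξ : 𝓐.IsSection 𝓖.src ξ) (x : X) :
    ContinuousOn (fun γ => 𝓐.onFiber ξ x (𝓖.inv γ)) {γ | 𝓖.rng γ = x} := by
  refine CXAlgebra.Approx.continuousOn (C := 𝓐.toCXAlgebra) fun γ hγ => ?_
  refine 𝓐.approx_onFiber hξ (γ := 𝓖.inv γ) (𝓖.continuous_inv.continuousWithinAt)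
    (eventually_mem_nhdsWithin.mono fun γ hγ => ?_)
  rw [𝓖.src_inv]; exact hγ

theorem kernel_smul (k : G → ℂ) (f : ∀ γ, 𝓐.Fiber (𝓖.rng γ)) (x : X) (a b : G) :
    𝓐.kernel (fun γ => k γ • f γ) x a b = k (𝓖.mul (𝓖.inv a) b) • 𝓐.kernel f x a b := by
  rw [kernel, kernel, ← tr_smul]
  congr 1
  by_cases h : 𝓖.rng (𝓖.mul (𝓖.inv a) b) = 𝓖.src a
  · rw [← h, CXAlgebra.onFiber_self, CXAlgebra.onFiber_self]
  · rw [𝓐.onFiber_of_ne _ h, 𝓐.onFiber_of_ne _ h, smul_zero]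

end GAlgebra

namespace GAlgebra

variable {G X A : Type*} [TopologicalSpace G] [TopologicalSpace X] [T2Space G]
  [LocallyCompactSpace G] [T2Space X] [MeasurableSpace G] [BorelSpace G] [NonUnitalCStarAlgebra A]
  {𝓖 : TopGroupoid G X} (𝓐 : GAlgebra 𝓖 A) (lam : HaarSystem 𝓖)

/-- The integrand in the definition of the convolution is continuous in both variables. -/
theorem approx_conv_integrand {f : ∀ γ, 𝓐.Fiber (𝓖.rng γ)} (hf : 𝓐.IsSection 𝓖.rng f)
    {ξ : ∀ γ, 𝓐.Fiber (𝓖.src γ)} (hξ : 𝓐.IsSection 𝓖.src ξ) (γ γ' : G) :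
    𝓐.Approx ((𝓝 γ' ×ˢ 𝓝 γ) ⊓ 𝓟 {p | 𝓖.rng p.1 = 𝓖.rng p.2}) (fun p : G × G => 𝓖.src p.2)
      fun p => (𝓐.act p.2).symm (𝓐.onFiber f (𝓖.rng p.2) p.1) *
        𝓐.onFiber ξ (𝓖.src p.2) (𝓖.mul (𝓖.inv p.1) p.2) := by
  set l := (𝓝 γ' ×ˢ 𝓝 γ) ⊓ 𝓟 {p | 𝓖.rng p.1 = 𝓖.rng p.2} with hl
  rcases l.eq_or_neBot with h | h
  · rw [h]; exact CXAlgebra.Approx.of_bot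
  have h1 : Tendsto Prod.fst l (𝓝 γ') := tendsto_fst.mono_left inf_le_left
  have h2 : Tendsto Prod.snd l (𝓝 γ) := tendsto_snd.mono_left inf_le_left
  have h3 : ∀ᶠ p in l, 𝓖.rng p.1 = 𝓖.rng p.2 := eventually_inf_principal.2
    (Eventually.of_forall fun _ h => h)
  refine CXAlgebra.Approx.mul ?_ ?_
  · simp only [act_symm_eq]
    exact 𝓐.approx_tr ((𝓖.continuous_inv.tendsto _).comp h2)
      (Eventually.of_forall fun p => 𝓖.src_inv _) (Eventually.of_forall fun p => 𝓖.rng_inv _)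
      (𝓐.approx_onFiber hf h1 h3)
  · refine 𝓐.approx_onFiber hξ (𝓖.tendsto_mul ((𝓖.continuous_inv.tendsto _).comp h1) h2 ?_) ?_
    · exact h3.mono fun p hp => by rw [𝓖.src_inv, hp]
    · exact h3.mono fun p hp => 𝓖.src_mul (by rw [𝓖.src_inv, hp])

theorem continuousOn_conv_integrand {f : ∀ γ, 𝓐.Fiber (𝓖.rng γ)}
    (hf : 𝓐.IsSection 𝓖.rng f) {ξ : ∀ γ, 𝓐.Fiber (𝓖.src γ)} (hξ : 𝓐.IsSection 𝓖.src ξ) (γ : G) :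
    ContinuousOn (fun γ' => (𝓐.act γ).symm (𝓐.onFiber f (𝓖.rng γ) γ') *
        𝓐.onFiber ξ (𝓖.src γ) (𝓖.mul (𝓖.inv γ') γ)) {γ' | 𝓖.rng γ' = 𝓖.rng γ} := by
  refine CXAlgebra.Approx.continuousOn (C := 𝓐.toCXAlgebra) fun γ' hγ' => ?_
  refine (𝓐.approx_conv_integrand hf hξ γ γ').comp (p := fun γ' => (γ', γ)) ?_
  refine tendsto_inf.2 ⟨?_, tendsto_principal.2 eventually_mem_nhdsWithin⟩
  exact (tendsto_id.mono_left nhdsWithin_le_nhds).prodMk tendsto_const_nhds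

theorem conv_integrand_ne_zero {f : ∀ γ, 𝓐.Fiber (𝓖.rng γ)} {ξ : ∀ γ, 𝓐.Fiber (𝓖.src γ)} {γ γ' : G}
    (h : (𝓐.act γ).symm (𝓐.onFiber f (𝓖.rng γ) γ') *
      𝓐.onFiber ξ (𝓖.src γ) (𝓖.mul (𝓖.inv γ') γ) ≠ 0) :
    γ' ∈ 𝓐.supp f ∧ 𝓖.mul (𝓖.inv γ') γ ∈ 𝓐.supp ξ := by
  constructor
  · by_contra hn
    exact h (by rw [𝓐.onFiber_eq_zero hn, map_zero, zero_mul])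
  · by_contra hn
    exact h (by rw [𝓐.onFiber_eq_zero hn, mul_zero])

theorem integrable_conv {f : ∀ γ, 𝓐.Fiber (𝓖.rng γ)} (hf : f ∈ 𝓐.Cc 𝓖.rng)
    {ξ : ∀ γ, 𝓐.Fiber (𝓖.src γ)} (hξ : ξ ∈ 𝓐.Cc 𝓖.src) (γ : G) :
    Integrable (fun γ' => (𝓐.act γ).symm (𝓐.onFiber f (𝓖.rng γ) γ') *
      𝓐.onFiber ξ (𝓖.src γ) (𝓖.mul (𝓖.inv γ') γ)) (lam.meas (𝓖.rng γ)) :=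
  lam.integrable_of_continuousOn (𝓐.continuousOn_conv_integrand hf.1 hξ.1 γ) hf.2
    fun _ _ h => (𝓐.conv_integrand_ne_zero h).1

theorem conv_ne_zero {f : ∀ γ, 𝓐.Fiber (𝓖.rng γ)} {ξ : ∀ γ, 𝓐.Fiber (𝓖.src γ)} {γ : G}
    (h : 𝓐.conv lam f ξ γ ≠ 0) : γ ∈ 𝓖.setMul (𝓐.supp f) (𝓐.supp ξ) := by
  by_contra hn
  refine h (integral_eq_zero_of_ae ?_)
  filter_upwards [lam.ae_rng (𝓖.rng γ)] with γ' hγ'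
  by_contra h0
  obtain ⟨h1, h2⟩ := 𝓐.conv_integrand_ne_zero h0
  exact hn ⟨γ', h1, _, h2, by rw [𝓖.rng_mul (by rw [𝓖.src_inv, hγ']), 𝓖.rng_inv],
    (HaarSystem.mul_inv_cancel_left 𝓖 hγ').symm⟩

theorem isCompact_supp {q : G → X} {f : ∀ γ, 𝓐.Fiber (q γ)} (hf : f ∈ 𝓐.Cc q) :
    IsCompact (𝓐.supp f) := hf.2

/-- Convolution preserves `C_c(X; G, s^* A)`. -/
theorem conv_mem_Cc {f : ∀ γ, 𝓐.Fiber (𝓖.rng γ)} (hf : f ∈ 𝓐.Cc 𝓖.rng)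
    {ξ : ∀ γ, 𝓐.Fiber (𝓖.src γ)} (hξ : ξ ∈ 𝓐.Cc 𝓖.src) : 𝓐.conv lam f ξ ∈ 𝓐.Cc 𝓖.src := by
  refine 𝓐.mem_Cc_of_approx 𝓖.continuous_src (fun γ => ?_)
    (HaarSystem.isCompact_setMul 𝓖 (𝓐.isCompact_supp hf) (𝓐.isCompact_supp hξ))
    fun γ h => 𝓐.conv_ne_zero lam h
  exact lam.approx_integral (𝓖.continuous_rng.tendsto γ) (𝓐.isCompact_supp hf)
    (fun _ _ _ h => (𝓐.conv_integrand_ne_zero h).1)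
    (Eventually.of_forall fun γ => 𝓐.integrable_conv lam hf hξ γ)
    (𝓐.approx_conv_integrand hf.1 hξ.1 γ)

theorem supp_conv_subset {f : ∀ γ, 𝓐.Fiber (𝓖.rng γ)} (hf : f ∈ 𝓐.Cc 𝓖.rng)
    {ξ : ∀ γ, 𝓐.Fiber (𝓖.src γ)} (hξ : ξ ∈ 𝓐.Cc 𝓖.src) :
    𝓐.supp (𝓐.conv lam f ξ) ⊆ 𝓖.setMul (𝓐.supp f) (𝓐.supp ξ) :=
  𝓐.supp_subset (HaarSystem.isCompact_setMul 𝓖 (𝓐.isCompact_supp hf) (𝓐.isCompact_supp hξ)).isClosed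
    fun _ h => 𝓐.conv_ne_zero lam h

/-- The convolution as an integral operator on the arrows of range `x`. -/
theorem onFiber_conv {f : ∀ γ, 𝓐.Fiber (𝓖.rng γ)} (hf : f ∈ 𝓐.Cc 𝓖.rng)
    {ξ : ∀ γ, 𝓐.Fiber (𝓖.src γ)} (hξ : ξ ∈ 𝓐.Cc 𝓖.src) {x : X} {a : G} (ha : 𝓖.rng a = x) :
    𝓐.onFiber (𝓐.conv lam f ξ) x (𝓖.inv a) =
      ∫ b, 𝓐.kernel f x a b * 𝓐.onFiber ξ x (𝓖.inv b) ∂(lam.meas x) := by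
  obtain ⟨γ, rfl⟩ : ∃ γ, a = 𝓖.inv γ := ⟨𝓖.inv a, (𝓖.inv_inv a).symm⟩
  rw [𝓖.inv_inv]
  obtain rfl : 𝓖.src γ = x := by rw [← ha, 𝓖.rng_inv]
  rw [CXAlgebra.onFiber_self, conv, ← lam.integral_mul_left' γ
    (𝓐.continuousOn_conv_integrand hf.1 hξ.1 γ) (𝓐.isCompact_supp hf)
    fun _ _ h => (𝓐.conv_integrand_ne_zero h).1]
  refine integral_congr_ae ?_
  filter_upwards [lam.ae_rng (𝓖.src γ)] with b hb
  have e : 𝓖.mul (𝓖.inv (𝓖.mul γ b)) γ = 𝓖.inv b := by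
    rw [𝓖.inv_mul_rev hb.symm, 𝓖.mul_assoc (by rw [𝓖.src_inv, 𝓖.rng_inv, hb]) (𝓖.src_inv γ),
      𝓖.inv_mul, ← hb, ← 𝓖.src_inv, 𝓖.mul_unit]
  rw [e, act_symm_eq, kernel, 𝓖.inv_inv, 𝓖.src_inv]

/-- The product of the convolution algebra, transported from the convolution action on
sections of `s^* A`. -/
def mulSec (f g : ∀ γ, 𝓐.Fiber (𝓖.rng γ)) (γ : G) : 𝓐.Fiber (𝓖.rng γ) :=
  𝓐.act γ (𝓐.conv lam f (fun γ => (𝓐.act γ).symm (g γ)) γ)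

theorem mulSec_mem_Cc {f g : ∀ γ, 𝓐.Fiber (𝓖.rng γ)} (hf : f ∈ 𝓐.Cc 𝓖.rng)
    (hg : g ∈ 𝓐.Cc 𝓖.rng) : 𝓐.mulSec lam f g ∈ 𝓐.Cc 𝓖.rng :=
  𝓐.act_mem_Cc (𝓐.conv_mem_Cc lam hf (𝓐.isSection_act_symm hg))

theorem supp_mulSec_subset {f g : ∀ γ, 𝓐.Fiber (𝓖.rng γ)} (hf : f ∈ 𝓐.Cc 𝓖.rng)
    (hg : g ∈ 𝓐.Cc 𝓖.rng) : 𝓐.supp (𝓐.mulSec lam f g) ⊆ 𝓖.setMul (𝓐.supp f) (𝓐.supp g) := by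
  have e : 𝓐.supp (fun γ => (𝓐.act γ).symm (g γ)) = 𝓐.supp g := by simp [CXAlgebra.supp]
  refine (𝓐.supp_act _).subset.trans ?_
  rw [← e]
  exact 𝓐.supp_conv_subset lam hf (𝓐.isSection_act_symm hg)

/-- The kernel of a product is the composition of the kernels. -/
theorem kernel_mulSec {f g : ∀ γ, 𝓐.Fiber (𝓖.rng γ)} (hf : f ∈ 𝓐.Cc 𝓖.rng)
    (hg : g ∈ 𝓐.Cc 𝓖.rng) {x : X} {a c : G} (ha : 𝓖.rng a = x) (hc : 𝓖.rng c = x) :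
    𝓐.kernel (𝓐.mulSec lam f g) x a c =
      ∫ b, 𝓐.kernel f x a b * 𝓐.kernel g x b c ∂(lam.meas x) := by
  have hac : 𝓖.src (𝓖.inv a) = 𝓖.rng c := by rw [𝓖.src_inv, ha, hc]
  set γ := 𝓖.mul (𝓖.inv a) c with hγ
  have hγr : 𝓖.rng γ = 𝓖.src a := by rw [hγ, 𝓖.rng_mul hac, 𝓖.rng_inv]
  have hγs : 𝓖.src γ = 𝓖.src c := 𝓖.src_mul hac
  have hγm : 𝓖.mul a γ = c := HaarSystem.mul_inv_cancel_left 𝓖 (ha.trans hc.symm)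
  have hg' := 𝓐.isSection_act_symm hg
  have hcont : ContinuousOn (fun b => 𝓐.kernel f x a b * 𝓐.kernel g x b c)
      {b | 𝓖.rng b = 𝓖.rng a} := by
    rw [ha]
    refine ContinuousOn.mul ?_ ?_
    · exact (𝓐.continuousOn_kernel hf.1 x).comp (f := fun b => (a, b)) (by fun_prop)
        fun b hb => ⟨ha, hb⟩
    · exact (𝓐.continuousOn_kernel hg.1 x).comp (f := fun b => (b, c)) (by fun_prop)
        fun b hb => ⟨hb, hc⟩
  have hsupp : ∀ b, 𝓖.rng b = 𝓖.rng a → 𝓐.kernel f x a b * 𝓐.kernel g x b c ≠ 0 →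
      b ∈ 𝓖.setMul {a} (𝓐.supp f) := fun b hb h => by
    have h1 := 𝓐.kernel_ne_zero (left_ne_zero_of_mul h)
    exact ⟨a, rfl, _, h1, by rw [𝓖.rng_mul (by rw [𝓖.src_inv, hb]), 𝓖.rng_inv],
      (HaarSystem.mul_inv_cancel_left 𝓖 hb.symm).symm⟩
  have key := lam.integral_mul_left' a hcont
    (HaarSystem.isCompact_setMul 𝓖 isCompact_singleton (𝓐.isCompact_supp hf)) hsupp
  rw [ha] at key
  rw [← key, kernel, ← hγ, show 𝓐.mulSec lam f g = fun γ => 𝓐.act γ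
    (𝓐.conv lam f (fun γ => (𝓐.act γ).symm (g γ)) γ) from rfl, 𝓐.onFiber_act _ hγr,
    𝓐.tr_tr rfl hγr rfl ha hγm, ← trL_apply, conv,
    ← ContinuousLinearMap.integral_comp_comm _ (𝓐.integrable_conv lam hf hg' γ), ← hγr]
  refine integral_congr_ae ?_
  filter_upwards [lam.ae_rng (𝓖.rng γ)] with b hb
  rw [hγr] at hb
  have hbγ : 𝓖.src (𝓖.inv b) = 𝓖.rng γ := by rw [𝓖.src_inv, hb, hγr]
  have hab : 𝓖.src a = 𝓖.rng b := hb.symm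
  have e1 : 𝓖.mul (𝓖.inv a) (𝓖.mul a b) = b := HaarSystem.inv_mul_cancel_left 𝓖 hab
  have e2 : 𝓖.mul (𝓖.inv (𝓖.mul a b)) c = 𝓖.mul (𝓖.inv b) γ := by
    rw [𝓖.inv_mul_rev hab, 𝓖.mul_assoc (by rw [𝓖.src_inv, 𝓖.rng_inv, hab]) hac]
  have e3 : 𝓖.mul c (𝓖.inv γ) = a := by
    rw [← hγm, 𝓖.mul_inv_cancel_right hγr.symm]
  have hβ : 𝓖.src (𝓖.mul (𝓖.inv b) γ) = 𝓖.src γ := 𝓖.src_mul hbγ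
  have hβr : 𝓖.rng (𝓖.mul (𝓖.inv b) γ) = 𝓖.src b := by rw [𝓖.rng_mul hbγ, 𝓖.rng_inv]
  have e4 : 𝓖.mul c (𝓖.inv (𝓖.mul (𝓖.inv b) γ)) = 𝓖.mul a b := by
    rw [𝓖.inv_mul_rev hbγ, 𝓖.inv_inv, ← 𝓖.mul_assoc (by rw [𝓖.rng_inv, hγs])
      (by rw [𝓖.src_inv, hγr, hb]), e3]
  rw [trL_apply, tr_mul]
  congr 1
  · rw [act_symm_eq, 𝓐.tr_tr hγs.symm (𝓖.rng_inv γ) (𝓖.src_inv γ) (hc) e3, kernel, e1, hγr]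
  · rw [𝓐.onFiber_act_symm g hβ, 𝓐.tr_tr hγs.symm (by rw [𝓖.rng_inv, hβ]) (𝓖.src_inv _) hc e4,
      kernel, e2, 𝓖.src_mul hab, ← hβr, CXAlgebra.onFiber_self]

/-- Convolution by a product is the composition of the convolutions. -/
theorem conv_mulSec {f g : ∀ γ, 𝓐.Fiber (𝓖.rng γ)} (hf : f ∈ 𝓐.Cc 𝓖.rng)
    (hg : g ∈ 𝓐.Cc 𝓖.rng) {ξ : ∀ γ, 𝓐.Fiber (𝓖.src γ)} (hξ : ξ ∈ 𝓐.Cc 𝓖.src) :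
    𝓐.conv lam (𝓐.mulSec lam f g) ξ = 𝓐.conv lam f (𝓐.conv lam g ξ) := by
  ext γ
  obtain ⟨a, rfl⟩ : ∃ a, γ = 𝓖.inv a := ⟨𝓖.inv γ, (𝓖.inv_inv γ).symm⟩
  set x := 𝓖.src (𝓖.inv a) with hx
  have ha : 𝓖.rng a = x := (𝓖.src_inv a).symm
  rw [← CXAlgebra.onFiber_self _ (𝓐.conv lam (𝓐.mulSec lam f g) ξ),
    ← CXAlgebra.onFiber_self _ (𝓐.conv lam f (𝓐.conv lam g ξ)), ← hx,
    𝓐.onFiber_conv lam (𝓐.mulSec_mem_Cc lam hf hg) hξ ha,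
    𝓐.onFiber_conv lam hf (𝓐.conv_mem_Cc lam hg hξ) ha]
  have hkf : ContinuousOn (fun b => 𝓐.kernel f x a b) {b | 𝓖.rng b = x} :=
    (𝓐.continuousOn_kernel hf.1 x).comp (f := fun b => (a, b)) (by fun_prop) fun b hb => ⟨ha, hb⟩
  have hkg := 𝓐.continuousOn_kernel hg.1 x
  have hξc := 𝓐.continuousOn_onFiber_inv hξ.1 x
  have hL := L2.isCompact_inv (𝓐.isCompact_supp hξ)
  have hK := HaarSystem.isCompact_setMul 𝓖 (isCompact_singleton (x := a)) (𝓐.isCompact_supp hf)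
  have hfK : ∀ b, 𝓖.rng b = x → 𝓐.kernel f x a b ≠ 0 → b ∈ 𝓖.setMul {a} (𝓐.supp f) := by
    intro b hb h
    exact ⟨a, rfl, _, 𝓐.kernel_ne_zero h, by
      rw [𝓖.rng_mul (by rw [𝓖.src_inv, ha, hb]), 𝓖.rng_inv],
      (HaarSystem.mul_inv_cancel_left 𝓖 (ha.trans hb.symm)).symm⟩
  have hξL : ∀ c, 𝓐.onFiber ξ x (𝓖.inv c) ≠ 0 → c ∈ 𝓖.inv ⁻¹' 𝓐.supp ξ := by
    intro c h
    by_contra hn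
    exact h (𝓐.onFiber_eq_zero hn x)
  calc ∫ c, 𝓐.kernel (𝓐.mulSec lam f g) x a c * 𝓐.onFiber ξ x (𝓖.inv c) ∂(lam.meas x)
      = ∫ c, ∫ b, 𝓐.kernel f x a b * (𝓐.kernel g x b c * 𝓐.onFiber ξ x (𝓖.inv c))
          ∂(lam.meas x) ∂(lam.meas x) := by
        refine integral_congr_ae ?_
        filter_upwards [lam.ae_rng x] with c hc
        rw [𝓐.kernel_mulSec lam hf hg ha hc, ← integral_mul_const_of_integrable]
        · simp only [mul_assoc]
        · refine lam.integrable_of_continuousOn (hkf.mul (hkg.comp (f := fun b => (b, c))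
            (by fun_prop) fun b hb => ⟨hb, hc⟩)) hK fun b hb h => hfK b hb (left_ne_zero_of_mul h)
    _ = ∫ b, ∫ c, 𝓐.kernel f x a b * (𝓐.kernel g x b c * 𝓐.onFiber ξ x (𝓖.inv c))
          ∂(lam.meas x) ∂(lam.meas x) := by
        refine lam.integral_swap ?_ hL hK ?_
        · refine ContinuousOn.mul (hkf.comp (f := fun p : G × G => p.2) (by fun_prop)
            fun p hp => hp.2) (ContinuousOn.mul (hkg.comp (f := fun p : G × G => (p.2, p.1))
              (by fun_prop) fun p hp => ⟨hp.2, hp.1⟩) (hξc.comp (f := fun p : G × G => p.1)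
                (by fun_prop) fun p hp => hp.1))
        · intro c b hc hb h
          exact ⟨hξL c (right_ne_zero_of_mul (right_ne_zero_of_mul h)),
            hfK b hb (left_ne_zero_of_mul h)⟩
    _ = ∫ b, 𝓐.kernel f x a b * 𝓐.onFiber (𝓐.conv lam g ξ) x (𝓖.inv b) ∂(lam.meas x) := by
        refine integral_congr_ae ?_
        filter_upwards [lam.ae_rng x] with b hb
        rw [𝓐.onFiber_conv lam hg hξ hb, ← integral_const_mul_of_integrable]
        exact lam.integrable_of_continuousOn ((hkg.comp (f := fun c => (b, c))
            (by fun_prop) fun c hc => ⟨hb, hc⟩).mul hξc) hL fun c _ h =>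
              hξL c (right_ne_zero_of_mul h)

/-- The involution of the convolution algebra. -/
def starSec (f : ∀ γ, 𝓐.Fiber (𝓖.rng γ)) (γ : G) : 𝓐.Fiber (𝓖.rng γ) :=
  𝓐.act γ (star (𝓐.onFiber f (𝓖.src γ) (𝓖.inv γ)))

theorem supp_starSec_subset {f : ∀ γ, 𝓐.Fiber (𝓖.rng γ)} :
    𝓐.supp (𝓐.starSec f) ⊆ 𝓖.inv ⁻¹' 𝓐.supp f := by
  refine 𝓐.supp_subset (isClosed_closure.preimage 𝓖.continuous_inv) fun γ h => ?_
  by_contra hn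
  exact h (by rw [starSec, 𝓐.onFiber_eq_zero hn]; simp)

theorem starSec_mem_Cc {f : ∀ γ, 𝓐.Fiber (𝓖.rng γ)} (hf : f ∈ 𝓐.Cc 𝓖.rng) :
    𝓐.starSec f ∈ 𝓐.Cc 𝓖.rng := by
  refine 𝓐.act_mem_Cc (h := fun γ => star (𝓐.onFiber f (𝓖.src γ) (𝓖.inv γ))) ?_
  have hK : IsCompact (𝓖.inv ⁻¹' 𝓐.supp f) := by
    convert (𝓐.isCompact_supp hf).image 𝓖.continuous_inv using 1
    ext γ
    constructor
    · intro h; exact ⟨𝓖.inv γ, h, 𝓖.inv_inv γ⟩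
    · rintro ⟨γ, h, rfl⟩
      rw [Set.mem_preimage, 𝓖.inv_inv]; exact h
  refine 𝓐.mem_Cc_of_approx 𝓖.continuous_src (fun γ => ?_) hK fun γ h => ?_
  · exact (𝓐.approx_onFiber hf.1 (𝓖.continuous_inv.tendsto γ)
      (Eventually.of_forall fun γ => 𝓖.rng_inv γ)).star
  · by_contra hn
    exact h (by rw [𝓐.onFiber_eq_zero hn, star_zero])

/-- The kernel of the adjoint section is the adjoint kernel. -/
theorem kernel_starSec (f : ∀ γ, 𝓐.Fiber (𝓖.rng γ)) {x : X} {a b : G} (ha : 𝓖.rng a = x)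
    (hb : 𝓖.rng b = x) : 𝓐.kernel (𝓐.starSec f) x a b = star (𝓐.kernel f x b a) := by
  have hab : 𝓖.src (𝓖.inv a) = 𝓖.rng b := by rw [𝓖.src_inv, ha, hb]
  have hr : 𝓖.rng (𝓖.mul (𝓖.inv a) b) = 𝓖.src a := by rw [𝓖.rng_mul hab, 𝓖.rng_inv]
  have hs : 𝓖.src (𝓖.mul (𝓖.inv a) b) = 𝓖.src b := 𝓖.src_mul hab
  rw [kernel, show 𝓐.starSec f = fun γ => 𝓐.act γ (star (𝓐.onFiber f (𝓖.src γ) (𝓖.inv γ))) from rfl,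
    𝓐.onFiber_act _ hr, 𝓐.tr_tr rfl hr rfl ha
      (HaarSystem.mul_inv_cancel_left 𝓖 (ha.trans hb.symm)), tr_star, kernel, hs,
    𝓖.inv_mul_rev hab, 𝓖.inv_inv]

/-- Convolution by `f` and by its adjoint are adjoint to each other. -/
theorem form_conv {f : ∀ γ, 𝓐.Fiber (𝓖.rng γ)} (hf : f ∈ 𝓐.Cc 𝓖.rng) (x : X)
    (ξ η : 𝓐.Cc 𝓖.src) :
    (L2.preHilbert lam 𝓐.toCXAlgebra).form x ⟨𝓐.conv lam f ξ.1, 𝓐.conv_mem_Cc lam hf ξ.2⟩ η =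
      (L2.preHilbert lam 𝓐.toCXAlgebra).form x ξ
        ⟨𝓐.conv lam (𝓐.starSec f) η.1, 𝓐.conv_mem_Cc lam (𝓐.starSec_mem_Cc hf) η.2⟩ := by
  have hk := 𝓐.continuousOn_kernel hf.1 x
  have hξc := 𝓐.continuousOn_onFiber_inv ξ.2.1 x
  have hηc := 𝓐.continuousOn_onFiber_inv η.2.1 x
  have hL := L2.isCompact_inv (𝓐.isCompact_supp ξ.2)
  have hK := L2.isCompact_inv (𝓐.isCompact_supp η.2)
  have hs : ∀ (ξ : ∀ γ, 𝓐.Fiber (𝓖.src γ)) (c : G), 𝓐.onFiber ξ x (𝓖.inv c) ≠ 0 →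
      c ∈ 𝓖.inv ⁻¹' 𝓐.supp ξ := by
    intro ξ c h
    by_contra hn
    exact h (𝓐.onFiber_eq_zero hn x)
  change ∫ a, star (𝓐.onFiber (𝓐.conv lam f ξ.1) x (𝓖.inv a)) * 𝓐.onFiber η.1 x (𝓖.inv a)
      ∂(lam.meas x) = ∫ b, star (𝓐.onFiber ξ.1 x (𝓖.inv b)) *
        𝓐.onFiber (𝓐.conv lam (𝓐.starSec f) η.1) x (𝓖.inv b) ∂(lam.meas x)
  calc _ = ∫ a, ∫ b, star (𝓐.kernel f x a b * 𝓐.onFiber ξ.1 x (𝓖.inv b)) *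
          𝓐.onFiber η.1 x (𝓖.inv a) ∂(lam.meas x) ∂(lam.meas x) := by
        refine integral_congr_ae ?_
        filter_upwards [lam.ae_rng x] with a ha
        have hint : Integrable (fun b => 𝓐.kernel f x a b * 𝓐.onFiber ξ.1 x (𝓖.inv b))
            (lam.meas x) := lam.integrable_of_continuousOn ((hk.comp (f := fun b => (a, b))
            (by fun_prop) fun b hb => ⟨ha, hb⟩).mul hξc) hL fun b _ h =>
              hs _ b (right_ne_zero_of_mul h)
        have h1 := (starL' ℝ (A := 𝓐.Fiber x)).toContinuousLinearMap.integral_comp_comm hint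
        have h2 : star (∫ b, 𝓐.kernel f x a b * 𝓐.onFiber ξ.1 x (𝓖.inv b) ∂(lam.meas x)) =
            ∫ b, star (𝓐.kernel f x a b * 𝓐.onFiber ξ.1 x (𝓖.inv b)) ∂(lam.meas x) := h1.symm
        rw [𝓐.onFiber_conv lam hf ξ.2 ha, h2, ← integral_mul_const_of_integrable]
        exact ((starL' ℝ (A := 𝓐.Fiber x)).toContinuousLinearMap).integrable_comp hint
    _ = ∫ b, ∫ a, star (𝓐.kernel f x a b * 𝓐.onFiber ξ.1 x (𝓖.inv b)) *
          𝓐.onFiber η.1 x (𝓖.inv a) ∂(lam.meas x) ∂(lam.meas x) := by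
        refine lam.integral_swap ?_ hK hL ?_
        · exact (hk.mul (hξc.comp (f := fun p : G × G => p.2) (by fun_prop)
            fun p hp => hp.2)).star.mul (hηc.comp (f := fun p : G × G => p.1) (by fun_prop)
            fun p hp => hp.1)
        · intro a b ha hb h
          refine ⟨hs _ a (right_ne_zero_of_mul h), hs _ b fun h0 => h ?_⟩
          rw [h0, mul_zero, star_zero, zero_mul]
    _ = _ := by
        refine integral_congr_ae ?_
        filter_upwards [lam.ae_rng x] with b hb
        rw [𝓐.onFiber_conv lam (𝓐.starSec_mem_Cc hf) η.2 hb, ← integral_const_mul_of_integrable]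
        · refine integral_congr_ae ?_
          filter_upwards [lam.ae_rng x] with a ha
          rw [𝓐.kernel_starSec f hb ha, star_mul, mul_assoc]
        · exact lam.integrable_of_continuousOn ((((𝓐.continuousOn_kernel
            (𝓐.starSec_mem_Cc hf).1 x).comp (f := fun a => (b, a))
            (by fun_prop) fun a ha => ⟨hb, ha⟩)).mul hηc) hK fun a _ h =>
              hs _ a (right_ne_zero_of_mul h)

end GAlgebra

/-! ### Adjointable operators and their matrices -/

theorem CStarAlgebra.exists_norm_sq_sub_eq {A : Type*} [CStarAlgebra A] (T : A) :
    ∃ S : A, ((‖T‖ ^ 2 : ℝ) : ℂ) • (1 : A) - star T * T = star S * S := by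
  let _ := CStarAlgebra.spectralOrder A
  have _ := CStarAlgebra.spectralOrderedRing A
  have h : star T * T ≤ algebraMap ℝ _ (‖T‖ ^ 2) := CStarAlgebra.star_mul_le_algebraMap_norm_sq
  obtain ⟨S, hS⟩ := CStarAlgebra.nonneg_iff_eq_star_mul_self.1 (sub_nonneg.2 h)
  refine ⟨S, ?_⟩
  rw [← hS, Algebra.algebraMap_eq_smul_one, Complex.coe_smul]

theorem CStarAlgebra.exists_eq_star_mul_self_of_sum {A ι : Type*} [CStarAlgebra A] (s : Finset ι)
    (v : ι → A) : ∃ S : A, ∑ i ∈ s, v i * star (v i) = star S * S := by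
  let _ := CStarAlgebra.spectralOrder A
  have _ := CStarAlgebra.spectralOrderedRing A
  exact CStarAlgebra.nonneg_iff_eq_star_mul_self.1
    (Finset.sum_nonneg fun i _ => mul_star_self_nonneg (v i))

namespace PreHilbert

variable {X : Type*} {F : X → Type*} {V : Type*}
  [∀ x, NonUnitalCStarAlgebra (F x)] [∀ x, PartialOrder (F x)] [∀ x, StarOrderedRing (F x)]
  [AddCommGroup V] [Module ℂ V] (H : PreHilbert X F V)

theorem norm_toSpace_le_of_form_le {c : ℝ} (hc : 0 ≤ c) {v w : V}
    (h : ∀ x, H.form x v v ≤ (c ^ 2) • H.form x w w) : ‖H.toSpace v‖ ≤ c * ‖H.toSpace w‖ := by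
  refine H.norm_space_le (by positivity) fun x => ?_
  rw [inner_toSpace]
  refine (CStarAlgebra.norm_le_norm_of_nonneg_of_le ((H.isPosForm x).nonneg v) (h x)).trans ?_
  rw [norm_smul, Real.norm_of_nonneg (by positivity), mul_pow, ← H.inner_toSpace]
  gcongr
  exact H.norm_inner_self_le x _

/-- Two linear maps of the pre-Hilbert module that are bounded and adjoint to each other extend to an
adjointable operator. -/
theorem exists_adjointable {t s : V →ₗ[ℂ] V} {c : ℝ}
    (hts : ∀ x v w, H.form x (t v) w = H.form x v (s w))
    (ht : ∀ v, ‖H.toSpace (t v)‖ ≤ c * ‖H.toSpace v‖)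
    (hs : ∀ v, ‖H.toSpace (s v)‖ ≤ c * ‖H.toSpace v‖) :
    ∃ T : H.Adjointable, (∀ v, T.op (H.toSpace v) = H.toSpace (t v)) ∧
      ∀ v, T.adj (H.toSpace v) = H.toSpace (s v) := by
  have hd := H.denseRange_toSpace
  let T : H.Space →L[ℂ] H.Space := (H.toSpace ∘ₗ t).extendOfNorm H.toSpace
  let S : H.Space →L[ℂ] H.Space := (H.toSpace ∘ₗ s).extendOfNorm H.toSpace
  have hT : ∀ v, T (H.toSpace v) = H.toSpace (t v) := LinearMap.extendOfNorm_eq hd ⟨c, ht⟩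
  have hS : ∀ v, S (H.toSpace v) = H.toSpace (s v) := LinearMap.extendOfNorm_eq hd ⟨c, hs⟩
  refine ⟨Adjointable.mkPair T S fun x ξ η => ?_, hT, hS⟩
  refine H.eq_of_dense (f := fun ξ => H.innerFun x (T ξ, η)) (g := fun ξ => H.innerFun x (ξ, S η))
    ((H.continuous_left x η).comp T.continuous) (H.continuous_left x _) (fun v => ?_) ξ
  refine H.eq_of_dense (f := fun η => H.innerFun x (T (H.toSpace v), η))
    (g := fun η => H.innerFun x (H.toSpace v, S η))
    (H.continuous_right x _) ((H.continuous_right x _).comp S.continuous) (fun w => ?_) η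
  rw [hT, hS, innerFun_coe, innerFun_coe, hts]

namespace Adjointable

variable {H}

theorem norm_eq_op (T : H.Adjointable) : ‖T‖ = ‖T.op‖ := by
  rw [norm_eq_max, norm_op_eq, max_self]

/-- An adjointable operator is determined by the operator. -/
theorem ext_op {T S : H.Adjointable} (h : T.op = S.op) : T = S := by
  rw [← sub_eq_zero, ← norm_eq_zero, norm_eq_op]
  have : (T - S).op = T.op - S.op := rfl
  rw [this, h, sub_self, norm_zero]

/-- Evaluation of adjointable operators on a vector, as an additive map. -/
def applyHom (ξ : H.Space) : H.Adjointable →+ H.Space where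
  toFun T := T.op ξ
  map_zero' := rfl
  map_add' _ _ := rfl

theorem op_sum_apply {ι : Type*} (s : Finset ι) (T : ι → H.Adjointable) (ξ : H.Space) :
    (∑ i ∈ s, T i).op ξ = ∑ i ∈ s, (T i).op ξ :=
  map_sum (applyHom ξ) T s

theorem op_mul_apply (T S : H.Adjointable) (ξ : H.Space) : (T * S).op ξ = T.op (S.op ξ) := rfl

theorem inner_star (T : H.Adjointable) (x : X) (ξ η : H.Space) :
    H.inner x ξ ((star T).op η) = H.inner x (T.op ξ) η := (T.inner_op x ξ η).symm

/-- The value of the quadratic form of `star T * T`, for a matrix `T`. -/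
theorem inner_star_mul_self {n : ℕ} (T : CStarMatrix (Fin n) (Fin n) H.Adjointable) (x : X)
    (η : Fin n → H.Space) :
    ∑ i, H.inner x (η i) (∑ j, ((star T * T) i j).op (η j)) =
      ∑ k, H.inner x (∑ j, (T k j).op (η j)) (∑ j, (T k j).op (η j)) := by
  have e : ∀ i j, ((star T * T) i j).op (η j) =
      ∑ k, (star (T k i)).op ((T k j).op (η j)) := fun i j => by
    rw [CStarMatrix.mul_apply, op_sum_apply]; rfl
  simp only [e, map_sum, LinearMap.sum_apply, inner_star]
  rw [Finset.sum_congr rfl fun i _ => Finset.sum_comm, Finset.sum_comm]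
  refine Finset.sum_congr rfl fun k _ => ?_
  exact Finset.sum_comm

/-- A matrix `T` of adjointable operators satisfies `⟨T η, T η⟩(x) ≤ ‖T‖² ⟨η, η⟩(x)`. -/
theorem inner_matrix_le [PartialOrder H.Adjointable] [StarOrderedRing H.Adjointable] {n : ℕ}
    (T : CStarMatrix (Fin n) (Fin n) H.Adjointable) (x : X) (η : Fin n → H.Space) :
    ∑ k, H.inner x (∑ j, (T k j).op (η j)) (∑ j, (T k j).op (η j)) ≤
      (‖T‖ ^ 2) • ∑ j, H.inner x (η j) (η j) := by
  obtain ⟨S, hS⟩ := CStarAlgebra.exists_norm_sq_sub_eq T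
  have h1 := inner_star_mul_self T x η
  have h2 := inner_star_mul_self S x η
  have h3 : 0 ≤ ∑ k, H.inner x (∑ j, (S k j).op (η j)) (∑ j, (S k j).op (η j)) :=
    Finset.sum_nonneg fun k _ => (H.isPosForm_inner x).nonneg _
  have h4 : ∀ i, ∑ j, ((star S * S) i j).op (η j) =
      ((‖T‖ ^ 2 : ℝ) : ℂ) • η i - ∑ j, ((star T * T) i j).op (η j) := by
    intro i
    have h5 : ∀ j, ((star S * S) i j).op (η j) =
        ((‖T‖ ^ 2 : ℝ) : ℂ) • (if i = j then η j else 0) - ((star T * T) i j).op (η j) := by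
      intro j
      rw [← hS, CStarMatrix.sub_apply, CStarMatrix.smul_apply, CStarMatrix.one_apply]
      change ((‖T‖ ^ 2 : ℝ) : ℂ) • (if i = j then (1 : H.Adjointable) else 0).op (η j) -
        ((star T * T) i j).op (η j) = _
      split_ifs <;> rfl
    rw [Finset.sum_congr rfl fun j _ => h5 j, Finset.sum_sub_distrib, ← Finset.smul_sum]
    simp
  rw [← h2] at h3
  simp only [h4, map_sub, Finset.sum_sub_distrib, h1, map_smul] at h3
  rw [← Finset.smul_sum, Complex.coe_smul] at h3
  exact sub_nonneg.1 h3

/-- The operator norm of a matrix of adjointable operators is the norm of its action on vectors. -/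
theorem norm_matrix_le [PartialOrder H.Adjointable] [StarOrderedRing H.Adjointable] {n : ℕ}
    (T : CStarMatrix (Fin n) (Fin n) H.Adjointable) {c : ℝ} (hc : 0 ≤ c)
    (hT : ∀ (x : X) (η : Fin n → H.Space),
      ∑ k, H.inner x (∑ j, (T k j).op (η j)) (∑ j, (T k j).op (η j)) ≤
        (c ^ 2) • ∑ j, H.inner x (η j) (η j)) : ‖T‖ ≤ c := by
  -- The norm of `CStarMatrix` is that of the action on rows by multiplication from the right, so
  -- the estimate is applied to `star T`, and a row `v` is compared with the operator `S` such that
  -- `star S * S = ∑ i, v i * star (v i)`.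
  have hform : ∀ (v : Fin n → H.Adjointable) (S : H.Adjointable), ∑ i, v i * star (v i) = star S * S →
      ∀ (x : X) (ξ : H.Space), H.inner x (S.op ξ) (S.op ξ) =
        ∑ i, H.inner x ((star (v i)).op ξ) ((star (v i)).op ξ) := by
    intro v S hS x ξ
    rw [← inner_star, ← op_mul_apply, ← hS, op_sum_apply, map_sum]
    refine Finset.sum_congr rfl fun i _ => ?_
    rw [op_mul_apply, ← inner_star, star_star]
  rw [← norm_star T, CStarMatrix.norm_def]
  refine ContinuousLinearMap.opNorm_le_bound _ hc fun v => ?_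
  set w := CStarMatrix.toCLM (star T) v with hw
  have hwi : ∀ j, star (w j) = ∑ i, T j i * star (v i) := by
    intro j
    rw [hw, CStarMatrix.toCLM_apply_eq_sum]
    change star (∑ i, v i * star (T j i)) = _
    simp
  obtain ⟨S, hS⟩ := CStarAlgebra.exists_eq_star_mul_self_of_sum Finset.univ fun i => v i
  obtain ⟨R, hR⟩ := CStarAlgebra.exists_eq_star_mul_self_of_sum Finset.univ fun i => w i
  have hnv : ‖v‖ = ‖S‖ := by
    have := CStarModule.norm_sq_eq H.Adjointable (x := v)
    rw [WithCStarModule.pi_inner] at this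
    simp only [WithCStarModule.inner_def] at this
    rw [hS, CStarRing.norm_star_mul_self, ← sq] at this
    exact (sq_eq_sq₀ (norm_nonneg _) (norm_nonneg _)).1 this
  have hnw : ‖w‖ = ‖R‖ := by
    have := CStarModule.norm_sq_eq H.Adjointable (x := w)
    rw [WithCStarModule.pi_inner] at this
    simp only [WithCStarModule.inner_def] at this
    rw [hR, CStarRing.norm_star_mul_self, ← sq] at this
    exact (sq_eq_sq₀ (norm_nonneg _) (norm_nonneg _)).1 this
  rw [hnv, hnw, norm_eq_op R]
  refine R.op.opNorm_le_bound (by positivity) fun ξ => ?_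
  refine H.norm_space_le (by positivity) fun x => ?_
  have h1 : H.inner x (R.op ξ) (R.op ξ) ≤ (c ^ 2) • H.inner x (S.op ξ) (S.op ξ) := by
    rw [hform _ R hR, hform _ S hS]
    have := hT x fun i => (star (v i)).op ξ
    simpa only [hwi, op_sum_apply, op_mul_apply] using this
  refine (CStarAlgebra.norm_le_norm_of_nonneg_of_le ((H.isPosForm_inner x).nonneg _) h1).trans ?_
  rw [norm_smul, Real.norm_of_nonneg (by positivity), mul_assoc, mul_pow]
  gcongr
  refine (H.norm_inner_self_le x _).trans ?_
  gcongr
  rw [norm_eq_op]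
  exact S.op.le_opNorm ξ

/-- The inequality of `norm_matrix_le` may be checked on a dense set of vectors. -/
theorem norm_matrix_le_of_dense [PartialOrder H.Adjointable] [StarOrderedRing H.Adjointable]
    {n : ℕ} (T : CStarMatrix (Fin n) (Fin n) H.Adjointable) {c : ℝ} (hc : 0 ≤ c)
    (hT : ∀ (x : X) (v : Fin n → V),
      ∑ k, H.inner x (∑ j, (T k j).op (H.toSpace (v j))) (∑ j, (T k j).op (H.toSpace (v j))) ≤
        (c ^ 2) • ∑ j, H.form x (v j) (v j)) : ‖T‖ ≤ c := by
  refine norm_matrix_le T hc fun x η => ?_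
  have hd : DenseRange fun v : Fin n → V => fun j => H.toSpace (v j) :=
    DenseRange.piMap fun _ => H.denseRange_toSpace
  refine hd.induction_on (p := fun η : Fin n → H.Space =>
    ∑ k, H.inner x (∑ j, (T k j).op (η j)) (∑ j, (T k j).op (η j)) ≤
        (c ^ 2) • ∑ j, H.inner x (η j) (η j)) η ?_ fun v => ?_
  · have hcs := H.continuous_inner_self x
    refine isClosed_le ?_ ?_
    · exact continuous_finsetSum _ fun k _ => hcs.comp (f := fun η : Fin n → H.Space =>
        ∑ j, (T k j).op (η j)) (by fun_prop)
    · exact (continuous_finsetSum _ fun k _ => hcs.comp (f := fun η : Fin n → H.Space =>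
        η k) (by fun_prop)).const_smul _
  · simpa only [inner_toSpace] using hT x v

end Adjointable

end PreHilbert

/-! ### The operators of convolution -/

namespace PreHilbert

variable {X : Type*} {F : X → Type*} {V : Type*}
  [∀ x, NonUnitalCStarAlgebra (F x)] [∀ x, PartialOrder (F x)] [∀ x, StarOrderedRing (F x)]
  [AddCommGroup V] [Module ℂ V] {H : PreHilbert X F V}

/-- The adjoint of an adjointable operator can be computed on the pre-Hilbert module. -/
theorem Adjointable.adj_toSpace {T : H.Adjointable} {t s : V → V}
    (hT : ∀ v, T.op (H.toSpace v) = H.toSpace (t v))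
    (hts : ∀ x v w, H.form x (t v) w = H.form x v (s w)) (w : V) :
    T.adj (H.toSpace w) = H.toSpace (s w) := by
  refine H.ext_inner fun x ζ => ?_
  rw [← T.inner_op]
  refine H.eq_of_dense (f := fun ζ => H.innerFun x (T.op ζ, H.toSpace w))
    (g := fun ζ => H.innerFun x (ζ, H.toSpace (s w)))
    ((H.continuous_left x _).comp T.op.continuous) (H.continuous_left x _) (fun v => ?_) ζ
  rw [hT, innerFun_coe, innerFun_coe, hts]

theorem Adjointable.op_eq_of_toSpace {T S : H.Adjointable}
    (h : ∀ v, T.op (H.toSpace v) = S.op (H.toSpace v)) : T = S :=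
  Adjointable.ext_op (ContinuousLinearMap.ext
    (H.eq_of_dense T.op.continuous S.op.continuous h))

end PreHilbert

namespace CXAlgebra

variable {G X A : Type*} [TopologicalSpace G] [TopologicalSpace X] [T2Space G]
  [LocallyCompactSpace G] [T2Space X] [NonUnitalCStarAlgebra A] (C : CXAlgebra X A)

/-- Pointwise multiplication of compactly supported sections by a continuous function. -/
def mulFun {q : G → X} (hq : Continuous q) (k : C(G, ℝ)) : C.Cc q →ₗ[ℂ] C.Cc q where
  toFun f := ⟨fun γ => (k γ : ℂ) • f.1 γ, C.smul_mem_Cc hq f.2 (by fun_prop)⟩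
  map_add' f g := by ext γ; exact smul_add _ _ _
  map_smul' c f := by ext γ; exact smul_comm (k γ : ℂ) c (f.1 γ)

theorem onFiber_mulFun {q : G → X} (hq : Continuous q) (k : C(G, ℝ)) (f : C.Cc q) (x : X) (γ : G) :
    C.onFiber (C.mulFun hq k f).1 x γ = (k γ : ℂ) • C.onFiber f.1 x γ := by
  by_cases h : q γ = x
  · subst h; simp [onFiber, mulFun]
  · simp [onFiber, h]

theorem supp_mulFun_subset {q : G → X} (hq : Continuous q) (k : C(G, ℝ)) (f : C.Cc q) :
    C.supp (C.mulFun hq k f).1 ⊆ C.supp f.1 :=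
  closure_mono fun _ h h' => h (by simp [mulFun, h'])

theorem supp_mulFun_subset_tsupport {q : G → X} (hq : Continuous q) (k : C(G, ℝ)) (f : C.Cc q) :
    C.supp (C.mulFun hq k f).1 ⊆ tsupport k :=
  closure_mono fun _ h h' => h (by simp [mulFun, h'])

end CXAlgebra

namespace GAlgebra

variable {G X A : Type*} [TopologicalSpace G] [TopologicalSpace X] [T2Space G]
  [LocallyCompactSpace G] [T2Space X] [MeasurableSpace G] [BorelSpace G] [NonUnitalCStarAlgebra A]
  {𝓖 : TopGroupoid G X} (𝓐 : GAlgebra 𝓖 A) (lam : HaarSystem 𝓖)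

/-- The pre-Hilbert module `C_c(X; G, s^* A)`. -/
abbrev preL2 : PreHilbert X 𝓐.Fiber (𝓐.Cc 𝓖.src) := L2.preHilbert lam 𝓐.toCXAlgebra

/-- Convolution by an element of `C_c(X; G, r^* A)`, as a linear map. -/
def convL (f : 𝓐.Cc 𝓖.rng) : 𝓐.Cc 𝓖.src →ₗ[ℂ] 𝓐.Cc 𝓖.src where
  toFun ξ := ⟨𝓐.conv lam f.1 ξ.1, 𝓐.conv_mem_Cc lam f.2 ξ.2⟩
  map_add' ξ η := by
    ext γ
    refine Eq.trans ?_ (integral_add (𝓐.integrable_conv lam f.2 ξ.2 γ)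
      (𝓐.integrable_conv lam f.2 η.2 γ))
    refine integral_congr_ae (ae_of_all _ fun γ' => ?_)
    simp only [Submodule.coe_add, CXAlgebra.onFiber_add, mul_add]
  map_smul' c ξ := by
    ext γ
    refine Eq.trans ?_ (integral_smul c _)
    refine integral_congr_ae (ae_of_all _ fun γ' => ?_)
    simp only [Submodule.coe_smul, CXAlgebra.onFiber_smul, mul_smul_comm]

theorem convL_add (f g : 𝓐.Cc 𝓖.rng) (ξ : 𝓐.Cc 𝓖.src) :
    𝓐.convL lam (f + g) ξ = 𝓐.convL lam f ξ + 𝓐.convL lam g ξ := by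
  ext γ
  refine Eq.trans ?_ (integral_add (𝓐.integrable_conv lam f.2 ξ.2 γ)
    (𝓐.integrable_conv lam g.2 ξ.2 γ))
  refine integral_congr_ae (ae_of_all _ fun γ' => ?_)
  simp only [Submodule.coe_add, CXAlgebra.onFiber_add, map_add, add_mul]

theorem convL_smul (c : ℂ) (f : 𝓐.Cc 𝓖.rng) (ξ : 𝓐.Cc 𝓖.src) :
    𝓐.convL lam (c • f) ξ = c • 𝓐.convL lam f ξ := by
  ext γ
  refine Eq.trans ?_ (integral_smul c _)
  refine integral_congr_ae (ae_of_all _ fun γ' => ?_)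
  simp only [Submodule.coe_smul, CXAlgebra.onFiber_smul, map_smul, smul_mul_assoc]

theorem form_convL (f : 𝓐.Cc 𝓖.rng) (x : X) (ξ η : 𝓐.Cc 𝓖.src) :
    (𝓐.preL2 lam).form x (𝓐.convL lam f ξ) η =
      (𝓐.preL2 lam).form x ξ (𝓐.convL lam ⟨𝓐.starSec f.1, 𝓐.starSec_mem_Cc f.2⟩ η) :=
  𝓐.form_conv lam f.2 x ξ η

theorem isConvolution_iff {f : 𝓐.Cc 𝓖.rng} {T : 𝓐.AdjOps lam} :
    𝓐.IsConvolution lam f.1 T ↔ ∀ ξ, PreHilbert.Adjointable.op T ((𝓐.preL2 lam).toSpace ξ) =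
      (𝓐.preL2 lam).toSpace (𝓐.convL lam f ξ) := by
  refine forall_congr' fun ξ => ⟨?_, fun h => ⟨𝓐.convL lam f ξ, fun γ => rfl, h⟩⟩
  rintro ⟨ζ, h1, h2⟩
  rw [h2]
  congr 1
  ext γ
  exact h1 γ

theorem mem_convOps_iff {S : Set G} {T : 𝓐.AdjOps lam} : T ∈ 𝓐.convOps lam S ↔
    ∃ f : 𝓐.Cc 𝓖.rng, 𝓐.supp f.1 ⊆ S ∧ 𝓐.IsConvolution lam f.1 T :=
  ⟨fun ⟨f, h, h'⟩ => ⟨⟨f, h⟩, h'⟩, fun ⟨f, h'⟩ => ⟨f.1, f.2, h'⟩⟩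

theorem convOps_mono {S S' : Set G} (h : S ⊆ S') : 𝓐.convOps lam S ⊆ 𝓐.convOps lam S' :=
  fun _ ⟨f, hf, hS, hT⟩ => ⟨f, hf, hS.trans h, hT⟩

theorem IsConvolution.eq {f : 𝓐.Cc 𝓖.rng} {T T' : 𝓐.AdjOps lam} (h : 𝓐.IsConvolution lam f.1 T)
    (h' : 𝓐.IsConvolution lam f.1 T') : T = T' := by
  rw [isConvolution_iff] at h h'
  exact PreHilbert.Adjointable.op_eq_of_toSpace fun v => (h v).trans (h' v).symm

theorem IsConvolution.add {f g : 𝓐.Cc 𝓖.rng} {T T' : 𝓐.AdjOps lam}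
    (h : 𝓐.IsConvolution lam f.1 T) (h' : 𝓐.IsConvolution lam g.1 T') :
    𝓐.IsConvolution lam (f + g).1 (T + T') := by
  rw [isConvolution_iff] at h h' ⊢
  intro ξ
  rw [convL_add, map_add, ← h, ← h']
  rfl

theorem IsConvolution.smul {f : 𝓐.Cc 𝓖.rng} {T : 𝓐.AdjOps lam} (c : ℂ)
    (h : 𝓐.IsConvolution lam f.1 T) : 𝓐.IsConvolution lam (c • f).1 (c • T) := by
  rw [isConvolution_iff] at h ⊢
  intro ξ
  rw [convL_smul, map_smul, ← h]
  rfl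

theorem IsConvolution.mul {f g : 𝓐.Cc 𝓖.rng} {T T' : 𝓐.AdjOps lam}
    (h : 𝓐.IsConvolution lam f.1 T) (h' : 𝓐.IsConvolution lam g.1 T') :
    𝓐.IsConvolution lam (𝓐.mulSec lam f.1 g.1) (T * T') := by
  rw [show 𝓐.mulSec lam f.1 g.1 =
    (⟨_, 𝓐.mulSec_mem_Cc lam f.2 g.2⟩ : 𝓐.Cc 𝓖.rng).1 from rfl, isConvolution_iff]
  rw [isConvolution_iff] at h h'
  intro ξ
  refine (congrArg (PreHilbert.Adjointable.op T) (h' ξ)).trans ((h _).trans ?_)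
  congr 1
  ext1
  exact (𝓐.conv_mulSec lam f.2 g.2 ξ.2).symm

theorem IsConvolution.star {f : 𝓐.Cc 𝓖.rng} {T : 𝓐.AdjOps lam}
    (h : 𝓐.IsConvolution lam f.1 T) : 𝓐.IsConvolution lam (𝓐.starSec f.1) (star T) := by
  rw [show 𝓐.starSec f.1 =
    (⟨_, 𝓐.starSec_mem_Cc f.2⟩ : 𝓐.Cc 𝓖.rng).1 from rfl, isConvolution_iff]
  rw [isConvolution_iff] at h
  exact PreHilbert.Adjointable.adj_toSpace h (𝓐.form_convL lam f)

theorem zero_isConvolution : 𝓐.IsConvolution lam (0 : 𝓐.Cc 𝓖.rng).1 0 := by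
  rw [isConvolution_iff]
  intro ξ
  have : 𝓐.convL lam 0 ξ = 0 := by simpa using 𝓐.convL_smul lam 0 0 ξ
  rw [this, map_zero]
  rfl

theorem mul_mem_convOps {S S' : Set G} {T T' : 𝓐.AdjOps lam} (h : T ∈ 𝓐.convOps lam S)
    (h' : T' ∈ 𝓐.convOps lam S') : T * T' ∈ 𝓐.convOps lam (𝓖.setMul S S') := by
  rw [mem_convOps_iff] at h h'
  obtain ⟨f, hf, hT⟩ := h
  obtain ⟨g, hg, hT'⟩ := h'
  refine ⟨_, 𝓐.mulSec_mem_Cc lam f.2 g.2, (𝓐.supp_mulSec_subset lam f.2 g.2).trans ?_, hT.mul 𝓐 lam hT'⟩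
  rintro γ ⟨a, ha, b, hb, hab⟩
  exact ⟨a, hf ha, b, hg hb, hab⟩

theorem star_mem_convOps {S S' : Set G} {T : 𝓐.AdjOps lam} (h : T ∈ 𝓐.convOps lam S)
    (hS : ∀ γ ∈ S, 𝓖.inv γ ∈ S') : star T ∈ 𝓐.convOps lam S' := by
  rw [mem_convOps_iff] at h
  obtain ⟨f, hf, hT⟩ := h
  refine ⟨_, 𝓐.starSec_mem_Cc f.2, fun γ hγ => ?_, hT.star 𝓐 lam⟩
  rw [← 𝓖.inv_inv γ]
  exact hS _ (hf (𝓐.supp_starSec_subset hγ))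

/-- The elements of the reduced crossed product that are convolutions by sections with support in
`S`. -/
def convSubmodule (S : Set G) : Submodule ℂ (𝓐.ReducedCrossedProduct lam) where
  carrier := {T | 𝓐.incl lam T ∈ 𝓐.convOps lam S}
  zero_mem' := ⟨0, Submodule.zero_mem _, by simp [CXAlgebra.supp], 𝓐.zero_isConvolution lam⟩
  add_mem' := by
    intro T T' h h'
    rw [Set.mem_ofPred_eq, mem_convOps_iff] at h h'
    obtain ⟨f, hf, hT⟩ := h
    obtain ⟨g, hg, hT'⟩ := h'
    refine ⟨_, (f + g).2, ?_, hT.add 𝓐 lam hT'⟩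
    refine (closure_mono (t := {γ | f.1 γ ≠ 0} ∪ {γ | g.1 γ ≠ 0}) fun γ h => ?_).trans
      (closure_union.subset.trans (union_subset hf hg))
    by_contra hn
    simp only [Set.mem_union, Set.mem_ofPred_eq, not_or, not_not] at hn
    exact h (by simp [hn.1, hn.2])
  smul_mem' := by
    intro c T h
    rw [Set.mem_ofPred_eq, mem_convOps_iff] at h
    obtain ⟨f, hf, hT⟩ := h
    exact ⟨_, (c • f).2,
      (closure_mono (s := {γ | (c • f).1 γ ≠ 0}) (t := {γ | f.1 γ ≠ 0})
        fun γ h h' => h (by simp [show f.1 γ = 0 from h'])).trans hf, hT.smul 𝓐 lam c⟩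

theorem supported_eq (S : Set G) :
    𝓐.supported lam S = (𝓐.convSubmodule lam S).topologicalClosure := by
  rw [supported]
  congr 1
  exact Submodule.span_eq (𝓐.convSubmodule lam S)

theorem mem_supported_iff {S : Set G} {T : 𝓐.ReducedCrossedProduct lam} :
    T ∈ 𝓐.supported lam S ↔ T ∈ closure (𝓐.convSubmodule lam S : Set _) := by
  rw [supported_eq]; rfl

theorem isClosed_supported (S : Set G) :
    IsClosed (𝓐.supported lam S : Set (𝓐.ReducedCrossedProduct lam)) :=
  Submodule.isClosed_topologicalClosure _

theorem convSubmodule_mono {S S' : Set G} (h : S ⊆ S') :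
    𝓐.convSubmodule lam S ≤ 𝓐.convSubmodule lam S' := fun _ hT => 𝓐.convOps_mono lam h hT

theorem convSubmodule_le_supported (S : Set G) : 𝓐.convSubmodule lam S ≤ 𝓐.supported lam S := by
  rw [supported_eq]
  exact Submodule.le_topologicalClosure _

theorem supported_mono {S S' : Set G} (h : S ⊆ S') : 𝓐.supported lam S ≤ 𝓐.supported lam S' := by
  rw [supported_eq, supported_eq]
  exact Submodule.topologicalClosure_mono (𝓐.convSubmodule_mono lam h)

theorem mul_mem_supported {S S' S'' : Set G} (h : 𝓖.setMul S S' ⊆ S'')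
    {T T' : 𝓐.ReducedCrossedProduct lam} (hT : T ∈ 𝓐.supported lam S)
    (hT' : T' ∈ 𝓐.supported lam S') : T * T' ∈ 𝓐.supported lam S'' := by
  rw [mem_supported_iff] at *
  exact map_mem_closure₂ continuous_mul hT hT' fun a ha b hb =>
    𝓐.convOps_mono lam h (𝓐.mul_mem_convOps lam ha hb)

theorem star_mem_supported {S S' : Set G} (h : ∀ γ ∈ S, 𝓖.inv γ ∈ S')
    {T : 𝓐.ReducedCrossedProduct lam} (hT : T ∈ 𝓐.supported lam S) :
    star T ∈ 𝓐.supported lam S' := by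
  rw [mem_supported_iff] at *
  exact map_mem_closure continuous_star hT fun a ha => 𝓐.star_mem_convOps lam ha h

/-- The convolutions by sections with support in a set stable under products and inverses form a
⋆-algebra. -/
def convStarSubalgebra (S : Set G) (hS : 𝓖.setMul S S ⊆ S) (hS' : ∀ γ ∈ S, 𝓖.inv γ ∈ S) :
    NonUnitalStarSubalgebra ℂ (𝓐.ReducedCrossedProduct lam) where
  toSubmodule := 𝓐.convSubmodule lam S
  mul_mem' ha hb := 𝓐.convOps_mono lam hS (𝓐.mul_mem_convOps lam ha hb)
  star_mem' ha := 𝓐.star_mem_convOps lam ha hS'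

theorem setMul_subset (H : Subgroupoid 𝓖) : 𝓖.setMul H.carrier H.carrier ⊆ H.carrier := by
  rintro _ ⟨a, ha, b, hb, hab, rfl⟩
  exact H.mul_mem a ha b hb hab

/-- Convolutions supported in a subgroupoid form a ⋆-algebra, so that the C⋆-algebra that they generate
is just their closure. -/
theorem coe_subgroupoidAlgebra (H : Subgroupoid 𝓖) :
    (𝓐.subgroupoidAlgebra lam H : Set (𝓐.ReducedCrossedProduct lam)) =
      𝓐.supported lam H.carrier := by
  have e : NonUnitalStarAlgebra.adjoin ℂ {T | 𝓐.incl lam T ∈ 𝓐.convOps lam H.carrier} =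
      𝓐.convStarSubalgebra lam H.carrier (setMul_subset H) H.inv_mem :=
    le_antisymm (NonUnitalStarAlgebra.adjoin_le Subset.rfl)
      (NonUnitalStarAlgebra.subset_adjoin ℂ _)
  rw [supported_eq, subgroupoidAlgebra, e]
  rfl

theorem mem_subgroupoidAlgebra {H : Subgroupoid 𝓖} {T : 𝓐.ReducedCrossedProduct lam} :
    T ∈ 𝓐.subgroupoidAlgebra lam H ↔ T ∈ 𝓐.supported lam H.carrier := by
  rw [← SetLike.mem_coe, coe_subgroupoidAlgebra]; rfl

/-- The inclusion of the reduced crossed product in the adjointable operators, as a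
⋆-homomorphism. -/
def inclHom : 𝓐.ReducedCrossedProduct lam →⋆ₙₐ[ℂ] 𝓐.AdjOps lam :=
  NonUnitalStarSubalgebraClass.subtype (𝓐.crossedSub lam)

theorem incl_injective : Function.Injective (𝓐.incl lam) := Subtype.val_injective

theorem isometry_incl : Isometry (𝓐.incl lam) := isometry_subtype_coe

theorem exists_incl_eq {S : Set G} {T : 𝓐.AdjOps lam} (h : T ∈ 𝓐.convOps lam S) :
    ∃ T' ∈ 𝓐.convSubmodule lam S, 𝓐.incl lam T' = T :=
  ⟨⟨T, subset_closure (NonUnitalStarAlgebra.subset_adjoin ℂ _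
    (𝓐.convOps_mono lam (subset_univ S) h))⟩, h, rfl⟩

/-- The convolutions are dense in the reduced crossed product. -/
theorem supported_univ : 𝓐.supported lam Set.univ = ⊤ := by
  rw [eq_top_iff]
  intro T _
  rw [mem_supported_iff, (𝓐.isometry_incl lam).isEmbedding.isInducing.closure_eq_preimage_closure_image]
  have e : (NonUnitalStarAlgebra.adjoin ℂ (𝓐.convOps lam Set.univ) : Set (𝓐.AdjOps lam)) ⊆
      𝓐.incl lam '' (𝓐.convSubmodule lam Set.univ : Set (𝓐.ReducedCrossedProduct lam)) := by
    have h : NonUnitalStarAlgebra.adjoin ℂ (𝓐.convOps lam Set.univ) ≤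
        (𝓐.convStarSubalgebra lam Set.univ (subset_univ _) fun _ _ => trivial).map
          (𝓐.inclHom lam) := by
      refine NonUnitalStarAlgebra.adjoin_le fun T hT => ?_
      obtain ⟨T', h1, h2⟩ := 𝓐.exists_incl_eq lam hT
      exact ⟨T', h1, h2⟩
    exact h
  exact closure_mono e T.2

end GAlgebra

/-! ### Multipliers of the convolution algebra -/

namespace PreHilbert.Adjointable

variable {X : Type*} {F : X → Type*} {V : Type*}
  [∀ x, NonUnitalCStarAlgebra (F x)] [∀ x, PartialOrder (F x)] [∀ x, StarOrderedRing (F x)]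
  [AddCommGroup V] [Module ℂ V] {H : PreHilbert X F V}

/-- An adjointable operator satisfies `⟨T ξ, T ξ⟩(x) ≤ ‖T‖² ⟨ξ, ξ⟩(x)` in each fibre. -/
theorem inner_op_le (T : H.Adjointable) (x : X) (ξ : H.Space) :
    H.inner x (T.op ξ) (T.op ξ) ≤ (‖T‖ ^ 2) • H.inner x ξ ξ := by
  obtain ⟨S, hS⟩ := CStarAlgebra.exists_norm_sq_sub_eq T
  have h1 : 0 ≤ H.inner x ξ ((star S * S).op ξ) := by
    rw [op_mul_apply, inner_star]
    exact (H.isPosForm_inner x).nonneg _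
  have h2 : (star S * S).op ξ = ((‖T‖ ^ 2 : ℝ) : ℂ) • ξ - (star T).op (T.op ξ) := by
    rw [← hS]; rfl
  rw [h2, map_sub, map_smul, inner_star, Complex.coe_smul] at h1
  exact sub_nonneg.1 h1

theorem norm_le_of_form_le {T : H.Adjointable} {t : V → V}
    (hT : ∀ v, T.op (H.toSpace v) = H.toSpace (t v)) {c : ℝ} (hc : 0 ≤ c)
    (h : ∀ x v, H.form x (t v) (t v) ≤ (c ^ 2) • H.form x v v) : ‖T‖ ≤ c := by
  rw [norm_eq_op]
  refine T.op.opNorm_le_bound hc fun ξ => ?_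
  refine H.denseRange_toSpace.induction_on (p := fun ξ => ‖T.op ξ‖ ≤ c * ‖ξ‖) ξ ?_ fun v => ?_
  · exact isClosed_le (by fun_prop) (by fun_prop)
  · rw [hT]
    exact H.norm_toSpace_le_of_form_le hc fun x => h x v

end PreHilbert.Adjointable

theorem CStarMatrix.continuous_apply {n : ℕ} {B : Type*} [NonUnitalCStarAlgebra B]
    [PartialOrder B] [StarOrderedRing B] (i j : Fin n) :
    Continuous fun x : CStarMatrix (Fin n) (Fin n) B => x i j :=
  (_root_.continuous_apply j).comp (_root_.continuous_apply (A := fun _ : Fin n => Fin n → B) i)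

theorem CStarMatrix.continuous_map {n : ℕ} {B B' : Type*} [NonUnitalCStarAlgebra B]
    [PartialOrder B] [StarOrderedRing B] [NonUnitalCStarAlgebra B'] [PartialOrder B']
    [StarOrderedRing B']
    {f : B → B'} (hf : Continuous f) :
    Continuous fun x : CStarMatrix (Fin n) (Fin n) B => x.map f :=
  continuous_pi fun i => continuous_pi fun j => hf.comp (CStarMatrix.continuous_apply i j)

/-- Matrices with entries in a dense set are dense. -/
theorem CStarMatrix.mem_closure_of_forall {n : ℕ} {B : Type*} [NonUnitalCStarAlgebra B]
    [PartialOrder B] [StarOrderedRing B] {s : Set B}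
    {x : CStarMatrix (Fin n) (Fin n) B} (hx : ∀ i j, x i j ∈ closure s) :
    x ∈ closure {y : CStarMatrix (Fin n) (Fin n) B | ∀ i j, y i j ∈ s} := by
  have h : x ∈ closure (Set.univ.pi fun _ : Fin n => Set.univ.pi fun _ : Fin n => s) := by
    rw [closure_pi_set]
    intro i _
    rw [closure_pi_set]
    exact fun j _ => hx i j
  refine closure_mono ?_ h
  exact fun y hy i j => hy i trivial j trivial

namespace GAlgebra

variable {G X A : Type*} [TopologicalSpace G] [TopologicalSpace X] [T2Space G]
  [LocallyCompactSpace G] [T2Space X] [MeasurableSpace G] [BorelSpace G] [NonUnitalCStarAlgebra A]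
  {𝓖 : TopGroupoid G X} (𝓐 : GAlgebra 𝓖 A) (lam : HaarSystem 𝓖)

/-- The bound `c` for the action on columns of a matrix of convolutions. -/
def ConvBound {n : ℕ} (f : Fin n → Fin n → 𝓐.Cc 𝓖.rng) (c : ℝ) : Prop :=
  ∀ (x : X) (v : Fin n → 𝓐.Cc 𝓖.src),
    ∑ i, (𝓐.preL2 lam).form x (∑ j, 𝓐.convL lam (f i j) (v j)) (∑ j, 𝓐.convL lam (f i j) (v j)) ≤
      (c ^ 2) • ∑ j, (𝓐.preL2 lam).form x (v j) (v j)

/-- Pointwise multiplication by `k` is a complete contraction on convolutions: it preserves the bounds of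
matrices of every size. The bounds are stated on the pre-Hilbert module, so that the product by `k`
need not be known to act by a bounded operator. -/
def IsContractiveMultiplier (k : C(G, ℝ)) : Prop :=
  ∀ (n : ℕ) (f : Fin n → Fin n → 𝓐.Cc 𝓖.rng) (c : ℝ), 0 ≤ c → 𝓐.ConvBound lam f c →
    𝓐.ConvBound lam (fun i j => 𝓐.mulFun 𝓖.continuous_rng k (f i j)) c

/-- Convolution by `f` is bounded by the norm of the operator. -/
theorem IsConvolution.form_le {f : 𝓐.Cc 𝓖.rng} {T : 𝓐.AdjOps lam} (h : 𝓐.IsConvolution lam f.1 T)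
    (x : X) (v : 𝓐.Cc 𝓖.src) :
    (𝓐.preL2 lam).form x (𝓐.convL lam f v) (𝓐.convL lam f v) ≤
      (‖T‖ ^ 2) • (𝓐.preL2 lam).form x v v := by
  rw [isConvolution_iff] at h
  have := PreHilbert.Adjointable.inner_op_le (H := 𝓐.preL2 lam) T x ((𝓐.preL2 lam).toSpace v)
  rwa [h, PreHilbert.inner_toSpace, PreHilbert.inner_toSpace] at this

theorem IsContractiveMultiplier.form_le {k : C(G, ℝ)} (hk : 𝓐.IsContractiveMultiplier lam k)
    {f : 𝓐.Cc 𝓖.rng} {T : 𝓐.AdjOps lam} (h : 𝓐.IsConvolution lam f.1 T)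
    (x : X) (v : 𝓐.Cc 𝓖.src) :
    (𝓐.preL2 lam).form x (𝓐.convL lam (𝓐.mulFun 𝓖.continuous_rng k f) v)
      (𝓐.convL lam (𝓐.mulFun 𝓖.continuous_rng k f) v) ≤ (‖T‖ ^ 2) • (𝓐.preL2 lam).form x v v := by
  have := hk 1 (fun _ _ => f) ‖T‖ (norm_nonneg T) (fun x v => by
    simpa using h.form_le 𝓐 lam x (v 0)) x fun _ => v
  simpa using this

theorem starSec_mulFun (k : C(G, ℝ)) (f : 𝓐.Cc 𝓖.rng) :
    (⟨𝓐.starSec (𝓐.mulFun 𝓖.continuous_rng k f).1, 𝓐.starSec_mem_Cc (Subtype.prop _)⟩ :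
      𝓐.Cc 𝓖.rng) = 𝓐.mulFun 𝓖.continuous_rng (k.comp ⟨𝓖.inv, 𝓖.continuous_inv⟩)
        ⟨𝓐.starSec f.1, 𝓐.starSec_mem_Cc f.2⟩ := by
  ext γ
  change 𝓐.act γ (star (𝓐.onFiber (𝓐.mulFun 𝓖.continuous_rng k f).1 (𝓖.src γ) (𝓖.inv γ))) =
    (k (𝓖.inv γ) : ℂ) • 𝓐.act γ (star (𝓐.onFiber f.1 (𝓖.src γ) (𝓖.inv γ)))
  rw [CXAlgebra.onFiber_mulFun, star_smul, map_smul]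
  simp

/-- The product by `k` of a convolution operator is a convolution operator. -/
theorem exists_isConvolution_mulFun {k : C(G, ℝ)} (hk : 𝓐.IsContractiveMultiplier lam k)
    (hk' : 𝓐.IsContractiveMultiplier lam (k.comp ⟨𝓖.inv, 𝓖.continuous_inv⟩))
    {f : 𝓐.Cc 𝓖.rng} {T : 𝓐.AdjOps lam} (h : 𝓐.IsConvolution lam f.1 T) :
    ∃ T' : 𝓐.AdjOps lam, 𝓐.IsConvolution lam (𝓐.mulFun 𝓖.continuous_rng k f).1 T' := by
  have h' : 𝓐.IsConvolution lam
      (⟨𝓐.starSec f.1, 𝓐.starSec_mem_Cc f.2⟩ : 𝓐.Cc 𝓖.rng).1 (star T) := h.star 𝓐 lam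
  obtain ⟨T', hT', -⟩ := (𝓐.preL2 lam).exists_adjointable (c := ‖T‖)
    (𝓐.form_convL lam (𝓐.mulFun 𝓖.continuous_rng k f))
    (fun v => (𝓐.preL2 lam).norm_toSpace_le_of_form_le (norm_nonneg T)
      fun x => hk.form_le 𝓐 lam h x v)
    (fun v => (𝓐.preL2 lam).norm_toSpace_le_of_form_le (norm_nonneg T) fun x => by
      rw [starSec_mulFun, ← norm_star T]
      exact hk'.form_le 𝓐 lam h' x v)
  exact ⟨T', (𝓐.isConvolution_iff lam).2 hT'⟩

theorem norm_incl (T : 𝓐.ReducedCrossedProduct lam) : ‖𝓐.incl lam T‖ = ‖T‖ := rfl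

/-- A matrix over the crossed product has the norm of the matrix of operators. -/
theorem norm_map_incl [PartialOrder (𝓐.AdjOps lam)] [StarOrderedRing (𝓐.AdjOps lam)] {n : ℕ}
    (x : CStarMatrix (Fin n) (Fin n) (𝓐.ReducedCrossedProduct lam)) :
    ‖x.map (𝓐.incl lam)‖ = ‖x‖ := by
  refine NonUnitalStarAlgHom.norm_map (CStarMatrix.mapₙₐ (𝓐.inclHom lam)) (fun x y h => ?_) x
  exact CStarMatrix.map_injective (𝓐.incl_injective lam) h

/-- The norm of a matrix of convolutions is the least bound for its action on columns. -/
theorem norm_le_iff_convBound {n : ℕ}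
    {x : CStarMatrix (Fin n) (Fin n) (𝓐.ReducedCrossedProduct lam)}
    {f : Fin n → Fin n → 𝓐.Cc 𝓖.rng}
    (hf : ∀ i j, 𝓐.IsConvolution lam (f i j).1 (𝓐.incl lam (x i j))) {c : ℝ} (hc : 0 ≤ c) :
    ‖x‖ ≤ c ↔ 𝓐.ConvBound lam f c := by
  let _ : PartialOrder (𝓐.preL2 lam).Adjointable := CStarAlgebra.spectralOrder _
  have _ : StarOrderedRing (𝓐.preL2 lam).Adjointable := CStarAlgebra.spectralOrderedRing _
  let _ : PartialOrder (𝓐.AdjOps lam) := CStarAlgebra.spectralOrder _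
  have _ : StarOrderedRing (𝓐.AdjOps lam) := CStarAlgebra.spectralOrderedRing _
  obtain ⟨y, hy, hf'⟩ : ∃ y : CStarMatrix (Fin n) (Fin n) (𝓐.preL2 lam).Adjointable, ‖y‖ = ‖x‖ ∧
      ∀ i j v, (y i j).op ((𝓐.preL2 lam).toSpace v) =
        (𝓐.preL2 lam).toSpace (𝓐.convL lam (f i j) v) :=
    ⟨x.map (𝓐.incl lam), 𝓐.norm_map_incl lam x, fun i j => (𝓐.isConvolution_iff lam).1 (hf i j)⟩
  rw [← hy]
  constructor
  · intro h z v
    have := PreHilbert.Adjointable.inner_matrix_le y z fun j => (𝓐.preL2 lam).toSpace (v j)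
    simp only [hf', ← map_sum, PreHilbert.inner_toSpace] at this
    refine this.trans ?_
    refine smul_le_smul_of_nonneg_right (pow_le_pow_left₀ (norm_nonneg _) h 2) ?_
    exact Finset.sum_nonneg fun j _ => ((𝓐.preL2 lam).isPosForm z).nonneg _
  · intro h
    refine PreHilbert.Adjointable.norm_matrix_le_of_dense y hc fun z v => ?_
    simp only [hf', ← map_sum, PreHilbert.inner_toSpace]
    exact h z v

/-- A contractive multiplier `k` such that `γ ↦ k (γ⁻¹)` is contractive too acts on the reduced
crossed product, by complete contractions. -/
theorem exists_multiplier {k : C(G, ℝ)} (hk : 𝓐.IsContractiveMultiplier lam k)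
    (hk' : 𝓐.IsContractiveMultiplier lam (k.comp ⟨𝓖.inv, 𝓖.continuous_inv⟩)) :
    ∃ Φ : 𝓐.ReducedCrossedProduct lam →L[ℂ] 𝓐.ReducedCrossedProduct lam,
      (∀ (f : 𝓐.Cc 𝓖.rng) T, 𝓐.IsConvolution lam f.1 (𝓐.incl lam T) →
        𝓐.IsConvolution lam (𝓐.mulFun 𝓖.continuous_rng k f).1 (𝓐.incl lam (Φ T))) ∧
      ∀ (n : ℕ) (x : CStarMatrix (Fin n) (Fin n) (𝓐.ReducedCrossedProduct lam)),
        ‖x.map Φ‖ ≤ ‖x‖ := by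
  -- the graph of the multiplication by `k` on the convolution operators
  let R : Submodule ℂ (𝓐.ReducedCrossedProduct lam × 𝓐.ReducedCrossedProduct lam) :=
    { carrier := {p | ∃ f : 𝓐.Cc 𝓖.rng, 𝓐.IsConvolution lam f.1 (𝓐.incl lam p.1) ∧
        𝓐.IsConvolution lam (𝓐.mulFun 𝓖.continuous_rng k f).1 (𝓐.incl lam p.2)}
      zero_mem' := ⟨0, 𝓐.zero_isConvolution lam, by
        rw [map_zero]; exact 𝓐.zero_isConvolution lam⟩
      add_mem' := by
        rintro p q ⟨f, hf, hf'⟩ ⟨g, hg, hg'⟩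
        refine ⟨f + g, hf.add 𝓐 lam hg, ?_⟩
        rw [map_add]
        exact hf'.add 𝓐 lam hg'
      smul_mem' := by
        rintro c p ⟨f, hf, hf'⟩
        refine ⟨c • f, hf.smul 𝓐 lam c, ?_⟩
        rw [map_smul]
        exact hf'.smul 𝓐 lam c }
  have hR : ∀ (f : 𝓐.Cc 𝓖.rng) T, 𝓐.IsConvolution lam f.1 (𝓐.incl lam T) →
      ∃ T', 𝓐.IsConvolution lam (𝓐.mulFun 𝓖.continuous_rng k f).1 (𝓐.incl lam T') := by
    intro f T h
    obtain ⟨S, hS⟩ := 𝓐.exists_isConvolution_mulFun lam hk hk' h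
    obtain ⟨T', -, rfl⟩ := 𝓐.exists_incl_eq lam (S := Set.univ) ⟨_, Subtype.prop _, subset_univ _, hS⟩
    exact ⟨T', hS⟩
  let e : R →ₗ[ℂ] 𝓐.ReducedCrossedProduct lam := (LinearMap.fst ℂ _ _).comp R.subtype
  let g : R →ₗ[ℂ] 𝓐.ReducedCrossedProduct lam := (LinearMap.snd ℂ _ _).comp R.subtype
  have hd : DenseRange e := by
    intro T
    have h : T ∈ 𝓐.supported lam Set.univ := by rw [supported_univ]; trivial
    rw [mem_supported_iff] at h
    refine closure_mono (fun S hS => ?_) h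
    obtain ⟨f, -, hS⟩ := (𝓐.mem_convOps_iff lam).1 hS
    obtain ⟨S', hS'⟩ := hR f S hS
    exact ⟨⟨(S, S'), f, hS, hS'⟩, rfl⟩
  have hb : ∀ p, ‖g p‖ ≤ 1 * ‖e p‖ := by
    rintro ⟨⟨T, T'⟩, f, hf, hf'⟩
    rw [one_mul]
    change ‖T'‖ ≤ ‖T‖
    rw [← norm_incl, ← norm_incl]
    exact PreHilbert.Adjointable.norm_le_of_form_le (H := 𝓐.preL2 lam)
      ((𝓐.isConvolution_iff lam).1 hf') (norm_nonneg (𝓐.incl lam T)) fun x v => hk.form_le 𝓐 lam hf x v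
  have hΦ : ∀ (f : 𝓐.Cc 𝓖.rng) T, 𝓐.IsConvolution lam f.1 (𝓐.incl lam T) →
      𝓐.IsConvolution lam (𝓐.mulFun 𝓖.continuous_rng k f).1
        (𝓐.incl lam (g.extendOfNorm e T)) := by
    intro f T h
    obtain ⟨T', hT'⟩ := hR f T h
    have h1 : g.extendOfNorm e T = T' :=
      LinearMap.extendOfNorm_eq hd ⟨1, hb⟩ ⟨(T, T'), f, h, hT'⟩
    rwa [h1]
  refine ⟨g.extendOfNorm e, hΦ, fun n x => ?_⟩
  have hx : x ∈ closure {y : CStarMatrix (Fin n) (Fin n) (𝓐.ReducedCrossedProduct lam) |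
      ∀ i j, y i j ∈ (𝓐.convSubmodule lam Set.univ : Set (𝓐.ReducedCrossedProduct lam))} := by
    refine CStarMatrix.mem_closure_of_forall fun i j => ?_
    rw [← mem_supported_iff, supported_univ]
    trivial
  have hcl : IsClosed {x : CStarMatrix (Fin n) (Fin n) (𝓐.ReducedCrossedProduct lam) |
      ‖x.map (g.extendOfNorm e)‖ ≤ ‖x‖} :=
    isClosed_le (CStarMatrix.continuous_map (g.extendOfNorm e).continuous).norm continuous_norm
  refine closure_minimal (fun y hy => ?_) hcl hx
  have hy' : ∀ i j, ∃ f : 𝓐.Cc 𝓖.rng, 𝓐.IsConvolution lam f.1 (𝓐.incl lam (y i j)) := fun i j => by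
    obtain ⟨f, -, h⟩ := (𝓐.mem_convOps_iff lam).1 (hy i j)
    exact ⟨f, h⟩
  choose f hf using hy'
  refine (𝓐.norm_le_iff_convBound lam (f := fun i j => 𝓐.mulFun 𝓖.continuous_rng k (f i j))
    (fun i j => hΦ _ _ (hf i j)) (norm_nonneg y)).2 ?_
  exact hk n f _ (norm_nonneg y) ((𝓐.norm_le_iff_convBound lam hf (norm_nonneg y)).1 le_rfl)

end GAlgebra

/-! ### Multipliers supported in a relatively clopen subgroupoid -/

/-- A locally constant equivalence relation on a compact set has finitely many classes, which are
separated by continuous functions. -/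
theorem IsCompact.exists_finset_separating {G : Type*} [TopologicalSpace G] [T2Space G]
    [LocallyCompactSpace G] {K : Set G} (hK : IsCompact K) {E : G → G → Prop}
    (hrefl : ∀ a ∈ K, E a a) (hsymm : ∀ a ∈ K, ∀ b ∈ K, E a b → E b a)
    (htrans : ∀ a ∈ K, ∀ b ∈ K, ∀ c ∈ K, E a b → E b c → E a c)
    (hE : ∀ a ∈ K, ∀ᶠ b in 𝓝[K] a, E a b) :
    ∃ (t : Finset G) (h : G → C(G, ℝ)), (t : Set G) ⊆ K ∧
      (∀ a ∈ t, ∀ b ∈ K, E a b → h a b = 1) ∧ (∀ a ∈ t, ∀ b ∈ K, ¬ E a b → h a b = 0) ∧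
      (∀ b ∈ K, ∃ a ∈ t, E a b) ∧ ∀ a ∈ t, ∀ a' ∈ t, E a a' → a = a' := by
  classical
  have : CompactSpace K := isCompact_iff_compactSpace.1 hK
  let s : Setoid K :=
    { r := fun a b => E a b
      iseqv := ⟨fun a => hrefl a a.2, fun {a b} => hsymm a a.2 b b.2,
        fun {a b c} => htrans a a.2 b b.2 c c.2⟩ }
  have hopen : ∀ a : K, IsOpen {b : K | E a b} := fun a => by
    refine isOpen_iff_mem_nhds.2 fun b hb => ?_
    have h1 : ∀ᶠ c : K in 𝓝 b, E b c := by
      have := hE b b.2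
      rw [nhdsWithin_eq_map_subtype_coe b.2] at this
      exact this
    filter_upwards [h1] with c hc using htrans a a.2 b b.2 c c.2 hb hc
  have hclosed : ∀ a : K, IsClosed {b : K | E a b} := fun a => by
    rw [← isOpen_compl_iff, isOpen_iff_mem_nhds]
    intro b hb
    filter_upwards [(hopen b).mem_nhds (hrefl b b.2)] with c hc hac
    exact hb (htrans a a.2 c c.2 b b.2 hac (hsymm b b.2 c c.2 hc))
  have hd : DiscreteTopology (Quotient s) := by
    refine discreteTopology_iff_isOpen_singleton.2 fun q => ?_
    obtain ⟨a, rfl⟩ := q.exists_rep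
    refine isQuotientMap_quot_mk.isOpen_preimage.1 ?_
    convert hopen a using 1
    ext b
    exact ⟨fun h => s.symm (Quotient.exact h), fun h => Quotient.sound (s.symm h)⟩
  have hfin : Finite (Quotient s) := finite_of_compact_of_discrete
  have hfin' : Fintype (Quotient s) := Fintype.ofFinite _
  have hsep : ∀ a : K, ∃ h : C(G, ℝ), (∀ b ∈ K, E a b → h b = 1) ∧ ∀ b ∈ K, ¬ E a b → h b = 0 := by
    intro a
    have h1 : IsCompact (Subtype.val '' {b : K | E a b}) :=
      (hclosed a).isCompact.image continuous_subtype_val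
    have h2 : IsCompact (Subtype.val '' {b : K | E a b}ᶜ) :=
      (hopen a).isClosed_compl.isCompact.image continuous_subtype_val
    obtain ⟨h, h1, h0, -, -⟩ := exists_continuous_one_zero_of_isCompact h1 h2.isClosed
      ((Set.disjoint_image_iff Subtype.val_injective).2 disjoint_compl_right)
    exact ⟨h, fun b hb hab => h1 ⟨⟨b, hb⟩, hab, rfl⟩, fun b hb hab => h0 ⟨⟨b, hb⟩, hab, rfl⟩⟩
  choose h h1 h0 using hsep
  have hout : ∀ b : K, E (Quotient.mk s b).out b := fun b => Quotient.mk_out (s := s) b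
  refine ⟨Finset.univ.image fun q : Quotient s => (q.out : G),
    fun a => if ha : a ∈ K then h ⟨a, ha⟩ else 0, ?_, ?_, ?_, ?_, ?_⟩
  · intro a ha
    obtain ⟨q, -, rfl⟩ := Finset.mem_image.1 (Finset.mem_coe.1 ha)
    exact q.out.2
  · intro a ha b hb hab
    obtain ⟨q, -, rfl⟩ := Finset.mem_image.1 ha
    simpa using h1 q.out b hb hab
  · intro a ha b hb hab
    obtain ⟨q, -, rfl⟩ := Finset.mem_image.1 ha
    simpa using h0 q.out b hb hab
  · intro b hb
    exact ⟨_, Finset.mem_image_of_mem _ (Finset.mem_univ (Quotient.mk s ⟨b, hb⟩)), hout ⟨b, hb⟩⟩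
  · intro a ha a' ha' hab
    obtain ⟨q, -, rfl⟩ := Finset.mem_image.1 ha
    obtain ⟨q', -, rfl⟩ := Finset.mem_image.1 ha'
    have : q = q' := Quotient.out_equiv_out.1 hab
    rw [this]

namespace Subgroupoid

variable {G X : Type*} [TopologicalSpace G] [TopologicalSpace X] {𝓖 : TopGroupoid G X}
  (H : Subgroupoid 𝓖)

/-- The arrows `a` and `b` of the same range differ by an element of `H`. -/
def Rel (a b : G) : Prop := 𝓖.mul (𝓖.inv a) b ∈ H.carrier

variable {H}

theorem Rel.symm {a b : G} (hab : 𝓖.rng a = 𝓖.rng b) (h : H.Rel a b) : H.Rel b a := by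
  have := H.inv_mem _ h
  rwa [𝓖.inv_mul_rev (by rw [𝓖.src_inv, hab]), 𝓖.inv_inv] at this

theorem Rel.trans {a b c : G} (hab : 𝓖.rng a = 𝓖.rng b) (hbc : 𝓖.rng b = 𝓖.rng c)
    (h : H.Rel a b) (h' : H.Rel b c) : H.Rel a c := by
  have h1 : 𝓖.src (𝓖.inv a) = 𝓖.rng b := by rw [𝓖.src_inv, hab]
  have h2 : 𝓖.src (𝓖.inv b) = 𝓖.rng c := by rw [𝓖.src_inv, hbc]
  have := H.mul_mem _ h _ h' (by rw [𝓖.src_mul h1, 𝓖.rng_mul h2, 𝓖.rng_inv])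
  rwa [𝓖.mul_assoc h1 (by rw [𝓖.rng_mul h2, 𝓖.rng_inv]), ← 𝓖.mul_assoc (𝓖.rng_inv b).symm h2,
    𝓖.mul_inv, hbc, 𝓖.unit_mul] at this

theorem rel_self {a : G} (ha : 𝓖.src a ∈ H.unitSpace) : H.Rel a a := by
  rw [Rel, 𝓖.inv_mul]; exact ha

/-- The function `γ ↦ φ (r γ) φ (s γ)` on the subgroupoid `H`, extended by `0`. -/
def cutoffFun (H : Subgroupoid 𝓖) (φ : C(X, ℝ)) (γ : G) : ℝ :=
  open Classical in if γ ∈ H.carrier then φ (𝓖.rng γ) * φ (𝓖.src γ) else 0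

theorem cutoffFun_of_mem {φ : C(X, ℝ)} {γ : G} (h : γ ∈ H.carrier) :
    H.cutoffFun φ γ = φ (𝓖.rng γ) * φ (𝓖.src γ) := if_pos h

theorem cutoffFun_of_notMem {φ : C(X, ℝ)} {γ : G} (h : γ ∉ H.carrier) : H.cutoffFun φ γ = 0 :=
  if_neg h

/-- Since `H` is closed in `G_Y` for its unit space `Y`, and `φ` has support in `Y`, the cut-off function
vanishes outside a subset of `H` that is closed in `G`. -/
theorem exists_isClosed_cutoffFun (hH : H.IsRelativelyClopen) {φ : C(X, ℝ)}
    (hφ : tsupport φ ⊆ H.unitSpace) :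
    ∃ Z : Set G, IsClosed Z ∧ Z ⊆ H.carrier ∧ ∀ γ, γ ∉ Z → H.cutoffFun φ γ = 0 := by
  obtain ⟨-, C, hC, hHC⟩ := hH
  refine ⟨C ∩ 𝓖.src ⁻¹' tsupport φ,
    hC.inter ((isClosed_tsupport φ).preimage 𝓖.continuous_src), ?_, fun γ hγ => ?_⟩
  · rw [hHC]
    exact fun γ h => ⟨h.1, hφ h.2⟩
  · by_cases h : γ ∈ H.carrier
    · rw [cutoffFun_of_mem h]
      rw [hHC] at h
      have : φ (𝓖.src γ) = 0 := by
        by_contra hne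
        exact hγ ⟨h.1, subset_tsupport _ hne⟩
      rw [this, mul_zero]
    · exact cutoffFun_of_notMem h

theorem continuous_cutoffFun (hH : H.IsRelativelyClopen) {φ : C(X, ℝ)}
    (hφ : tsupport φ ⊆ H.unitSpace) : Continuous (H.cutoffFun φ) := by
  obtain ⟨Z, hZ, hZH, h0⟩ := exists_isClosed_cutoffFun hH hφ
  rw [continuous_iff_continuousAt]
  intro γ
  by_cases h : γ ∈ H.carrier
  · have hc : Continuous fun γ => φ (𝓖.rng γ) * φ (𝓖.src γ) :=
      (φ.continuous.comp 𝓖.continuous_rng).mul (φ.continuous.comp 𝓖.continuous_src)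
    refine hc.continuousAt.congr ?_
    filter_upwards [hH.1.1.mem_nhds h] with γ' h' using (cutoffFun_of_mem h').symm
  · refine continuousAt_const (y := (0 : ℝ)) |>.congr ?_
    filter_upwards [hZ.isOpen_compl.mem_nhds fun h' => h (hZH h')] with γ' h' using (h0 γ' h').symm

/-- The function `γ ↦ φ (r γ) φ (s γ)` on a relatively clopen subgroupoid `H`, extended by `0`. -/
def cutoff (hH : H.IsRelativelyClopen) {φ : C(X, ℝ)} (hφ : tsupport φ ⊆ H.unitSpace) : C(G, ℝ) :=
  ⟨H.cutoffFun φ, continuous_cutoffFun hH hφ⟩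

theorem cutoff_of_mem (hH : H.IsRelativelyClopen) {φ : C(X, ℝ)} (hφ : tsupport φ ⊆ H.unitSpace)
    {γ : G} (h : γ ∈ H.carrier) : cutoff hH hφ γ = φ (𝓖.rng γ) * φ (𝓖.src γ) := if_pos h

theorem cutoff_of_notMem (hH : H.IsRelativelyClopen) {φ : C(X, ℝ)}
    (hφ : tsupport φ ⊆ H.unitSpace) {γ : G} (h : γ ∉ H.carrier) : cutoff hH hφ γ = 0 := if_neg h

theorem tsupport_cutoff_subset (hH : H.IsRelativelyClopen) {φ : C(X, ℝ)}
    (hφ : tsupport φ ⊆ H.unitSpace) : tsupport (cutoff hH hφ) ⊆ H.carrier := by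
  obtain ⟨Z, hZ, hZH, h0⟩ := exists_isClosed_cutoffFun hH hφ
  refine (closure_minimal (fun γ h => ?_) hZ).trans hZH
  by_contra hn
  exact h (h0 γ hn)

theorem cutoff_comp_inv (hH : H.IsRelativelyClopen) {φ : C(X, ℝ)}
    (hφ : tsupport φ ⊆ H.unitSpace) :
    (cutoff hH hφ).comp ⟨𝓖.inv, 𝓖.continuous_inv⟩ = cutoff hH hφ := by
  ext γ
  change cutoff hH hφ (𝓖.inv γ) = _
  by_cases h : γ ∈ H.carrier
  · rw [cutoff_of_mem hH hφ h, cutoff_of_mem hH hφ (H.inv_mem γ h), 𝓖.rng_inv, 𝓖.src_inv, mul_comm]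
  · rw [cutoff_of_notMem hH hφ h, cutoff_of_notMem hH hφ fun h' => h ?_]
    rw [← 𝓖.inv_inv γ]
    exact H.inv_mem _ h'

end Subgroupoid

namespace GAlgebra

variable {G X A : Type*} [TopologicalSpace G] [TopologicalSpace X] [T2Space G]
  [LocallyCompactSpace G] [T2Space X] [MeasurableSpace G] [BorelSpace G] [NonUnitalCStarAlgebra A]
  {𝓖 : TopGroupoid G X} (𝓐 : GAlgebra 𝓖 A) (lam : HaarSystem 𝓖)

/-- Sums of squares of norms in `L²(G, A)` are compared pointwise. -/
theorem sum_form_le {ι κ : Type*} (s : Finset ι) (t : Finset κ) (v : ι → 𝓐.Cc 𝓖.src)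
    (w : κ → 𝓐.Cc 𝓖.src) (x : X) (h : ∀ b, 𝓖.rng b = x →
      ∑ i ∈ s, star (𝓐.onFiber (v i).1 x (𝓖.inv b)) * 𝓐.onFiber (v i).1 x (𝓖.inv b) ≤
        ∑ i ∈ t, star (𝓐.onFiber (w i).1 x (𝓖.inv b)) * 𝓐.onFiber (w i).1 x (𝓖.inv b)) :
    ∑ i ∈ s, (𝓐.preL2 lam).form x (v i) (v i) ≤ ∑ i ∈ t, (𝓐.preL2 lam).form x (w i) (w i) := by
  change ∑ i ∈ s, ∫ b, L2.integrand 𝓐.toCXAlgebra (v i).1 (v i).1 x b ∂(lam.meas x) ≤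
    ∑ i ∈ t, ∫ b, L2.integrand 𝓐.toCXAlgebra (w i).1 (w i).1 x b ∂(lam.meas x)
  rw [← integral_finsetSum _ fun i _ => L2.integrable lam (v i).2 (v i).2 x,
    ← integral_finsetSum _ fun i _ => L2.integrable lam (w i).2 (w i).2 x]
  refine integral_mono_ae (integrable_finsetSum _ fun i _ => L2.integrable lam (v i).2 (v i).2 x)
    (integrable_finsetSum _ fun i _ => L2.integrable lam (w i).2 (w i).2 x) ?_
  filter_upwards [lam.ae_rng x] with b hb using h b hb

theorem star_smul_mul_smul_le {B : Type*} [NonUnitalCStarAlgebra B] [PartialOrder B]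
    [StarOrderedRing B] {c : ℝ} (hc : |c| ≤ 1) (b : B) :
    star ((c : ℂ) • b) * ((c : ℂ) • b) ≤ star b * b := by
  rw [star_smul, smul_mul_smul_comm]
  have : star (c : ℂ) * (c : ℂ) = ((c ^ 2 : ℝ) : ℂ) := by simp [sq]
  rw [this, Complex.coe_smul]
  have h2 : c ^ 2 ≤ 1 := (sq_le_one_iff_abs_le_one c).2 hc
  simpa using smul_le_smul_of_nonneg_right h2 (star_mul_self_nonneg b)

theorem form_mulFun_le {k : C(G, ℝ)} (hk : ∀ γ, |k γ| ≤ 1) (v : 𝓐.Cc 𝓖.src) (x : X) :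
    (𝓐.preL2 lam).form x (𝓐.mulFun 𝓖.continuous_src k v) (𝓐.mulFun 𝓖.continuous_src k v) ≤
      (𝓐.preL2 lam).form x v v := by
  have := 𝓐.sum_form_le lam {()} {()} (fun _ => 𝓐.mulFun 𝓖.continuous_src k v) (fun _ => v) x
    fun b _ => by
      simp only [Finset.sum_singleton, CXAlgebra.onFiber_mulFun]
      exact star_smul_mul_smul_le (hk _) _
  simpa using this

/-- The function `φ ∘ r` on `G`. -/
def rngFun (𝓖 : TopGroupoid G X) (φ : C(X, ℝ)) : C(G, ℝ) := φ.comp ⟨𝓖.rng, 𝓖.continuous_rng⟩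

/-- The function `φ ∘ s` on `G`. -/
def srcFun (𝓖 : TopGroupoid G X) (φ : C(X, ℝ)) : C(G, ℝ) := φ.comp ⟨𝓖.src, 𝓖.continuous_src⟩

/-- Multiplication by `φ ∘ r` of a convolution is its composition with a contraction of `L²(G, A)`. -/
theorem isContractiveMultiplier_rngFun {φ : C(X, ℝ)} (hφ : ∀ x, |φ x| ≤ 1) :
    𝓐.IsContractiveMultiplier lam (rngFun 𝓖 φ) := by
  intro n f c _ h x v
  have e : ∀ (f : 𝓐.Cc 𝓖.rng) v, 𝓐.convL lam (𝓐.mulFun 𝓖.continuous_rng (rngFun 𝓖 φ) f) v =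
      𝓐.mulFun 𝓖.continuous_src (rngFun 𝓖 φ) (𝓐.convL lam f v) := by
    intro f v
    ext γ
    refine Eq.trans (integral_congr_ae ?_) (integral_smul ((φ (𝓖.rng γ) : ℝ) : ℂ) _)
    filter_upwards [lam.ae_rng (𝓖.rng γ)] with b hb
    have : rngFun 𝓖 φ b = φ (𝓖.rng γ) := congrArg φ hb
    rw [CXAlgebra.onFiber_mulFun, map_smul, smul_mul_assoc, this]
  simp only [e, ← map_sum]
  exact (Finset.sum_le_sum fun i _ => 𝓐.form_mulFun_le lam (fun γ => hφ _) _ x).trans (h x v)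

/-- Multiplication by `φ ∘ s` of a convolution is its composition, on the other side, with a contraction of
`L²(G, A)`. -/
theorem isContractiveMultiplier_srcFun {φ : C(X, ℝ)} (hφ : ∀ x, |φ x| ≤ 1) :
    𝓐.IsContractiveMultiplier lam (srcFun 𝓖 φ) := by
  intro n f c _ h x v
  have e : ∀ (f : 𝓐.Cc 𝓖.rng) v, 𝓐.convL lam (𝓐.mulFun 𝓖.continuous_rng (srcFun 𝓖 φ) f) v =
      𝓐.convL lam f (𝓐.mulFun 𝓖.continuous_src (rngFun 𝓖 φ) v) := by
    intro f v
    ext γ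
    refine integral_congr_ae ?_
    filter_upwards [lam.ae_rng (𝓖.rng γ)] with b hb
    have hr : 𝓖.rng (𝓖.mul (𝓖.inv b) γ) = 𝓖.src b := by
      rw [𝓖.rng_mul (by rw [𝓖.src_inv, hb]), 𝓖.rng_inv]
    rw [CXAlgebra.onFiber_mulFun, CXAlgebra.onFiber_mulFun, map_smul, smul_mul_assoc, mul_smul_comm]
    simp only [rngFun, srcFun, ContinuousMap.comp_apply, ContinuousMap.coe_mk, hr]
  simp only [e]
  refine (h x _).trans (smul_le_smul_of_nonneg_left ?_ (by positivity))
  exact Finset.sum_le_sum fun i _ => 𝓐.form_mulFun_le lam (fun γ => hφ _) _ x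

theorem onFiber_sum {q : G → X} {ι : Type*} (s : Finset ι) (v : ι → 𝓐.Cc q) (x : X) (γ : G) :
    𝓐.onFiber (∑ i ∈ s, v i : 𝓐.Cc q).1 x γ = ∑ i ∈ s, 𝓐.onFiber (v i).1 x γ := by
  let φ : 𝓐.Cc q →+ 𝓐.Fiber x :=
    { toFun := fun v => 𝓐.onFiber v.1 x γ
      map_zero' := by
        have := 𝓐.onFiber_smul 0 (0 : 𝓐.Cc q).1 x γ
        rw [zero_smul, zero_smul] at this
        exact this
      map_add' := fun v w => 𝓐.onFiber_add v.1 w.1 x γ }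
  exact map_sum φ v s

/-- The multiplier attached to a relatively clopen subgroupoid `H` is contractive: over the arrows of
range `x`, it is the compression to the blocks given by the classes modulo `H`, only finitely many
of which meet a given compact set. -/
theorem isContractiveMultiplier_cutoff {H : Subgroupoid 𝓖} (hH : H.IsRelativelyClopen)
    {φ : C(X, ℝ)} (hφ : tsupport φ ⊆ H.unitSpace) (hφ1 : ∀ x, |φ x| ≤ 1) :
    𝓐.IsContractiveMultiplier lam (Subgroupoid.cutoff hH hφ) := by
  intro n f c _ hf x v
  -- the inverses of the arrows of `K` carry the fibre over `x` of the vectors `v j`, cut off by `φ`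
  set K : Set G := ({b | 𝓖.rng b = x} ∩ 𝓖.src ⁻¹' tsupport φ) ∩ ⋃ j, 𝓖.inv ⁻¹' 𝓐.supp (v j).1 with hK
  have hKc : IsCompact K := (isCompact_iUnion fun j => L2.isCompact_inv
    (𝓐.isCompact_supp (v j).2)).inter_left ((HaarSystem.isClosed_rng 𝓖 x).inter
      ((isClosed_tsupport φ).preimage 𝓖.continuous_src))
  have hKr : ∀ a ∈ K, 𝓖.rng a = x := fun a ha => ha.1.1
  have hself : ∀ a ∈ K, H.Rel a a := fun a ha => Subgroupoid.rel_self (hφ ha.1.2)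
  obtain ⟨t, h, htK, h1, h0, hex, huniq⟩ := hKc.exists_finset_separating (E := H.Rel) hself
    (fun a ha b hb => Subgroupoid.Rel.symm ((hKr a ha).trans (hKr b hb).symm))
    (fun a ha b hb c hc => Subgroupoid.Rel.trans ((hKr a ha).trans (hKr b hb).symm)
      ((hKr b hb).trans (hKr c hc).symm))
    (fun a ha => by
      have hc := HaarSystem.continuousOn_mul_left 𝓖 (𝓖.inv a) a
        (by simp [𝓖.src_inv])
      refine nhdsWithin_mono a (fun b hb => ?_) (hc.eventually (hH.1.1.mem_nhds (hself a ha)))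
      simp [𝓖.src_inv, hKr a ha, hKr b hb])
  have hzero : ∀ j b, 𝓖.rng b = x → b ∉ K →
      (φ (𝓖.src b) : ℂ) • 𝓐.onFiber (v j).1 x (𝓖.inv b) = 0 := by
    intro j b hb hbK
    by_contra hne
    have h2 : φ (𝓖.src b) ≠ 0 := fun h => hne (by rw [h]; simp)
    have h3 : 𝓖.inv b ∈ 𝓐.supp (v j).1 := by
      by_contra hn
      exact hne (by rw [𝓐.onFiber_eq_zero hn, smul_zero])
    exact hbK ⟨⟨hb, subset_tsupport _ h2⟩, mem_iUnion.2 ⟨j, h3⟩⟩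
  -- the part of `v` in the block of `a`, cut off by `φ`
  set w : G → Fin n → 𝓐.Cc 𝓖.src := fun a j => 𝓐.mulFun 𝓖.continuous_src
    ((h a).comp ⟨𝓖.inv, 𝓖.continuous_inv⟩ * rngFun 𝓖 φ) (v j) with hw
  have hwv : ∀ a j b, 𝓐.onFiber (w a j).1 x (𝓖.inv b) =
      (h a b : ℂ) • (φ (𝓖.src b) : ℂ) • 𝓐.onFiber (v j).1 x (𝓖.inv b) := by
    intro a j b
    rw [hw, CXAlgebra.onFiber_mulFun, _root_.smul_smul]
    simp [rngFun, 𝓖.inv_inv, 𝓖.rng_inv]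
  have hbound : ∀ j, ∑ a ∈ t, (𝓐.preL2 lam).form x (w a j) (w a j) ≤
      (𝓐.preL2 lam).form x (v j) (v j) := by
    intro j
    have := 𝓐.sum_form_le lam t {()} (fun a => w a j) (fun _ => v j) x fun b hb => by
      simp only [Finset.sum_singleton, hwv]
      by_cases hbK : b ∈ K
      · obtain ⟨a, ha, hab⟩ := hex b hbK
        rw [Finset.sum_eq_single_of_mem a ha fun a' ha' hne => ?_]
        · rw [h1 a ha b hbK hab, Complex.ofReal_one, one_smul]
          exact star_smul_mul_smul_le (hφ1 _) _
        · have : ¬ H.Rel a' b := fun ha'b => hne <| huniq a' ha' a ha <|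
            Subgroupoid.Rel.trans ((hKr _ (htK ha')).trans hb.symm)
              (hb.trans (hKr _ (htK ha)).symm) ha'b
              (Subgroupoid.Rel.symm ((hKr _ (htK ha)).trans hb.symm) hab)
          rw [h0 a' ha' b hbK this]
          simp
      · simp only [hzero j b hb hbK, smul_zero, mul_zero, Finset.sum_const_zero]
        exact star_mul_self_nonneg _
    simpa using this
  -- Over `b₁⁻¹`, the left-hand side is `φ (s b₁)` times the convolution of `f` with the block of `b₁`,
  -- and vanishes if no block contains `b₁`.
  have hblock : ∀ i, (𝓐.preL2 lam).form x
      (∑ j, 𝓐.convL lam (𝓐.mulFun 𝓖.continuous_rng (Subgroupoid.cutoff hH hφ) (f i j)) (v j))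
      (∑ j, 𝓐.convL lam (𝓐.mulFun 𝓖.continuous_rng (Subgroupoid.cutoff hH hφ) (f i j)) (v j)) ≤
      ∑ a ∈ t, (𝓐.preL2 lam).form x (∑ j, 𝓐.convL lam (f i j) (w a j))
        (∑ j, 𝓐.convL lam (f i j) (w a j)) := by
    intro i
    have := 𝓐.sum_form_le lam {()} t (fun _ => ∑ j, 𝓐.convL lam
      (𝓐.mulFun 𝓖.continuous_rng (Subgroupoid.cutoff hH hφ) (f i j)) (v j))
      (fun a => ∑ j, 𝓐.convL lam (f i j) (w a j)) x fun b₁ hb₁ => by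
      simp only [Finset.sum_singleton]
      have hrs : ∀ b, 𝓖.rng b = x → 𝓖.rng (𝓖.mul (𝓖.inv b₁) b) = 𝓖.src b₁ ∧
          𝓖.src (𝓖.mul (𝓖.inv b₁) b) = 𝓖.src b := fun b hb => by
        have : 𝓖.src (𝓖.inv b₁) = 𝓖.rng b := by rw [𝓖.src_inv, hb₁, hb]
        rw [𝓖.rng_mul this, 𝓖.src_mul this, 𝓖.rng_inv]
        exact ⟨rfl, rfl⟩
      have hker : ∀ j, 𝓐.onFiber (𝓐.convL lam (𝓐.mulFun 𝓖.continuous_rng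
          (Subgroupoid.cutoff hH hφ) (f i j)) (v j)).1 x (𝓖.inv b₁) =
          ∫ b, (Subgroupoid.cutoff hH hφ (𝓖.mul (𝓖.inv b₁) b) : ℂ) •
            𝓐.kernel (f i j).1 x b₁ b * 𝓐.onFiber (v j).1 x (𝓖.inv b) ∂(lam.meas x) := by
        intro j
        refine (𝓐.onFiber_conv lam (𝓐.mulFun 𝓖.continuous_rng
          (Subgroupoid.cutoff hH hφ) (f i j)).2 (v j).2 hb₁).trans ?_
        congr 1
        ext b
        congr 1
        exact 𝓐.kernel_smul (fun γ => (Subgroupoid.cutoff hH hφ γ : ℂ)) _ x b₁ b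
      by_cases hab : ∃ a ∈ t, H.Rel a b₁
      · obtain ⟨a, ha, hab⟩ := hab
        have hra : 𝓖.rng a = x := hKr _ (htK ha)
        have key : 𝓐.onFiber (∑ j, 𝓐.convL lam (𝓐.mulFun 𝓖.continuous_rng
            (Subgroupoid.cutoff hH hφ) (f i j)) (v j) : 𝓐.Cc 𝓖.src).1 x (𝓖.inv b₁) =
            (φ (𝓖.src b₁) : ℂ) •
              𝓐.onFiber (∑ j, 𝓐.convL lam (f i j) (w a j) : 𝓐.Cc 𝓖.src).1 x (𝓖.inv b₁) := by
          rw [onFiber_sum, onFiber_sum, Finset.smul_sum]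
          refine Finset.sum_congr rfl fun j _ => ?_
          rw [hker j, show (𝓐.convL lam (f i j) (w a j)).1 = 𝓐.conv lam (f i j).1 (w a j).1 from rfl,
            𝓐.onFiber_conv lam (f i j).2 (w a j).2 hb₁, ← integral_smul]
          refine integral_congr_ae ?_
          filter_upwards [lam.ae_rng x] with b hb
          rw [hwv]
          have hrel : H.Rel a b ↔ 𝓖.mul (𝓖.inv b₁) b ∈ H.carrier :=
            ⟨fun h => Subgroupoid.Rel.trans (hb₁.trans hra.symm) (hra.trans hb.symm)
              (Subgroupoid.Rel.symm (hra.trans hb₁.symm) hab) h,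
              fun h => Subgroupoid.Rel.trans (hra.trans hb₁.symm) (hb₁.trans hb.symm) hab h⟩
          have hcut : (Subgroupoid.cutoff hH hφ (𝓖.mul (𝓖.inv b₁) b) : ℂ) •
              𝓐.onFiber (v j).1 x (𝓖.inv b) = (φ (𝓖.src b₁) : ℂ) • (h a b : ℂ) •
                (φ (𝓖.src b) : ℂ) • 𝓐.onFiber (v j).1 x (𝓖.inv b) := by
            by_cases hm : 𝓖.mul (𝓖.inv b₁) b ∈ H.carrier
            · rw [Subgroupoid.cutoff_of_mem hH hφ hm, (hrs b hb).1, (hrs b hb).2, Complex.ofReal_mul,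
                mul_smul]
              by_cases hbK : b ∈ K
              · rw [h1 a ha b hbK (hrel.2 hm), Complex.ofReal_one, one_smul]
              · rw [hzero j b hb hbK, smul_zero, smul_zero, smul_zero]
            · rw [Subgroupoid.cutoff_of_notMem hH hφ hm, Complex.ofReal_zero, zero_smul]
              by_cases hbK : b ∈ K
              · rw [h0 a ha b hbK fun h => hm (hrel.1 h)]
                simp
              · rw [hzero j b hb hbK, smul_zero, smul_zero]
          rw [smul_mul_assoc, ← mul_smul_comm, hcut, mul_smul_comm]
        rw [key]
        refine (star_smul_mul_smul_le (hφ1 _) _).trans ?_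
        exact Finset.single_le_sum (f := fun a => star (𝓐.onFiber
          (∑ j, 𝓐.convL lam (f i j) (w a j) : 𝓐.Cc 𝓖.src).1 x (𝓖.inv b₁)) *
          𝓐.onFiber (∑ j, 𝓐.convL lam (f i j) (w a j) : 𝓐.Cc 𝓖.src).1 x (𝓖.inv b₁))
          (fun a _ => star_mul_self_nonneg _) ha
      · have key : 𝓐.onFiber (∑ j, 𝓐.convL lam (𝓐.mulFun 𝓖.continuous_rng
            (Subgroupoid.cutoff hH hφ) (f i j)) (v j) : 𝓐.Cc 𝓖.src).1 x (𝓖.inv b₁) = 0 := by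
          rw [onFiber_sum]
          refine Finset.sum_eq_zero fun j _ => ?_
          rw [hker j]
          refine integral_eq_zero_of_ae ?_
          filter_upwards [lam.ae_rng x] with b hb
          rw [smul_mul_assoc, ← mul_smul_comm]
          by_cases hm : 𝓖.mul (𝓖.inv b₁) b ∈ H.carrier
          · have hbK : b ∉ K := fun hbK => by
              obtain ⟨a, ha, hrel⟩ := hex b hbK
              have hra : 𝓖.rng a = x := hKr _ (htK ha)
              exact hab ⟨a, ha, Subgroupoid.Rel.trans (hra.trans hb.symm) (hb.trans hb₁.symm) hrel
                (Subgroupoid.Rel.symm (hb₁.trans hb.symm) hm)⟩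
            rw [Subgroupoid.cutoff_of_mem hH hφ hm, (hrs b hb).2, Complex.ofReal_mul, mul_smul,
              hzero j b hb hbK, smul_zero, mul_zero]
            rfl
          · rw [Subgroupoid.cutoff_of_notMem hH hφ hm, Complex.ofReal_zero, zero_smul, mul_zero]
            rfl
        rw [key, mul_zero]
        exact Finset.sum_nonneg fun a _ => star_mul_self_nonneg _
    simpa using this
  calc _ ≤ ∑ i, ∑ a ∈ t, (𝓐.preL2 lam).form x (∑ j, 𝓐.convL lam (f i j) (w a j))
        (∑ j, 𝓐.convL lam (f i j) (w a j)) := Finset.sum_le_sum fun i _ => hblock i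
    _ = ∑ a ∈ t, ∑ i, (𝓐.preL2 lam).form x (∑ j, 𝓐.convL lam (f i j) (w a j))
        (∑ j, 𝓐.convL lam (f i j) (w a j)) := Finset.sum_comm
    _ ≤ ∑ a ∈ t, (c ^ 2) • ∑ j, (𝓐.preL2 lam).form x (w a j) (w a j) :=
        Finset.sum_le_sum fun a _ => hf x (w a)
    _ = (c ^ 2) • ∑ j, ∑ a ∈ t, (𝓐.preL2 lam).form x (w a j) (w a j) := by
        rw [← Finset.smul_sum, Finset.sum_comm]
    _ ≤ _ := smul_le_smul_of_nonneg_left (Finset.sum_le_sum fun j _ => hbound j) (by positivity)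

end GAlgebra

/-! ### The controlled Mayer–Vietoris pair -/

namespace GOrder

variable {G X : Type*} [TopologicalSpace G] [TopologicalSpace X] [T2Space G] [T2Space X]
  {𝓖 : TopGroupoid G X}

/-- The `G`-order generated by a compact set. -/
def ofCompact {K : Set G} (hK : IsCompact K) : GOrder 𝓖 where
  carrier := (K ∪ 𝓖.inv ⁻¹' K) ∪ ((𝓖.unit ∘ 𝓖.src) '' K ∪ (𝓖.unit ∘ 𝓖.rng) '' K)
  unit_mem := by
    rintro γ ((h | h) | (⟨γ, h, rfl⟩ | ⟨γ, h, rfl⟩))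
    · exact Or.inr (Or.inl ⟨γ, h, rfl⟩)
    · exact Or.inr (Or.inr ⟨_, h, by simp [𝓖.rng_inv]⟩)
    · exact Or.inr (Or.inl ⟨γ, h, by simp [𝓖.src_unit]⟩)
    · exact Or.inr (Or.inr ⟨γ, h, by simp [𝓖.src_unit]⟩)
  inv_mem := by
    rintro γ ((h | h) | (⟨γ, h, rfl⟩ | ⟨γ, h, rfl⟩))
    · exact Or.inl (Or.inr (by rwa [Set.mem_preimage, 𝓖.inv_inv]))
    · exact Or.inl (Or.inl h)
    · exact Or.inr (Or.inl ⟨γ, h, by simp [𝓖.inv_unit]⟩)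
    · exact Or.inr (Or.inr ⟨γ, h, by simp [𝓖.inv_unit]⟩)
  isCompact Y hY := by
    have h1 : IsCompact (𝓖.inv ⁻¹' K) := by
      convert hK.image 𝓖.continuous_inv using 1
      ext γ
      constructor
      · intro h; exact ⟨𝓖.inv γ, h, 𝓖.inv_inv γ⟩
      · rintro ⟨γ, h, rfl⟩
        rw [Set.mem_preimage, 𝓖.inv_inv]; exact h
    exact ((hK.union h1).union ((hK.image (𝓖.continuous_unit.comp 𝓖.continuous_src)).union
      (hK.image (𝓖.continuous_unit.comp 𝓖.continuous_rng)))).inter_right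
        (hY.isClosed.preimage 𝓖.continuous_src)

theorem subset_ofCompact {K : Set G} (hK : IsCompact K) : K ⊆ (ofCompact (𝓖 := 𝓖) hK).carrier :=
  subset_union_left.trans subset_union_left

theorem setMul_subset_add (s s' : GOrder 𝓖) : 𝓖.setMul s.carrier s'.carrier ⊆ (s + s').carrier :=
  fun _ h => Or.inl (Or.inl h)

theorem le_add_self (s : GOrder 𝓖) : s ≤ s + s := fun γ h =>
  setMul_subset_add s s ⟨γ, h, _, s.unit_mem γ h, (𝓖.rng_unit _).symm, (𝓖.mul_unit γ).symm⟩

end GOrder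

namespace GAlgebra

variable {G X A : Type*} [TopologicalSpace G] [TopologicalSpace X] [T2Space G]
  [LocallyCompactSpace G] [T2Space X] [MeasurableSpace G] [BorelSpace G] [NonUnitalCStarAlgebra A]
  {𝓖 : TopGroupoid G X} (𝓐 : GAlgebra 𝓖 A) (lam : HaarSystem 𝓖)

/-- A convolution belongs to the term of the filtration given by the `G`-order generated by its
support. -/
theorem exists_gOrder {S : Set G} {T : 𝓐.ReducedCrossedProduct lam}
    (hT : T ∈ 𝓐.convSubmodule lam S) :
    ∃ s : GOrder 𝓖, T ∈ 𝓐.supported lam s.carrier := by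
  obtain ⟨f, -, hf⟩ := (𝓐.mem_convOps_iff lam).1 hT
  exact ⟨GOrder.ofCompact (𝓐.isCompact_supp f.2), 𝓐.convSubmodule_le_supported lam _
    ⟨f.1, f.2, GOrder.subset_ofCompact _, hf⟩⟩

/-- The sections supported in the `G`-orders are all sections of compact support, whence the density of
the union. -/
theorem isFiltered_supported :
    IsFiltered fun s : GOrder 𝓖 => 𝓐.supported lam s.carrier where
  isClosed s := 𝓐.isClosed_supported lam _
  mono s s' h := 𝓐.supported_mono lam h
  star_mem s a ha := 𝓐.star_mem_supported lam s.inv_mem ha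
  mul_mem s s' a ha b hb := 𝓐.mul_mem_supported lam (GOrder.setMul_subset_add s s') ha hb
  dense := by
    intro T
    have h : T ∈ 𝓐.supported lam Set.univ := by rw [supported_univ]; trivial
    rw [mem_supported_iff] at h
    refine closure_mono (fun S hS => ?_) h
    exact mem_iUnion.2 (𝓐.exists_gOrder lam hS)

theorem isClosed_subgroupoidAlgebra (H : Subgroupoid 𝓖) :
    IsClosed (𝓐.subgroupoidAlgebra lam H : Set (𝓐.ReducedCrossedProduct lam)) := by
  rw [coe_subgroupoidAlgebra]
  exact 𝓐.isClosed_supported lam _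

theorem isFiltered_traceOn (H : Subgroupoid 𝓖) : IsFiltered fun s : GOrder 𝓖 =>
    traceOn (𝓐.subgroupoidAlgebra lam H) (𝓐.supported lam s.carrier) where
  isClosed s := (𝓐.isClosed_supported lam _).preimage continuous_subtype_val
  mono s s' h T hT := 𝓐.supported_mono lam h hT
  star_mem s a ha := 𝓐.star_mem_supported lam s.inv_mem ha
  mul_mem s s' a ha b hb := 𝓐.mul_mem_supported lam (GOrder.setMul_subset_add s s') ha hb
  dense := by
    rintro ⟨T, hT⟩
    rw [Topology.IsInducing.subtypeVal.closure_eq_preimage_closure_image]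
    have h := hT
    rw [mem_subgroupoidAlgebra, mem_supported_iff] at h
    refine closure_mono (fun S hS => ?_) h
    have hS' : S ∈ 𝓐.subgroupoidAlgebra lam H :=
      (𝓐.mem_subgroupoidAlgebra lam).2 (𝓐.convSubmodule_le_supported lam _ hS)
    exact ⟨⟨S, hS'⟩, mem_iUnion.2 (𝓐.exists_gOrder lam hS), rfl⟩

/-- Since `r^{*6} ⊆ r'` and `r'_V ⊆ H`, products of arrows of `r_V` with arrows of `r^{*5}`, on either
side, stay in `H`. -/
theorem isNeighborhoodAlgebra {r r' : GOrder 𝓖} (hr : r + r + r + r + r + r ≤ r') {V : Set X}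
    {H : Subgroupoid 𝓖} (hH : 𝓖.restrictSrc r'.carrier V ⊆ H.carrier) :
    IsNeighborhoodAlgebra (fun s : GOrder 𝓖 => 𝓐.supported lam s.carrier) r
      (𝓐.supported lam (𝓖.restrictSrc r.carrier V)) (𝓐.subgroupoidAlgebra lam H) := by
  have hmono : ∀ a b : GOrder 𝓖, a ≤ b → a + r ≤ b + r := fun a b h =>
    CoarseStructure.add_le_add' _ _ _ _ h le_rfl
  have h2 := r.le_add_self
  have h3 := hmono _ _ h2
  have h4 := hmono _ _ h3
  have h5 := hmono _ _ h4
  have h6 := hmono _ _ h5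
  have hrr' : r ≤ r' := h2.trans (h3.trans (h4.trans (h5.trans (h6.trans hr))))
  have h5r' : r + r + r + r + r ≤ r' := h6.trans hr
  set p := r + r + r + r + r with hp
  have hrH : 𝓖.restrictSrc r.carrier V ⊆ H.carrier := fun γ h => hH ⟨hrr' h.1, h.2⟩
  -- arrows of `p` with range in `V`
  have hpH : ∀ a ∈ p.carrier, 𝓖.rng a ∈ V → a ∈ H.carrier := by
    intro a ha haV
    rw [← 𝓖.inv_inv a]
    refine H.inv_mem _ (hH ⟨h5r' (p.inv_mem a ha), ?_⟩)
    rwa [Set.mem_preimage, 𝓖.src_inv]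
  have hleft : 𝓖.setMul p.carrier (𝓖.restrictSrc r.carrier V) ⊆ H.carrier := by
    rintro _ ⟨a, ha, d, hd, had, rfl⟩
    refine hH ⟨hr (GOrder.setMul_subset_add p r ⟨a, ha, d, hd.1, had, rfl⟩), ?_⟩
    rw [Set.mem_preimage, 𝓖.src_mul had]
    exact hd.2
  refine ⟨𝓐.isClosed_subgroupoidAlgebra lam H, 𝓐.isFiltered_traceOn lam H, ?_, ?_, ?_, ?_⟩
  · intro d hd
    exact (𝓐.mem_subgroupoidAlgebra lam).2 (𝓐.supported_mono lam hrH hd)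
  · intro d hd a ha
    exact (𝓐.mem_subgroupoidAlgebra lam).2 (𝓐.mul_mem_supported lam hleft ha hd)
  · intro d hd a ha
    refine (𝓐.mem_subgroupoidAlgebra lam).2 (𝓐.mul_mem_supported lam ?_ hd ha)
    rintro _ ⟨d, hd, a, ha, hda, rfl⟩
    exact H.mul_mem d (hrH hd) a (hpH a ha (hda ▸ hd.2)) hda
  · intro d hd a ha b hb
    refine (𝓐.mem_subgroupoidAlgebra lam).2 (𝓐.mul_mem_supported lam ?_
      (𝓐.mul_mem_supported lam Subset.rfl ha hd) hb)
    rintro _ ⟨_, ⟨a, ha, d, hd, had, rfl⟩, b, hb, hab, rfl⟩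
    refine H.mul_mem _ (hleft ⟨a, ha, d, hd, had, rfl⟩) b (hpH b hb ?_) hab
    rw [← hab, 𝓖.src_mul had]
    exact hd.2

/-- The action of a multiplier cuts supports down to the support of the multiplier. -/
theorem map_mem_supported {k : C(G, ℝ)}
    {Φ : 𝓐.ReducedCrossedProduct lam →L[ℂ] 𝓐.ReducedCrossedProduct lam}
    (hΦ : ∀ (f : 𝓐.Cc 𝓖.rng) T, 𝓐.IsConvolution lam f.1 (𝓐.incl lam T) →
        𝓐.IsConvolution lam (𝓐.mulFun 𝓖.continuous_rng k f).1 (𝓐.incl lam (Φ T)))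
    {S S' : Set G} (h : S ∩ tsupport k ⊆ S') {T : 𝓐.ReducedCrossedProduct lam}
    (hT : T ∈ 𝓐.supported lam S) : Φ T ∈ 𝓐.supported lam S' := by
  rw [mem_supported_iff] at *
  refine map_mem_closure Φ.continuous hT fun T hT => ?_
  obtain ⟨f, hf, hT⟩ := (𝓐.mem_convOps_iff lam).1 hT
  exact ⟨_, Subtype.prop _, (subset_inter ((𝓐.supp_mulFun_subset _ k f).trans hf)
    (𝓐.supp_mulFun_subset_tsupport _ k f)).trans h, hΦ f T hT⟩

/-- The multiplier given by a function on `X` composed with the source. -/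
theorem exists_multiplier_srcFun {φ : C(X, ℝ)} (hφ : ∀ x, |φ x| ≤ 1) :
    ∃ Φ : 𝓐.ReducedCrossedProduct lam →L[ℂ] 𝓐.ReducedCrossedProduct lam,
      (∀ (f : 𝓐.Cc 𝓖.rng) T, 𝓐.IsConvolution lam f.1 (𝓐.incl lam T) →
        𝓐.IsConvolution lam (𝓐.mulFun 𝓖.continuous_rng (srcFun 𝓖 φ) f).1 (𝓐.incl lam (Φ T))) ∧
      ∀ (n : ℕ) (x : CStarMatrix (Fin n) (Fin n) (𝓐.ReducedCrossedProduct lam)),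
        ‖x.map Φ‖ ≤ ‖x‖ := by
  refine 𝓐.exists_multiplier lam (𝓐.isContractiveMultiplier_srcFun lam hφ) ?_
  have : (srcFun 𝓖 φ).comp ⟨𝓖.inv, 𝓖.continuous_inv⟩ = rngFun 𝓖 φ := by
    ext γ
    simp [srcFun, rngFun, 𝓖.src_inv]
  rw [this]
  exact 𝓐.isContractiveMultiplier_rngFun lam hφ

/-- Multipliers by two functions of sum `1` add up to the identity. -/
theorem multiplier_add_eq {k₁ k₂ : C(G, ℝ)}
    {Φ₁ Φ₂ : 𝓐.ReducedCrossedProduct lam →L[ℂ] 𝓐.ReducedCrossedProduct lam}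
    (hΦ₁ : ∀ (f : 𝓐.Cc 𝓖.rng) T, 𝓐.IsConvolution lam f.1 (𝓐.incl lam T) →
        𝓐.IsConvolution lam (𝓐.mulFun 𝓖.continuous_rng k₁ f).1 (𝓐.incl lam (Φ₁ T)))
    (hΦ₂ : ∀ (f : 𝓐.Cc 𝓖.rng) T, 𝓐.IsConvolution lam f.1 (𝓐.incl lam T) →
        𝓐.IsConvolution lam (𝓐.mulFun 𝓖.continuous_rng k₂ f).1 (𝓐.incl lam (Φ₂ T)))
    (hk : ∀ γ, k₁ γ + k₂ γ = 1) (T : 𝓐.ReducedCrossedProduct lam) : Φ₁ T + Φ₂ T = T := by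
  have h : T ∈ 𝓐.supported lam Set.univ := by rw [supported_univ]; trivial
  rw [mem_supported_iff] at h
  have hcl : IsClosed {T | (Φ₁ + Φ₂) T = T} := isClosed_eq (Φ₁ + Φ₂).continuous continuous_id
  refine closure_minimal (fun T hT => ?_) hcl h
  obtain ⟨f, -, hf⟩ := (𝓐.mem_convOps_iff lam).1 hT
  have h12 := (hΦ₁ f T hf).add 𝓐 lam (hΦ₂ f T hf)
  have e : 𝓐.mulFun 𝓖.continuous_rng k₁ f + 𝓐.mulFun 𝓖.continuous_rng k₂ f = f := by
    ext γ
    change (k₁ γ : ℂ) • f.1 γ + (k₂ γ : ℂ) • f.1 γ = f.1 γ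
    rw [← add_smul, ← Complex.ofReal_add, hk, Complex.ofReal_one, one_smul]
  rw [e] at h12
  exact 𝓐.incl_injective lam (h12.eq 𝓐 lam hf)

/-- A partition of unity decomposes the elements supported in `r`, completely contractively. -/
theorem isCompleteCoerciveDecompositionPair (r : GOrder 𝓖) {V₁ V₂ : Set X}
    (hV : ∃ φ : PartitionOfUnity (Fin 2) X Set.univ, φ.IsSubordinate ![V₁, V₂]) :
    IsCompleteCoerciveDecompositionPair (fun s : GOrder 𝓖 => 𝓐.supported lam s.carrier) r
      (𝓐.supported lam (𝓖.restrictSrc r.carrier V₁))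
      (𝓐.supported lam (𝓖.restrictSrc r.carrier V₂)) 2 := by
  refine ⟨𝓐.isClosed_supported lam _, 𝓐.isClosed_supported lam _,
    𝓐.supported_mono lam inter_subset_left, 𝓐.supported_mono lam inter_subset_left, ?_⟩
  intro s hs n x hx
  obtain ⟨φ, hφ⟩ := hV
  have habs : ∀ i x, |φ i x| ≤ 1 := fun i x => by
    rw [abs_of_nonneg (φ.nonneg i x)]
    exact φ.le_one i x
  have hsum : ∀ x, φ 0 x + φ 1 x = 1 := fun x => by
    have := φ.sum_eq_one (Set.mem_univ x)
    rwa [finsum_eq_sum_of_fintype, Fin.sum_univ_two] at this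
  obtain ⟨Φ₁, hΦ₁, hn₁⟩ := 𝓐.exists_multiplier_srcFun lam (habs 0)
  obtain ⟨Φ₂, hΦ₂, hn₂⟩ := 𝓐.exists_multiplier_srcFun lam (habs 1)
  have hmem : ∀ (V : Set X) (i : Fin 2), tsupport (φ i) ⊆ V →
      s.carrier ∩ tsupport (srcFun 𝓖 (φ i)) ⊆ 𝓖.restrictSrc r.carrier V := by
    rintro V i hi γ ⟨h1, h2⟩
    exact ⟨hs h1, hi (tsupport_comp_subset_preimage (φ i) 𝓖.continuous_src h2)⟩
  have hadd := 𝓐.multiplier_add_eq lam hΦ₁ hΦ₂ fun γ => hsum (𝓖.src γ)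
  have htwo : ∀ y : CStarMatrix (Fin n) (Fin n) (𝓐.ReducedCrossedProduct lam), ‖y‖ ≤ ‖x‖ →
      ‖y‖ ≤ 2 * ‖x‖ := fun y h => by linarith [norm_nonneg x]
  refine ⟨x.map Φ₁, x.map Φ₂, fun i j => ⟨𝓐.map_mem_supported lam hΦ₁ (hmem V₁ 0 (hφ 0)) (hx i j),
      𝓐.map_mem_supported lam hΦ₁ inter_subset_left (hx i j)⟩,
    fun i j => ⟨𝓐.map_mem_supported lam hΦ₂ (hmem V₂ 1 (hφ 1)) (hx i j),
      𝓐.map_mem_supported lam hΦ₂ inter_subset_left (hx i j)⟩, htwo _ (hn₁ n x), htwo _ (hn₂ n x), ?_⟩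
  ext i j
  exact (hadd (x i j)).symm

/-- Given matrices `x` and `y` of elements of `D₁` and `D₂`, the matrix `x` is almost fixed by a
multiplier supported in `H₁`, and this multiplier carries `y` to the intersection. -/
theorem hasCIA [LocallyCompactSpace X] {H₁ H₂ : Subgroupoid 𝓖} (hH₁ : H₁.IsRelativelyClopen)
    (s : GOrder 𝓖) :
    HasCIA ((𝓐.subgroupoidAlgebra lam H₁ : Set (𝓐.ReducedCrossedProduct lam)) ∩
        𝓐.supported lam s.carrier)
      ((𝓐.subgroupoidAlgebra lam H₂ : Set (𝓐.ReducedCrossedProduct lam)) ∩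
        𝓐.supported lam s.carrier) 2 := by
  intro ε hε n x y hx hy hxy
  obtain ⟨x', hx', hxx'⟩ : ∃ x' : CStarMatrix (Fin n) (Fin n) (𝓐.ReducedCrossedProduct lam),
      (∀ i j, x' i j ∈ (𝓐.convSubmodule lam H₁.carrier : Set (𝓐.ReducedCrossedProduct lam))) ∧
        ‖x - x'‖ < (ε - ‖x - y‖) / 2 := by
    have hcl := CStarMatrix.mem_closure_of_forall (x := x) fun i j =>
      (𝓐.mem_supported_iff lam).1 ((𝓐.mem_subgroupoidAlgebra lam).1 (hx i j).1)
    obtain ⟨x', h, h'⟩ := Metric.mem_closure_iff.1 hcl ((ε - ‖x - y‖) / 2) (by linarith)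
    exact ⟨x', h, by rwa [← dist_eq_norm]⟩
  have hf : ∀ i j, ∃ f : 𝓐.Cc 𝓖.rng, 𝓐.supp f.1 ⊆ H₁.carrier ∧
      𝓐.IsConvolution lam f.1 (𝓐.incl lam (x' i j)) := fun i j =>
    (𝓐.mem_convOps_iff lam).1 (hx' i j)
  choose f hfH hf using hf
  -- the cut-off function is `1` at the sources and ranges of the supports
  set L : Set X := ⋃ i, ⋃ j, (𝓖.src '' 𝓐.supp (f i j).1 ∪ 𝓖.rng '' 𝓐.supp (f i j).1) with hL
  have hLc : IsCompact L := isCompact_iUnion fun i => isCompact_iUnion fun j =>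
    ((𝓐.isCompact_supp (f i j).2).image 𝓖.continuous_src).union
      ((𝓐.isCompact_supp (f i j).2).image 𝓖.continuous_rng)
  have hLH : L ⊆ H₁.unitSpace := by
    refine iUnion_subset fun i => iUnion_subset fun j => union_subset ?_ ?_
    · rintro _ ⟨γ, hγ, rfl⟩
      have := H₁.mul_mem _ (H₁.inv_mem γ (hfH i j hγ)) γ (hfH i j hγ) (𝓖.src_inv γ)
      rwa [𝓖.inv_mul] at this
    · rintro _ ⟨γ, hγ, rfl⟩
      have := H₁.mul_mem γ (hfH i j hγ) _ (H₁.inv_mem γ (hfH i j hγ)) (𝓖.rng_inv γ).symm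
      rwa [𝓖.mul_inv] at this
  obtain ⟨φ, hφ1, -, hφH, hφ⟩ := exists_continuousMap_one_of_isCompact_subset_isOpen hLc
    hH₁.1.2 hLH
  have habs : ∀ x, |φ x| ≤ 1 := fun x => by
    rw [abs_of_nonneg (hφ x).1]
    exact (hφ x).2
  have hk := 𝓐.isContractiveMultiplier_cutoff lam hH₁ hφH habs
  obtain ⟨Φ, hΦ, hΦn⟩ := 𝓐.exists_multiplier lam hk
    (by rw [Subgroupoid.cutoff_comp_inv]; exact hk)
  have hΦx' : x'.map Φ = x' := by
    ext i j
    refine 𝓐.incl_injective lam (IsConvolution.eq 𝓐 lam (f := f i j) ?_ (hf i j))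
    have e : 𝓐.mulFun 𝓖.continuous_rng (Subgroupoid.cutoff hH₁ hφH) (f i j) = f i j := by
      ext γ
      change (Subgroupoid.cutoff hH₁ hφH γ : ℂ) • (f i j).1 γ = (f i j).1 γ
      by_cases hγ : γ ∈ 𝓐.supp (f i j).1
      · have h1 : 𝓖.src γ ∈ L := mem_iUnion₂.2 ⟨i, j, Or.inl ⟨γ, hγ, rfl⟩⟩
        have h2 : 𝓖.rng γ ∈ L := mem_iUnion₂.2 ⟨i, j, Or.inr ⟨γ, hγ, rfl⟩⟩
        rw [Subgroupoid.cutoff_of_mem hH₁ hφH (hfH i j hγ), hφ1 h1, hφ1 h2]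
        simp
      · rw [CXAlgebra.eq_zero_of_notMem_supp _ hγ, smul_zero]
    have := hΦ (f i j) _ (hf i j)
    rwa [e] at this
  have hsub : ∀ a b : CStarMatrix (Fin n) (Fin n) (𝓐.ReducedCrossedProduct lam),
      ‖a.map Φ - b.map Φ‖ ≤ ‖a - b‖ := fun a b => by
    have e : a.map Φ - b.map Φ = (a - b).map Φ := by
      ext i j
      exact (map_sub Φ _ _).symm
    rw [e]
    exact hΦn n _
  have h1 : ‖y.map Φ - x‖ ≤ ‖x - y‖ + 2 * ‖x - x'‖ := by
    have e : y.map Φ - x = (y.map Φ - x.map Φ) + (x.map Φ - x'.map Φ) - (x - x') := by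
      rw [hΦx']; abel
    rw [e]
    have h2 := hsub y x
    have h3 := hsub x x'
    have h4 := norm_sub_le ((y.map Φ - x.map Φ) + (x.map Φ - x'.map Φ)) (x - x')
    have h5 := norm_add_le (y.map Φ - x.map Φ) (x.map Φ - x'.map Φ)
    rw [norm_sub_rev y x] at h2
    linarith
  have h2 : ‖y.map Φ - y‖ ≤ ‖y.map Φ - x‖ + ‖x - y‖ := by
    have := norm_add_le (y.map Φ - x) (x - y)
    rwa [sub_add_sub_cancel] at this
  refine ⟨y.map Φ, fun i j => ?_, by linarith, by linarith⟩
  have hyij := hy i j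
  have hcut := Subgroupoid.tsupport_cutoff_subset hH₁ hφH
  refine ⟨⟨(𝓐.mem_subgroupoidAlgebra lam).2 ?_, ?_⟩, (𝓐.mem_subgroupoidAlgebra lam).2 ?_, ?_⟩
  · exact 𝓐.map_mem_supported lam hΦ (inter_subset_right.trans hcut) hyij.2
  · exact 𝓐.map_mem_supported lam hΦ inter_subset_left hyij.2
  · exact 𝓐.map_mem_supported lam hΦ inter_subset_left ((𝓐.mem_subgroupoidAlgebra lam).1 hyij.1)
  · exact 𝓐.map_mem_supported lam hΦ inter_subset_left hyij.2

end GAlgebra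

theorem theorem3 {G X A : Type*} [TopologicalSpace G] [T2Space G] [LocallyCompactSpace G]
    [TopologicalSpace X] [T2Space X] [LocallyCompactSpace X] [MeasurableSpace G] [BorelSpace G]
    [NonUnitalCStarAlgebra A] (𝓖 : TopGroupoid G X) (lam : HaarSystem 𝓖) (𝓐 : GAlgebra 𝓖 A)
    (r r' : GOrder 𝓖) (hr : r + r + r + r + r + r ≤ r') (V₁ V₂ : Set X) (H₁ H₂ : Subgroupoid 𝓖)
    (h : IsCoerciveDecomposition r' V₁ V₂ H₁ H₂) :
    IsControlledMayerVietorisPair (fun s : GOrder 𝓖 => 𝓐.supported lam s.carrier) r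
      (𝓐.supported lam (𝓖.restrictSrc r.carrier V₁)) (𝓐.supported lam (𝓖.restrictSrc r.carrier V₂))
      (𝓐.subgroupoidAlgebra lam H₁) (𝓐.subgroupoidAlgebra lam H₂) 2 where
  isFiltered := 𝓐.isFiltered_supported lam
  pos := two_pos
  decomposition := 𝓐.isCompleteCoerciveDecompositionPair lam r h.partition
  neighborhood₁ := 𝓐.isNeighborhoodAlgebra lam hr h.subset₁
  neighborhood₂ := 𝓐.isNeighborhoodAlgebra lam hr h.subset₂
  cia s := 𝓐.hasCIA lam h.isRelativelyClopen₁ s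

end
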